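/- Let $\mathfrak g$ be a finite-dimensional simple complex Lie algebra, $\mathfrak h\subset\mathfrak g$ a Cartan subalgebra, and $G$ the connected, simply connected complex Lie group with Lie algebra $\mathfrak g$, realized as a linear subgroup $G\subset SL(n,\mathbb C)$, so that $\mathfrak g\subset sl(n,\mathbb C)$; let $C\subset G$ be the Cartan subgroup with Lie algebra $\mathfrak h$. Let $w:\mathbb Z\to(0,\infty)$ satisfy $w(k+m)\le w(k)w(m)$, $w(-k)=w(k)$, $\lim_{k\to\infty}w(k)^{1/k}=1$, and $\lim_{k\to\infty}|k|^{-1/\lambda}\log w(k)=\infty$ for some $\lambda\in(1,2)$. Let $A_w$ be the Banach space of functions $f(z)=\sum_{k\in\mathbb Z}a_kz^k$ on the unit circle $S^1$ with $\|f\|_w=\sum_k|a_k|w(k)<\infty$, and norm $M_n(A_w)$ by $\|T\|_w=(\sum_{i,j}\|T_{ij}\|_w^2)^{1/2}$. Put $$L\mathfrak g=\{x\in M_n(A_w): x(z)\in\mathfrak g\ \forall z\in S^1\},\qquad LG=\{\gamma\in M_n(A_w):\gamma(z)\in G\ \forall z\in S^1\},$$ and let $\widehat{L\mathfrak g}=L\mathfrak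 g\times\mathbb C$ (the Banach space underlying the central extension of $L\mathfrak g$), which contains $\mathfrak h\times\mathbb C$ through constant loops. Let $D=z\,\frac{d}{dz}$. Elements $(\phi,p)$ and $(\phi',p')$ of $\widehat{L\mathfrak g}$ are gauge-conjugate if there is $\gamma\in LG$ with $$(\phi',p')=\bigl(\gamma\phi\gamma^{-1}+p\,\gamma D(\gamma^{-1}),\,p\bigr).$$ For $p\ne0$ the monodromy of $(\phi,p)$ is $f(2\pi)\in G$, where $f:\mathbb R\to G$ solves $\dot f(t)f(t)^{-1}=\frac1{ip}\phi(e^{it})$, $f(0)=1$. The element $(\phi,p)$ is loop-regular if $p\neq0$ and its monodromy $M$ is regular, that is, $\{g\in G:gMg^{-1}=M\}$ is conjugate in $G$ to $C$. **Proposition.** Let $(\psi,q)\in\widehat{L\mathfrak g}$ be loop-regular and let $(\xi,q)\in\mathfrak h\times\mathbb C^\times$ be gauge-conjugate to $(\psi,q)$. Then there exist an open set $U\subset\widehat{L\mathfrak g}$ containing $(\psi,q)$, all of whose elements are loop-regular and which contains with each element all elements gauge-conjugate to it, and a smooth ($C^\infty$ over $\mathbb R$) map $\eta:U\to\mathfrak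 h\times\mathbb C^\times$ which takes the same value at any two gauge-conjugate elements of $U$, such that $\eta(\psi,q)=(\xi,q)$ and $\eta(\phi,p)$ is gauge-conjugate to $(\phi,p)$ for every $(\phi,p)\in U$. -/

import Mathlib

open scoped ContDiff

/- Matrices (in particular matrices over the Wiener algebra below) carry the norm
`‖T‖ = (∑ i j, ‖T i j‖ ^ 2) ^ (1 / 2)`. -/
attribute [local instance] Matrix.frobeniusNormedAddCommGroup Matrix.frobeniusNormedSpace

/- The Lie bracket of matrices is the commutator. -/
attribute [local instance 100] LieRing.ofAssociativeRing

noncomputable section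

namespace LoopToda

/-- A symmetric weight function on `ℤ` which is of non-analytic type and rapidly increasing. -/
structure Weight where
  toFun : ℤ → ℝ
  pos' : ∀ k, 0 < toFun k
  submul' : ∀ k m, toFun (k + m) ≤ toFun k * toFun m
  symm' : ∀ k, toFun (-k) = toFun k
  nonanalytic' :
    Filter.Tendsto (fun k : ℕ => toFun (k : ℤ) ^ (1 / (k : ℝ))) Filter.atTop (nhds 1)
  rapid' : ∃ r : ℝ, 1 < r ∧ r < 2 ∧
    Filter.Tendsto (fun k : ℕ => (k : ℝ) ^ (-(1 / r)) * Real.log (toFun (k : ℤ)))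
      Filter.atTop Filter.atTop

instance : CoeFun Weight (fun _ => ℤ → ℝ) := ⟨Weight.toFun⟩

theorem Weight.one_le (w : Weight) (k : ℤ) : 1 ≤ w k := by
  have h0 : w 0 ≤ w 0 * w 0 := by simpa using w.submul' 0 0
  have h1 : w 0 ≤ w k * w k := by simpa [w.symm' k] using w.submul' k (-k)
  have p0 := w.pos' 0
  have pk := w.pos' k
  have h2 : 1 ≤ w 0 := by nlinarith
  nlinarith

/-- The sequences `(a_k)_{k ∈ ℤ}` with `∑ |a_k| w(k) < ∞`. -/
def wienerSubmodule (w : Weight) : Submodule ℂ (ℤ → ℂ) where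
  carrier := {a | Summable fun k => ‖a k‖ * w k}
  zero_mem' := by simp [summable_zero]
  add_mem' := by
    intro a b ha hb
    refine Summable.of_nonneg_of_le
      (fun k => mul_nonneg (norm_nonneg _) (w.pos' k).le) (fun k => ?_) (ha.add hb)
    rw [← add_mul]
    exact mul_le_mul_of_nonneg_right (norm_add_le _ _) (w.pos' k).le
  smul_mem' := by
    intro c a ha
    have h := Summable.mul_left ‖c‖ ha
    refine h.congr (fun k => ?_)
    simp [mul_assoc]

/-- The space `A_w` of functions `f(z) = ∑ a_k z ^ k` on the unit circle with
`‖f‖ = ∑ |a_k| w(k) < ∞`; a function is given by its (unique) coefficient sequence. -/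
def Wiener (w : Weight) : Type := wienerSubmodule w

namespace Wiener

variable {w : Weight}

instance : AddCommGroup (Wiener w) := inferInstanceAs (AddCommGroup (wienerSubmodule w))

instance : Module ℂ (Wiener w) := inferInstanceAs (Module ℂ (wienerSubmodule w))

/-- The coefficient `a_k`. -/
def coeff (f : Wiener w) (k : ℤ) : ℂ := f.1 k

theorem coeff_add (f g : Wiener w) (k : ℤ) : (f + g).coeff k = f.coeff k + g.coeff k := rfl

theorem coeff_smul (c : ℂ) (f : Wiener w) (k : ℤ) : (c • f).coeff k = c * f.coeff k := rfl

theorem coeff_zero (k : ℤ) : (0 : Wiener w).coeff k = 0 := rfl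

theorem coeff_neg (f : Wiener w) (k : ℤ) : (-f).coeff k = -f.coeff k := rfl

theorem ext_coeff {f g : Wiener w} (h : ∀ k, f.coeff k = g.coeff k) : f = g :=
  Subtype.ext (funext h)

theorem summable_weighted (f : Wiener w) : Summable fun k => ‖f.coeff k‖ * w k := f.2

instance : NormedAddCommGroup (Wiener w) :=
  AddGroupNorm.toNormedAddCommGroup
    { toFun := fun f => ∑' k, ‖f.coeff k‖ * w k
      map_zero' := by simp [coeff_zero]
      add_le' := by
        intro f g
        rw [← f.summable_weighted.tsum_add g.summable_weighted]
        refine (f + g).summable_weighted.tsum_le_tsum (fun k => ?_)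
          (f.summable_weighted.add g.summable_weighted)
        rw [← add_mul, coeff_add]
        exact mul_le_mul_of_nonneg_right (norm_add_le _ _) (w.pos' k).le
      neg' := by
        intro f
        simp [coeff_neg]
      eq_zero_of_map_eq_zero' := by
        intro f hf
        apply ext_coeff
        intro k
        have h := (hasSum_zero_iff_of_nonneg
          (fun k => mul_nonneg (norm_nonneg _) (w.pos' k).le)).1
          (hf ▸ f.summable_weighted.hasSum)
        have hk := congrFun h k
        simpa [(w.pos' k).ne', coeff_zero] using hk }

theorem norm_def (f : Wiener w) : ‖f‖ = ∑' k, ‖f.coeff k‖ * w k := rfl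

instance : NormedSpace ℂ (Wiener w) where
  norm_smul_le := by
    intro c f
    rw [norm_def, norm_def, ← tsum_mul_left]
    simp [coeff_smul, mul_assoc]

/-- The value `f(z) = ∑ a_k z ^ k` at a point of the unit circle. -/
def eval (f : Wiener w) (z : Circle) : ℂ := ∑' k : ℤ, f.coeff k * (z : ℂ) ^ k

theorem summable_eval (f : Wiener w) (z : Circle) :
    Summable fun k : ℤ => f.coeff k * (z : ℂ) ^ k := by
  refine Summable.of_norm_bounded f.summable_weighted (fun k => ?_)
  rw [norm_mul, norm_zpow, Circle.norm_coe, one_zpow]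
  exact mul_le_mul_of_nonneg_left (w.one_le k) (norm_nonneg _)

theorem eval_add (f g : Wiener w) (z : Circle) : (f + g).eval z = f.eval z + g.eval z := by
  unfold eval
  rw [← (f.summable_eval z).tsum_add (g.summable_eval z)]
  simp [coeff_add, add_mul]

theorem eval_smul (c : ℂ) (f : Wiener w) (z : Circle) : (c • f).eval z = c * f.eval z := by
  unfold eval
  rw [← tsum_mul_left]
  simp [coeff_smul, mul_assoc]

theorem eval_zero (z : Circle) : (0 : Wiener w).eval z = 0 := by
  simp [eval, coeff_zero]

/-- The constant function `c`. -/
def const (w : Weight) (c : ℂ) : Wiener w :=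
  ⟨Pi.single 0 c, by
    refine summable_of_ne_finset_zero (s := {0}) (fun k hk => ?_)
    have hk0 : k ≠ 0 := by simpa using hk
    simp [Pi.single_eq_of_ne hk0]⟩

theorem eval_const (c : ℂ) (z : Circle) : (const w c).eval z = c := by
  unfold eval
  rw [tsum_eq_single 0]
  · simp [coeff, const]
  · intro k hk
    simp [coeff, const, Pi.single_eq_of_ne hk]

end Wiener

variable {n : ℕ}

/-- The Banach space `M_n(A_w)`. -/
def MatWiener (n : ℕ) (w : Weight) : Type := Matrix (Fin n) (Fin n) (Wiener w)

instance (w : Weight) : NormedAddCommGroup (MatWiener n w) :=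
  inferInstanceAs (NormedAddCommGroup (Matrix (Fin n) (Fin n) (Wiener w)))

instance (w : Weight) : NormedSpace ℂ (MatWiener n w) :=
  inferInstanceAs (NormedSpace ℂ (Matrix (Fin n) (Fin n) (Wiener w)))

theorem MatWiener.norm_def {w : Weight} (T : MatWiener n w) :
    ‖T‖ = (∑ i, ∑ j, ‖T i j‖ ^ (2 : ℝ)) ^ (1 / 2 : ℝ) :=
  Matrix.frobenius_norm_def (α := Wiener w) T

/-- The element of `M_n(A_w)` with the given entries. -/
def MatWiener.of {w : Weight} (T : Fin n → Fin n → Wiener w) : MatWiener n w := Matrix.of T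

/-- The value `T(z) ∈ M_n(ℂ)` of `T ∈ M_n(A_w)` at a point of the unit circle. -/
def MatWiener.eval {w : Weight} (T : MatWiener n w) (z : Circle) : Matrix (Fin n) (Fin n) ℂ :=
  Matrix.of fun i j => (T i j).eval z

/-- The connected Lie subgroup of `SL(n, ℂ)` whose Lie algebra is the (Lie) subspace `V`: the
subgroup generated by the exponentials of the elements of `V`. -/
def expSubgroup (V : Set (Matrix (Fin n) (Fin n) ℂ)) :
    Subgroup (Matrix.SpecialLinearGroup (Fin n) ℂ) :=
  Subgroup.closure {g | ∃ x ∈ V, (g : Matrix (Fin n) (Fin n) ℂ) = NormedSpace.exp x}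

/-- The connected linear group `G` with Lie algebra `𝔤`. -/
abbrev linGroup (𝔤 : LieSubalgebra ℂ (Matrix (Fin n) (Fin n) ℂ)) :
    Subgroup (Matrix.SpecialLinearGroup (Fin n) ℂ) :=
  expSubgroup (𝔤 : Set (Matrix (Fin n) (Fin n) ℂ))

/-- The underlying matrix of an element of `G`. -/
def linGroup.mat {𝔤 : LieSubalgebra ℂ (Matrix (Fin n) (Fin n) ℂ)} (g : linGroup 𝔤) :
    Matrix (Fin n) (Fin n) ℂ :=
  (g : Matrix.SpecialLinearGroup (Fin n) ℂ).1

/-- The Cartan subgroup of `G` corresponding to `𝔥`: the connected subgroup with Lie algebra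
`𝔥`. -/
def cartanSubgroup {𝔤 : LieSubalgebra ℂ (Matrix (Fin n) (Fin n) ℂ)} (𝔥 : LieSubalgebra ℂ 𝔤) :
    Subgroup (linGroup 𝔤) :=
  (expSubgroup ((fun x : 𝔤 => (x : Matrix (Fin n) (Fin n) ℂ)) '' (𝔥 : Set 𝔤))).subgroupOf
    (linGroup 𝔤)

/-- The loop algebra `L𝔤`: the `x ∈ M_n(A_w)` with `x(z) ∈ 𝔤` for all `z` in the unit circle. -/
def loopAlgebra (𝔤 : LieSubalgebra ℂ (Matrix (Fin n) (Fin n) ℂ)) (w : Weight) :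
    Submodule ℂ (MatWiener n w) where
  carrier := {x | ∀ z : Circle, x.eval z ∈ 𝔤}
  zero_mem' := by
    intro z
    have h : MatWiener.eval (0 : MatWiener n w) z = 0 := by
      ext i j
      exact Wiener.eval_zero z
    rw [h]
    exact 𝔤.zero_mem
  add_mem' := by
    intro x y hx hy z
    have h : MatWiener.eval (x + y) z = MatWiener.eval x z + MatWiener.eval y z := by
      ext i j
      exact Wiener.eval_add _ _ z
    rw [h]
    exact 𝔤.add_mem (hx z) (hy z)
  smul_mem' := by
    intro c x hx z
    have h : MatWiener.eval (c • x) z = c • MatWiener.eval x z := by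
      ext i j
      exact Wiener.eval_smul _ _ z
    rw [h]
    exact 𝔤.smul_mem c (hx z)

/-- The loop group `LG`: the `γ ∈ M_n(A_w)` with `γ(z) ∈ G` for all `z` in the unit circle. -/
def loopGroup (𝔤 : LieSubalgebra ℂ (Matrix (Fin n) (Fin n) ℂ)) (w : Weight) :
    Set (MatWiener n w) :=
  {γ | ∀ z : Circle, ∃ g : linGroup 𝔤, linGroup.mat g = γ.eval z}

/-- The Banach space `L𝔤 × ℂ` underlying the centrally extended loop algebra. -/
abbrev ExtLoopAlgebra (𝔤 : LieSubalgebra ℂ (Matrix (Fin n) (Fin n) ℂ)) (w : Weight) : Type :=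
  loopAlgebra 𝔤 w × ℂ

/-- The derivation `D = z d/dz`, that is `-i d/dθ`, applied entrywise to functions on the unit
circle. -/
def circleD (f : Circle → Matrix (Fin n) (Fin n) ℂ) (z : Circle) : Matrix (Fin n) (Fin n) ℂ :=
  Matrix.of fun i j => -Complex.I * deriv (fun t : ℝ => f (Circle.exp t * z) i j) 0

section

variable {𝔤 : LieSubalgebra ℂ (Matrix (Fin n) (Fin n) ℂ)} {w : Weight}

/-- `y` is obtained from `x` by the gauge action of some `γ ∈ LG`: if `x = (φ, p)` then
`y = (γ φ γ⁻¹ + p γ D(γ⁻¹), p)`. (The weight grows rapidly, so loops in `LG` are smooth.) -/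
def GaugeConj (x y : ExtLoopAlgebra 𝔤 w) : Prop :=
  ∃ γ ∈ loopGroup 𝔤 w, y.2 = x.2 ∧
    ∀ z : Circle, MatWiener.eval y.1.1 z =
      γ.eval z * MatWiener.eval x.1.1 z * (γ.eval z)⁻¹ +
        x.2 • (γ.eval z * circleD (fun ζ => (γ.eval ζ)⁻¹) z)

/-- `f : ℝ → G` solves the monodromy equation `f' f⁻¹ = (1 / (i p)) φ(e^{it})`, `f(0) = 1`. -/
def SolvesMonodromy (x : ExtLoopAlgebra 𝔤 w) (f : ℝ → linGroup 𝔤) : Prop :=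
  f 0 = 1 ∧ ∀ t : ℝ, ∃ f' : Matrix (Fin n) (Fin n) ℂ,
    (∀ i j, HasDerivAt (fun s => linGroup.mat (f s) i j) (f' i j) t) ∧
      f' * (linGroup.mat (f t))⁻¹ =
        (1 / (Complex.I * x.2)) • MatWiener.eval x.1.1 (Circle.exp t)

/-- `M ∈ G` is the monodromy of `x = (φ, p)`. -/
def IsMonodromy (x : ExtLoopAlgebra 𝔤 w) (M : linGroup 𝔤) : Prop :=
  ∃ f : ℝ → linGroup 𝔤, SolvesMonodromy x f ∧ f (2 * Real.pi) = M

/-- `M ∈ G` is regular: the set of `g ∈ G` with `g M g⁻¹ = M` is conjugate in `G` to the Cartan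
subgroup. -/
def IsRegularElement (𝔥 : LieSubalgebra ℂ 𝔤) (M : linGroup 𝔤) : Prop :=
  ∃ g : linGroup 𝔤,
    Subgroup.centralizer {M} = (cartanSubgroup 𝔥).map (MulAut.conj g).toMonoidHom

/-- `(φ, p)` is loop-regular: `p ≠ 0` and its monodromy is regular. -/
def LoopRegular (𝔥 : LieSubalgebra ℂ 𝔤) (x : ExtLoopAlgebra 𝔤 w) : Prop :=
  x.2 ≠ 0 ∧ ∃ M : linGroup 𝔤, IsMonodromy x M ∧ IsRegularElement 𝔥 M

/-- The constant loop with value `μ ∈ 𝔤`. -/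
def constLoop (w : Weight) (μ : 𝔤) : loopAlgebra 𝔤 w :=
  ⟨MatWiener.of fun i j => Wiener.const w ((μ : Matrix (Fin n) (Fin n) ℂ) i j), by
    intro z
    have h : MatWiener.eval (MatWiener.of fun i j =>
        Wiener.const w ((μ : Matrix (Fin n) (Fin n) ℂ) i j)) z = μ := by
      ext i j
      exact Wiener.eval_const _ z
    rw [h]
    exact μ.2⟩

/-- The inclusion of `𝔥 × ℂ` into `L𝔤 × ℂ` through constant loops. -/
def cartanIncl {𝔥 : LieSubalgebra ℂ 𝔤} (w : Weight) (y : 𝔥 × ℂ) : ExtLoopAlgebra 𝔤 w :=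
  (constLoop w (y.1 : 𝔤), y.2)

end

end LoopToda

end

/-! The proof is a slice theorem for the gauge action near the constant loop `(ξ, q)`, followed by
transport along gauge orbits.

Existence of a slice. Consider `(u, h, p) ↦ exp(u) · (h, p)`, where `u` runs over 𝔤-valued loops
with one more derivative (weight `w.diff`) whose zeroth Fourier coefficient lies in the image of `ad
ξ`. Its derivative at `(0, ξ, q)` sends `(u, η, s)` to `([u, ξ] + η - q Du, s)`. On the `k`-th
Fourier mode this is `x ↦ [x, ξ] - qk x`, with `η` added for `k = 0`. The monodromy of `(ξ, q)` is
`exp(2πξ/(iq))`, and a solution of `[x, ξ] = qk x` commutes with it, so regularity forces `x ∈ 𝔥`;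
thus the mode operator is invertible for `k ≠ 0`, while for `k = 0` it has kernel `𝔥`, complemented
by its image. For large `|k|` its inverse is `O(1/|k|)`, which is exactly the derivative gained in
`w.diff`. So the derivative is bijective between Banach spaces (`RegPoint.eq_zero_of_linGauge`,
`RegPoint.exists_linGauge_eq`), and the inverse function theorem yields a smooth local `η`
(`RegPoint.exists_slice`).

Invariance. Gauge-conjugate elements have monodromies conjugate in `G` (`IsMonodromy.gauge`). If two
points of `𝔥 × ℂ` near `(ξ, q)` have monodromies conjugate by `a`, then regularity makes `a`
normalize `𝔥`. Normalizing elements act on `𝔥` in finitely many ways, because they permute the roots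
(`finite_normalizer_action`), so by continuity `a` must fix the monodromy of `(ξ, q)` itself
(`eventually_conj_fixes`). Hence `a` lies in the Cartan subgroup, the two monodromies agree, and
local injectivity of `exp` identifies the points. The same argument applied to one point shows that
nearby points are regular (`exists_nhds_regular`).

Globalization. `U` is the union of the gauge orbits meeting the slice neighbourhood, and `η` is
extended to be constant on orbits. A fixed gauge transformation taking one element with `p ≠ 0` to
another acts by a continuous linear map of `L𝔤 × ℂ` (`GaugeConj.exists_continuousLinearMap`), so
openness and smoothness spread from the neighbourhood to `U` (`exists_invariant_map`). -/

noncomputable section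

namespace LoopToda

/-! ### Weights: gaining one derivative, and growth at least linear. -/

namespace Weight

variable (w : Weight)

/-- The weight `(1 + |k|) w(k)`, whose Wiener algebra consists of functions with derivative in
the Wiener algebra of `w`. -/
def diff : Weight where
  toFun k := (1 + |(k : ℝ)|) * w k
  pos' k := mul_pos (by positivity) (w.pos' k)
  submul' k m := by
    have h1 : 1 + |((k + m : ℤ) : ℝ)| ≤ (1 + |(k : ℝ)|) * (1 + |(m : ℝ)|) := by
      push_cast
      nlinarith [abs_add_le (k : ℝ) m, mul_nonneg (abs_nonneg (k : ℝ)) (abs_nonneg (m : ℝ))]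
    calc (1 + |((k + m : ℤ) : ℝ)|) * w (k + m)
        ≤ ((1 + |(k : ℝ)|) * (1 + |(m : ℝ)|)) * (w k * w m) :=
          mul_le_mul h1 (w.submul' k m) (w.pos' _).le (by positivity)
      _ = _ := by ring
  symm' k := by simp [w.symm' k]
  nonanalytic' := by
    have h1 : Filter.Tendsto (fun k : ℕ => (1 + (k : ℝ)) ^ (1 / (k : ℝ))) Filter.atTop
        (nhds 1) := by
      have h := (tendsto_rpow_div_mul_add 1 1 (-1) one_ne_zero.symm).comp
        (Filter.tendsto_atTop_add_const_left Filter.atTop (1 : ℝ)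
          (tendsto_natCast_atTop_atTop (R := ℝ)))
      refine h.congr (fun k => ?_)
      simp
    have h2 := h1.mul w.nonanalytic'
    rw [one_mul] at h2
    refine h2.congr (fun k => ?_)
    rw [Real.mul_rpow (by positivity) (w.pos' _).le]
    simp
  rapid' := by
    obtain ⟨r, h1, h2, h⟩ := w.rapid'
    refine ⟨r, h1, h2, Filter.tendsto_atTop_mono (fun k => ?_) h⟩
    refine mul_le_mul_of_nonneg_left (Real.log_le_log (w.pos' _) ?_) (by positivity)
    have := w.pos' (k : ℤ)
    have h0 : (0 : ℝ) ≤ |((k : ℤ) : ℝ)| := abs_nonneg _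
    nlinarith

theorem diff_apply (k : ℤ) : w.diff k = (1 + |(k : ℝ)|) * w k := rfl

theorem le_diff (k : ℤ) : w k ≤ w.diff k := by
  rw [diff_apply]
  nlinarith [w.pos' k, abs_nonneg (k : ℝ), mul_nonneg (abs_nonneg (k : ℝ)) (w.pos' k).le]

theorem abs_mul_le_diff (k : ℤ) : |(k : ℝ)| * w k ≤ w.diff k := by
  rw [diff_apply]
  nlinarith [w.pos' k]

/-- Rapid growth gives `w k ≥ exp(k ^ (1/r)) ≥ k ^ (2/r) / 2`, and `r < 2` makes the exponent at
least 1. This is what makes every function in the Wiener algebra differentiable. -/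
theorem eventually_abs_le : ∀ᶠ k : ℤ in Filter.cofinite, |(k : ℝ)| ≤ 2 * w k := by
  obtain ⟨r, h1, h2, h⟩ := w.rapid'
  have key : ∀ᶠ k : ℕ in Filter.atTop, (k : ℝ) ≤ 2 * w k := by
    filter_upwards [h.eventually_ge_atTop 1, Filter.eventually_ge_atTop 1] with k hk hk1
    have hk0 : (1 : ℝ) ≤ k := by exact_mod_cast hk1
    have hkp : (0 : ℝ) < k := by linarith
    set x : ℝ := (k : ℝ) ^ (1 / r) with hx
    have hxp : 0 < x := Real.rpow_pos_of_pos hkp _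
    have hlog : x ≤ Real.log (w k) := by
      rw [Real.rpow_neg hkp.le, ← hx] at hk
      rwa [← div_eq_inv_mul, le_div_iff₀ hxp, one_mul] at hk
    have hexp : Real.exp x ≤ w k := by
      rw [← Real.exp_log (w.pos' k)]
      exact Real.exp_le_exp.2 hlog
    have hsq : (k : ℝ) ≤ x ^ 2 := by
      rw [hx, ← Real.rpow_natCast, ← Real.rpow_mul hkp.le]
      conv_lhs => rw [← Real.rpow_one (k : ℝ)]
      refine Real.rpow_le_rpow_of_exponent_le hk0 ?_
      rw [div_mul_eq_mul_div, le_div_iff₀ (by linarith)]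
      push_cast
      linarith
    have := Real.quadratic_le_exp_of_nonneg hxp.le
    nlinarith
  obtain ⟨N, hN⟩ := Filter.eventually_atTop.1 key
  refine (Set.finite_Icc (-(N : ℤ)) N).subset (fun k hk => ?_)
  by_contra hc
  apply hk
  have hk' : N ≤ k.natAbs := by
    simp only [Set.mem_Icc] at hc
    omega
  have h3 := hN _ hk'
  have h4 : w (k.natAbs : ℤ) = w k := by
    rcases Int.natAbs_eq k with h | h
    · rw [← h]
    · conv_rhs => rw [h, w.symm']
  rw [h4] at h3
  simpa [Nat.cast_natAbs] using h3

end Weight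

/-! ### The Wiener algebra as a commutative Banach algebra, with its derivation. -/

namespace Wiener

variable {w : Weight}

@[ext] theorem ext' {f g : Wiener w} (h : ∀ k, f.coeff k = g.coeff k) : f = g := ext_coeff h

/-- The element of the Wiener algebra with the given coefficients. -/
def mk (a : ℤ → ℂ) (h : Summable fun k => ‖a k‖ * w k) : Wiener w := ⟨a, h⟩

@[simp] theorem coeff_mk (a : ℤ → ℂ) (h : Summable fun k => ‖a k‖ * w k) (k : ℤ) :
    (mk a h).coeff k = a k := rfl

theorem weighted_nonneg (f : Wiener w) (k : ℤ) : 0 ≤ ‖f.coeff k‖ * w k :=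
  mul_nonneg (norm_nonneg _) (w.pos' k).le

theorem summable_norm (f : Wiener w) : Summable fun k => ‖f.coeff k‖ := by
  refine Summable.of_nonneg_of_le (fun k => norm_nonneg _) (fun k => ?_) f.summable_weighted
  exact le_mul_of_one_le_right (norm_nonneg _) (w.one_le k)

/-- The reindexing `(k, j) ↦ (j, k - j)` of a double sum in a convolution. -/
def convEquiv : ℤ × ℤ ≃ ℤ × ℤ where
  toFun p := (p.2, p.1 - p.2)
  invFun p := (p.1 + p.2, p.1)
  left_inv p := by ext <;> simp
  right_inv p := by ext <;> simp

theorem summable_conv (f g : Wiener w) : Summable fun p : ℤ × ℤ =>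
    (‖f.coeff p.2‖ * w p.2) * (‖g.coeff (p.1 - p.2)‖ * w (p.1 - p.2)) :=
  (convEquiv.summable_iff (f := fun p : ℤ × ℤ =>
    (‖f.coeff p.1‖ * w p.1) * (‖g.coeff p.2‖ * w p.2))).2
    (f.summable_weighted.mul_of_nonneg g.summable_weighted f.weighted_nonneg g.weighted_nonneg)

theorem norm_conv_le (f g : Wiener w) (k j : ℤ) : ‖f.coeff j * g.coeff (k - j)‖ * w k ≤
    (‖f.coeff j‖ * w j) * (‖g.coeff (k - j)‖ * w (k - j)) := by
  have h : w k ≤ w j * w (k - j) := by simpa using w.submul' j (k - j)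
  calc ‖f.coeff j * g.coeff (k - j)‖ * w k
      ≤ (‖f.coeff j‖ * ‖g.coeff (k - j)‖) * (w j * w (k - j)) := by
        rw [norm_mul]
        exact mul_le_mul_of_nonneg_left h (by positivity)
    _ = _ := by ring

theorem summable_conv_weighted (f g : Wiener w) : Summable fun p : ℤ × ℤ =>
    ‖f.coeff p.2 * g.coeff (p.1 - p.2)‖ * w p.1 :=
  Summable.of_nonneg_of_le (fun _ => mul_nonneg (norm_nonneg _) (w.pos' _).le)
    (fun p => norm_conv_le f g p.1 p.2) (summable_conv f g)

theorem norm_tsum_conv_le (f g : Wiener w) (k : ℤ) :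
    ‖∑' j, f.coeff j * g.coeff (k - j)‖ * w k ≤
      ∑' j, ‖f.coeff j * g.coeff (k - j)‖ * w k := by
  have h := (summable_conv_weighted f g).prod_factor k
  rw [tsum_mul_right]
  refine mul_le_mul_of_nonneg_right (norm_tsum_le_tsum_norm ?_) (w.pos' k).le
  exact (summable_mul_right_iff (w.pos' k).ne').1 h

scoped instance : Mul (Wiener w) where
  mul f g := mk (fun k => ∑' j, f.coeff j * g.coeff (k - j))
    (Summable.of_nonneg_of_le (fun k => mul_nonneg (norm_nonneg _) (w.pos' k).le)
      (norm_tsum_conv_le f g) (summable_conv_weighted f g).prod)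

theorem coeff_mul (f g : Wiener w) (k : ℤ) :
    (f * g).coeff k = ∑' j, f.coeff j * g.coeff (k - j) := rfl

theorem norm_mul_le' (f g : Wiener w) : ‖f * g‖ ≤ ‖f‖ * ‖g‖ := by
  have h1 := summable_conv_weighted f g
  have h2 := summable_conv f g
  calc ‖f * g‖ ≤ ∑' k, ∑' j, ‖f.coeff j * g.coeff (k - j)‖ * w k :=
        (f * g).summable_weighted.tsum_le_tsum (norm_tsum_conv_le f g) h1.prod
    _ = ∑' p : ℤ × ℤ, ‖f.coeff p.2 * g.coeff (p.1 - p.2)‖ * w p.1 := h1.tsum_prod.symm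
    _ ≤ ∑' p : ℤ × ℤ,
          (‖f.coeff p.2‖ * w p.2) * (‖g.coeff (p.1 - p.2)‖ * w (p.1 - p.2)) :=
        h1.tsum_le_tsum (fun p => norm_conv_le f g p.1 p.2) h2
    _ = ∑' p : ℤ × ℤ, (‖f.coeff p.1‖ * w p.1) * (‖g.coeff p.2‖ * w p.2) :=
        convEquiv.tsum_eq (fun p : ℤ × ℤ => (‖f.coeff p.1‖ * w p.1) * (‖g.coeff p.2‖ * w p.2))
    _ = ‖f‖ * ‖g‖ := by
        rw [norm_def, norm_def]
        exact (f.summable_weighted.tsum_mul_tsum g.summable_weighted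
          (f.summable_weighted.mul_of_nonneg g.summable_weighted f.weighted_nonneg
            g.weighted_nonneg)).symm

theorem summable_norm_eval (f : Wiener w) (z : Circle) :
    Summable fun k : ℤ => ‖f.coeff k * (z : ℂ) ^ k‖ :=
  f.summable_norm.congr (fun k => by
    rw [norm_mul, norm_zpow, Circle.norm_coe, one_zpow, mul_one])

theorem eval_mul (f g : Wiener w) (z : Circle) : (f * g).eval z = f.eval z * g.eval z := by
  have hf := f.summable_norm_eval z
  have hg := g.summable_norm_eval z
  obtain ⟨G, hG⟩ : ∃ G : ℤ × ℤ → ℂ, ∀ p, G p =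
      (f.coeff p.1 * (z : ℂ) ^ p.1) * (g.coeff p.2 * (z : ℂ) ^ p.2) := ⟨_, fun _ => rfl⟩
  have hs : Summable G := (summable_mul_of_summable_norm hf hg).congr (fun p => (hG p).symm)
  have hs' : Summable (G ∘ convEquiv) := convEquiv.summable_iff.2 hs
  have key : ∀ k j : ℤ, f.coeff j * g.coeff (k - j) * (z : ℂ) ^ k = (G ∘ convEquiv) (k, j) := by
    intro k j
    have h1 : (z : ℂ) ^ k = (z : ℂ) ^ j * (z : ℂ) ^ (k - j) := by
      rw [← zpow_add₀ (Circle.coe_ne_zero z)]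
      simp
    have h2 : (G ∘ convEquiv) (k, j) = G (j, k - j) := rfl
    rw [h1, h2, hG]
    ring
  have h1 : (f * g).eval z = ∑' k, ∑' j, (G ∘ convEquiv) (k, j) := by
    refine tsum_congr (fun k => ?_)
    rw [coeff_mul, ← tsum_mul_right]
    exact tsum_congr (key k)
  rw [h1, ← hs'.tsum_prod]
  change ∑' p, G (convEquiv p) = _
  rw [convEquiv.tsum_eq G]
  exact (tsum_congr hG).trans (tsum_mul_tsum_of_summable_norm hf hg).symm

/-- The Fourier series converges absolutely in the continuous functions, hence in `L²`; pairing with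
the `m`-th orthonormal character isolates the coefficient. Consequently identities in the algebra,
including the ring axioms, can be checked pointwise on the circle. -/
theorem coeff_eq_zero_of_eval_eq_zero (f : Wiener w) (h : ∀ z, f.eval z = 0) (m : ℤ) :
    f.coeff m = 0 := by
  have : Fact (0 < 2 * Real.pi) := ⟨Real.two_pi_pos⟩
  have hs : Summable fun k : ℤ =>
      f.coeff k • (fourier k : C(AddCircle (2 * Real.pi), ℂ)) := by
    refine Summable.of_norm (f.summable_norm.congr (fun k => ?_))
    rw [norm_smul, fourier_norm, mul_one]
  have h0 : ∑' k : ℤ, f.coeff k • (fourier k : C(AddCircle (2 * Real.pi), ℂ)) = 0 := by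
    ext θ
    rw [← ContinuousMap.tsum_apply hs]
    have h1 := h (AddCircle.toCircle θ)
    simpa [eval, fourier_apply, AddCircle.toCircle_zsmul] using h1
  have hsum := hs.hasSum
  rw [h0] at hsum
  have h1 := hsum.mapL (ContinuousMap.toLp (E := ℂ) 2
    (AddCircle.haarAddCircle (T := 2 * Real.pi)) ℂ)
  have h2 := h1.mapL (innerSL ℂ (fourierLp (T := 2 * Real.pi) 2 m))
  have h3 : ∀ k : ℤ, (innerSL ℂ (fourierLp (T := 2 * Real.pi) 2 m))
      (ContinuousMap.toLp (E := ℂ) 2 (AddCircle.haarAddCircle (T := 2 * Real.pi)) ℂ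
        (f.coeff k • fourier k)) = if k = m then f.coeff k else 0 := by
    intro k
    have h4 := orthonormal_iff_ite.1 (orthonormal_fourier (T := 2 * Real.pi)) m k
    rw [map_smul, map_smul]
    change f.coeff k • inner ℂ (fourierLp (T := 2 * Real.pi) 2 m) (fourierLp 2 k) = _
    rw [h4]
    simp [eq_comm]
  simp only [h3, map_zero] at h2
  have h5 := h2.unique (hasSum_ite_eq m (f.coeff m) |>.congr_fun (fun k => by
    by_cases hk : k = m <;> simp [hk]))
  exact h5.symm

theorem eval_sub (f g : Wiener w) (z : Circle) : (f - g).eval z = f.eval z - g.eval z := by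
  rw [eq_sub_iff_add_eq, ← eval_add, sub_add_cancel]

theorem ext_eval {f g : Wiener w} (h : ∀ z, f.eval z = g.eval z) : f = g := by
  rw [← sub_eq_zero]
  ext k
  rw [coeff_zero]
  exact coeff_eq_zero_of_eval_eq_zero _ (fun z => by rw [eval_sub, h, sub_self]) k

scoped instance : One (Wiener w) := ⟨const w 1⟩

@[simp] theorem eval_one (z : Circle) : (1 : Wiener w).eval z = 1 := eval_const 1 z

scoped instance : CommRing (Wiener w) where
  __ := (inferInstance : AddCommGroup (Wiener w))
  mul_assoc f g h := ext_eval fun z => by simp only [eval_mul, mul_assoc]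
  mul_comm f g := ext_eval fun z => by simp only [eval_mul, mul_comm]
  one_mul f := ext_eval fun z => by rw [eval_mul, eval_one, one_mul]
  mul_one f := ext_eval fun z => by rw [eval_mul, eval_one, mul_one]
  zero_mul f := ext_eval fun z => by rw [eval_mul, eval_zero, zero_mul]
  mul_zero f := ext_eval fun z => by rw [eval_mul, eval_zero, mul_zero]
  left_distrib f g h := ext_eval fun z => by simp only [eval_mul, eval_add, mul_add]
  right_distrib f g h := ext_eval fun z => by simp only [eval_mul, eval_add, add_mul]

scoped instance : NormedCommRing (Wiener w) where
  __ := (inferInstance : NormedAddCommGroup (Wiener w))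
  __ := (inferInstance : CommRing (Wiener w))
  norm_mul_le := norm_mul_le'

scoped instance : Algebra ℂ (Wiener w) :=
  Algebra.ofModule
    (fun c f g => ext_eval fun z => by simp only [eval_mul, eval_smul, mul_assoc])
    (fun c f g => ext_eval fun z => by simp only [eval_mul, eval_smul, mul_left_comm])

/-- The isometry of the Wiener algebra with `ℓ¹(ℤ)`. -/
def toLp : Wiener w ≃ᵢ lp (fun _ : ℤ => ℂ) 1 where
  toFun f := ⟨fun k => f.coeff k * w k, memℓp_gen (by
    simpa [abs_of_pos (w.pos' _)] using f.summable_weighted)⟩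
  invFun g := mk (fun k => g k / w k) (by
    have h := lp.memℓp g
    rw [memℓp_gen_iff (by simp)] at h
    refine h.congr (fun k => ?_)
    simp [abs_of_pos (w.pos' k), (w.pos' k).ne'])
  left_inv f := by
    ext k
    simp [(w.pos' k).ne']
  right_inv g := by
    ext k
    simp [(w.pos' k).ne']
  isometry_toFun := by
    refine Isometry.of_dist_eq (fun f g => ?_)
    rw [dist_eq_norm, dist_eq_norm, lp.norm_eq_tsum_rpow (by simp), norm_def]
    simp only [ENNReal.toReal_one, Real.rpow_one, div_one]
    refine tsum_congr (fun k => ?_)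
    rw [lp.coeFn_sub]
    simp only [Pi.sub_apply]
    rw [← sub_mul, norm_mul, sub_eq_add_neg f g, coeff_add, coeff_neg, ← sub_eq_add_neg]
    simp [abs_of_pos (w.pos' k)]

scoped instance : CompleteSpace (Wiener w) := toLp.completeSpace

/-- Evaluation at a point as a ring homomorphism. -/
def evalHom (z : Circle) : Wiener w →+* ℂ where
  toFun f := f.eval z
  map_one' := eval_one z
  map_mul' f g := eval_mul f g z
  map_zero' := eval_zero z
  map_add' f g := eval_add f g z

theorem norm_eval_le (f : Wiener w) (z : Circle) : ‖f.eval z‖ ≤ ‖f‖ := by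
  refine (norm_tsum_le_tsum_norm (f.summable_norm_eval z)).trans ?_
  refine (f.summable_norm_eval z).tsum_le_tsum (fun k => ?_) f.summable_weighted
  rw [norm_mul, norm_zpow, Circle.norm_coe, one_zpow]
  exact mul_le_mul_of_nonneg_left (w.one_le k) (norm_nonneg _)

/-- Evaluation at a point as a continuous linear map. -/
def evalL (z : Circle) : Wiener w →L[ℂ] ℂ :=
  LinearMap.mkContinuous
    { toFun := fun f => f.eval z
      map_add' := fun f g => eval_add f g z
      map_smul' := fun c f => eval_smul c f z } 1 (fun f => by simpa using norm_eval_le f z)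

@[simp] theorem evalL_apply (z : Circle) (f : Wiener w) : evalL z f = f.eval z := rfl

/-- A coefficient as a continuous linear map. -/
def coeffL (k : ℤ) : Wiener w →L[ℂ] ℂ :=
  LinearMap.mkContinuous
    { toFun := fun f => f.coeff k
      map_add' := fun f g => coeff_add f g k
      map_smul' := fun c f => coeff_smul c f k } 1 (fun f => by
        rw [one_mul]
        refine le_trans ?_ (f.summable_weighted.le_tsum k (fun j _ => f.weighted_nonneg j))
        exact le_mul_of_one_le_right (norm_nonneg _) (w.one_le k))

@[simp] theorem coeffL_apply (k : ℤ) (f : Wiener w) : coeffL k f = f.coeff k := rfl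

theorem summable_diff_le (f : Wiener w.diff) (c : ℤ → ℂ)
    (hc : ∀ k, ‖c k‖ * w k ≤ w.diff k) : Summable fun k => ‖c k * f.coeff k‖ * w k := by
  refine Summable.of_nonneg_of_le (fun k => mul_nonneg (norm_nonneg _) (w.pos' k).le)
    (fun k => ?_) f.summable_weighted
  rw [norm_mul, mul_comm ‖c k‖, mul_assoc]
  exact mul_le_mul_of_nonneg_left (hc k) (norm_nonneg _)

/-- The Fourier multiplier with the coefficients `c`. -/
def multiplier (c : ℤ → ℂ) (hc : ∀ k, ‖c k‖ * w k ≤ w.diff k) : Wiener w.diff →L[ℂ] Wiener w :=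
  LinearMap.mkContinuous
    { toFun := fun f => mk (fun k => c k * f.coeff k) (summable_diff_le f c hc)
      map_add' := fun f g => by
        ext k
        simp [coeff_add, mul_add]
      map_smul' := fun a f => by
        ext k
        simp [coeff_smul, mul_left_comm] } 1 (fun f => by
          rw [one_mul]
          refine (summable_diff_le f c hc).tsum_le_tsum (fun k => ?_) f.summable_weighted
          change ‖c k * f.coeff k‖ * w k ≤ _
          rw [norm_mul, mul_comm ‖c k‖, mul_assoc]
          exact mul_le_mul_of_nonneg_left (hc k) (norm_nonneg _))

/-- The inclusion of the Wiener algebra of `w.diff` in that of `w`. -/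
def incl (w : Weight) : Wiener w.diff →L[ℂ] Wiener w :=
  multiplier (fun _ => 1) (fun k => by simpa using w.le_diff k)

/-- The derivation `z d/dz` from the Wiener algebra of `w.diff` to that of `w`. -/
def deriv (w : Weight) : Wiener w.diff →L[ℂ] Wiener w :=
  multiplier (fun k => (k : ℂ)) (fun k => by simpa using w.abs_mul_le_diff k)

@[simp] theorem coeff_incl (f : Wiener w.diff) (k : ℤ) : (incl w f).coeff k = f.coeff k := by
  simp [incl, multiplier]

@[simp] theorem coeff_deriv (f : Wiener w.diff) (k : ℤ) :
    (deriv w f).coeff k = k * f.coeff k := by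
  simp [deriv, multiplier]

@[simp] theorem eval_incl (f : Wiener w.diff) (z : Circle) :
    (incl w f).eval z = f.eval z := by simp [eval]

/-- This licenses termwise differentiation for the weight `w` itself, which is needed because loops
in `LG` are only assumed to have entries in `A_w`. -/
theorem summable_abs_mul (f : Wiener w) : Summable fun k : ℤ => |(k : ℝ)| * ‖f.coeff k‖ := by
  refine Summable.of_norm_bounded_eventually (f.summable_weighted.mul_left 2) ?_
  filter_upwards [w.eventually_abs_le] with k hk
  rw [norm_mul, norm_norm, Real.norm_eq_abs, abs_abs]
  calc |(k : ℝ)| * ‖f.coeff k‖ ≤ 2 * w k * ‖f.coeff k‖ :=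
        mul_le_mul_of_nonneg_right hk (norm_nonneg _)
    _ = _ := by ring

theorem hasDerivAt_eval_exp_mul (f : Wiener w) (z : Circle) (t : ℝ) :
    HasDerivAt (fun s : ℝ => f.eval (Circle.exp s * z))
      (Complex.I * ∑' k : ℤ, k * f.coeff k * ((Circle.exp t * z : Circle) : ℂ) ^ k) t := by
  have hd : ∀ (k : ℤ) (s : ℝ), HasDerivAt
      (fun s : ℝ => f.coeff k * ((Circle.exp s * z : Circle) : ℂ) ^ k)
      (Complex.I * (k * f.coeff k * ((Circle.exp s * z : Circle) : ℂ) ^ k)) s := by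
    intro k s
    have h1 : HasDerivAt (fun s : ℝ => Complex.exp ((k * s * Complex.I : ℂ)))
        (Complex.exp ((k * s * Complex.I : ℂ)) * (k * 1 * Complex.I)) s :=
      (((Complex.ofRealCLM.hasDerivAt (x := s)).const_mul (k : ℂ)).mul_const Complex.I).cexp
    have h2 := (h1.const_mul (f.coeff k)).mul_const ((z : ℂ) ^ k)
    have h3 : ∀ s : ℝ, ((Circle.exp s * z : Circle) : ℂ) ^ k =
        Complex.exp ((k * s * Complex.I : ℂ)) * (z : ℂ) ^ k := by
      intro s
      rw [Circle.coe_mul, mul_zpow, Circle.coe_exp, ← Complex.exp_int_mul]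
      ring_nf
    simp only [h3]
    convert! h2 using 1
    · ext s
      ring
    · ring
  have h := hasDerivAt_tsum f.summable_abs_mul hd (fun k s => by
      rw [norm_mul, Complex.norm_I, one_mul, norm_mul, norm_zpow, Circle.norm_coe, one_zpow,
        mul_one, norm_mul]
      simp) (y₀ := t) (f.summable_eval _) t
  rw [tsum_mul_left] at h
  exact h

theorem eval_deriv (f : Wiener w.diff) (z : Circle) :
    (deriv w f).eval z = -Complex.I * _root_.deriv (fun t : ℝ => f.eval (Circle.exp t * z)) 0 := by
  rw [(f.hasDerivAt_eval_exp_mul z 0).deriv, ← mul_assoc]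
  simp [eval]

theorem deriv_mul (f g : Wiener w.diff) :
    deriv w (f * g) = deriv w f * incl w g + incl w f * deriv w g := by
  refine ext_eval fun z => ?_
  have hf := f.hasDerivAt_eval_exp_mul z 0
  have hg := g.hasDerivAt_eval_exp_mul z 0
  have hfg := hf.mul hg
  rw [eval_add, eval_mul, eval_mul, eval_deriv, eval_deriv, eval_deriv]
  simp only [eval_mul]
  rw [hf.deriv, hg.deriv]
  erw [hfg.deriv]
  simp
  ring

end Wiener

end LoopToda

end

/-! ### Matrices over the Wiener algebra as a Banach algebra. -/

noncomputable section

namespace LoopToda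

open scoped Wiener

namespace MatWiener

variable {n : ℕ} {w : Weight}

/-- An entry of a matrix over the Wiener algebra. -/
def entry (T : MatWiener n w) (i j : Fin n) : Wiener w := T i j

@[ext] theorem ext' {S T : MatWiener n w} (h : ∀ i j, S.entry i j = T.entry i j) : S = T :=
  Matrix.ext h

theorem norm_eq (T : MatWiener n w) :
    ‖T‖ = (∑ i, ∑ j, ‖T.entry i j‖ ^ (2 : ℝ)) ^ (1 / 2 : ℝ) := norm_def T

scoped instance : Mul (MatWiener n w) := inferInstanceAs (Mul (Matrix (Fin n) (Fin n) (Wiener w)))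

scoped instance : One (MatWiener n w) := inferInstanceAs (One (Matrix (Fin n) (Fin n) (Wiener w)))

scoped instance : Ring (MatWiener n w) where
  __ := (inferInstance : AddCommGroup (MatWiener n w))
  mul_assoc := Matrix.mul_assoc (α := Wiener w)
  one_mul := Matrix.one_mul (α := Wiener w)
  mul_one := Matrix.mul_one (α := Wiener w)
  zero_mul := Matrix.zero_mul (α := Wiener w)
  mul_zero := Matrix.mul_zero (α := Wiener w)
  left_distrib := Matrix.mul_add (α := Wiener w)
  right_distrib := Matrix.add_mul (α := Wiener w)

theorem mul_apply (S T : MatWiener n w) (i j : Fin n) :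
    (S * T).entry i j = ∑ k, S.entry i k * T.entry k j := rfl

@[simp] theorem add_apply (S T : MatWiener n w) (i j : Fin n) :
    (S + T).entry i j = S.entry i j + T.entry i j := rfl

@[simp] theorem smul_apply (c : ℂ) (S : MatWiener n w) (i j : Fin n) :
    (c • S).entry i j = c • S.entry i j := rfl

@[simp] theorem of_apply (T : Fin n → Fin n → Wiener w) (i j : Fin n) :
    (of T).entry i j = T i j := rfl

/-- The matrix of the norms of the entries. -/
def normMat (T : MatWiener n w) : Matrix (Fin n) (Fin n) ℝ := Matrix.of fun i j => ‖T.entry i j‖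

theorem norm_normMat (T : MatWiener n w) : ‖normMat T‖ = ‖T‖ := by
  rw [Matrix.frobenius_norm_def, norm_eq]
  simp [normMat]

/-- Entrywise submultiplicativity reduces this to the Frobenius inequality for the real matrices of
entry norms. -/
theorem norm_mul_le' (S T : MatWiener n w) : ‖S * T‖ ≤ ‖S‖ * ‖T‖ := by
  rw [← norm_normMat S, ← norm_normMat T]
  refine le_trans ?_ (Matrix.frobenius_norm_mul _ _)
  rw [norm_eq, Matrix.frobenius_norm_def]
  refine Real.rpow_le_rpow (by positivity) ?_ (by norm_num)
  refine Finset.sum_le_sum fun i _ => Finset.sum_le_sum fun j _ => ?_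
  refine Real.rpow_le_rpow (norm_nonneg _) ?_ (by norm_num)
  rw [mul_apply]
  refine (norm_sum_le _ _).trans (le_trans (Finset.sum_le_sum fun k _ => norm_mul_le _ _) ?_)
  exact Real.le_norm_self _

scoped instance : NormedRing (MatWiener n w) where
  __ := (inferInstance : NormedAddCommGroup (MatWiener n w))
  __ := (inferInstance : Ring (MatWiener n w))
  norm_mul_le := norm_mul_le'

scoped instance : Algebra ℂ (MatWiener n w) :=
  Algebra.ofModule
    (fun c S T => by
      ext i j : 2
      simp [mul_apply, Finset.smul_sum])
    (fun c S T => by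
      ext i j : 2
      simp [mul_apply, Finset.smul_sum])

scoped instance : NormedAlgebra ℂ (MatWiener n w) where
  norm_smul_le := norm_smul_le

theorem norm_entry_le (T : MatWiener n w) (i j : Fin n) : ‖T.entry i j‖ ≤ ‖T‖ := by
  rw [norm_eq]
  have h : ‖T.entry i j‖ ^ (2 : ℝ) ≤ ∑ i, ∑ j, ‖T.entry i j‖ ^ (2 : ℝ) :=
    (Finset.single_le_sum (f := fun j => ‖T.entry i j‖ ^ (2 : ℝ)) (fun _ _ => by positivity)
      (Finset.mem_univ j)).trans
      (Finset.single_le_sum (f := fun i => ∑ j, ‖T.entry i j‖ ^ (2 : ℝ))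
        (fun _ _ => by positivity) (Finset.mem_univ i))
  calc ‖T.entry i j‖ = (‖T.entry i j‖ ^ (2 : ℝ)) ^ (1 / 2 : ℝ) := by
        rw [← Real.rpow_mul (norm_nonneg _)]
        norm_num
    _ ≤ _ := Real.rpow_le_rpow (by positivity) h (by norm_num)

/-- An entry as a continuous linear map. -/
def entryL (i j : Fin n) : MatWiener n w →L[ℂ] Wiener w :=
  LinearMap.mkContinuous
    { toFun := fun T => T.entry i j
      map_add' := fun _ _ => rfl
      map_smul' := fun _ _ => rfl } 1 (fun T => by
        rw [one_mul]
        exact norm_entry_le T i j)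

@[simp] theorem entryL_apply (i j : Fin n) (T : MatWiener n w) : entryL i j T = T.entry i j := rfl

/-- The matrix with a single non-zero entry. -/
def single (i j : Fin n) (f : Wiener w) : MatWiener n w := Matrix.single i j f

theorem single_apply (i j i' j' : Fin n) (f : Wiener w) :
    (single i j f).entry i' j' = if i = i' ∧ j = j' then f else 0 := Matrix.single_apply ..

theorem norm_single (i j : Fin n) (f : Wiener w) : ‖single i j f‖ = ‖f‖ := by
  rw [norm_eq]
  rw [Finset.sum_eq_single i, Finset.sum_eq_single j]
  · simp only [single_apply, and_self, if_true]
    rw [← Real.rpow_mul (norm_nonneg _)]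
    norm_num
  · intro b _ hb
    simp [single_apply, hb.symm]
  · simp
  · intro b _ hb
    simp [single_apply, hb.symm]
  · simp

/-- The matrix with a single non-zero entry, as a continuous linear map. -/
def singleL (i j : Fin n) : Wiener w →L[ℂ] MatWiener n w :=
  LinearMap.mkContinuous
    { toFun := fun f => single i j f
      map_add' := fun f g => by
        ext i' j' : 2
        simp only [single_apply, add_apply]
        split_ifs <;> simp
      map_smul' := fun c f => by
        ext i' j' : 2
        simp only [single_apply, smul_apply, RingHom.id_apply]
        split_ifs <;> simp } 1 (fun T => by
          rw [one_mul]
          exact (norm_single i j T).le)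

@[simp] theorem singleL_apply (i j : Fin n) (f : Wiener w) :
    singleL i j f = single i j f := rfl

theorem sum_single (T : MatWiener n w) : ∑ i, ∑ j, single i j (T.entry i j) = T :=
  (Matrix.matrix_eq_sum_single (α := Wiener w) T).symm

/-- A continuous linear map with given entries. -/
def piL {E : Type*} [NormedAddCommGroup E] [NormedSpace ℂ E]
    (F : Fin n → Fin n → E →L[ℂ] Wiener w) : E →L[ℂ] MatWiener n w :=
  ∑ i, ∑ j, (singleL i j).comp (F i j)

@[simp] theorem piL_apply {E : Type*} [NormedAddCommGroup E] [NormedSpace ℂ E]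
    (F : Fin n → Fin n → E →L[ℂ] Wiener w) (x : E) (i j : Fin n) :
    (piL F x).entry i j = F i j x := by
  have h : piL F x = ∑ i, ∑ j, single i j ((of (fun i j => F i j x)).entry i j) := by
    simp [piL, _root_.sum_apply]
  rw [h, sum_single, of_apply]

/-- The map between matrices over Wiener algebras given by a map of the entries. -/
def mapL {w' : Weight} (F : Wiener w →L[ℂ] Wiener w') : MatWiener n w →L[ℂ] MatWiener n w' :=
  piL fun i j => F.comp (entryL i j)

@[simp] theorem mapL_apply {w' : Weight} (F : Wiener w →L[ℂ] Wiener w') (T : MatWiener n w)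
    (i j : Fin n) : (mapL F T).entry i j = F (T.entry i j) := by
  simp [mapL]

scoped instance : CompleteSpace (MatWiener n w) := by
  refine Metric.complete_of_cauchySeq_tendsto (fun u hu => ?_)
  have h : ∀ i j, ∃ a, Filter.Tendsto (fun k => (u k).entry i j) Filter.atTop (nhds a) := fun i j =>
    cauchySeq_tendsto_of_complete ((entryL i j).uniformContinuous.comp_cauchySeq hu)
  choose a ha using h
  refine ⟨of a, ?_⟩
  have h1 : Filter.Tendsto (fun k => ∑ i, ∑ j, singleL i j ((u k).entry i j)) Filter.atTop
      (nhds (∑ i, ∑ j, singleL i j (a i j))) :=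
    tendsto_finsetSum _ fun i _ => tendsto_finsetSum _ fun j _ =>
      ((singleL i j).continuous.tendsto _).comp (ha i j)
  simp only [singleL_apply, sum_single] at h1
  rwa [show ∑ i, ∑ j, single i j (a i j) = of a from sum_single (of a)] at h1

@[simp] theorem eval_apply (T : MatWiener n w) (z : Circle) (i j : Fin n) :
    T.eval z i j = (T.entry i j).eval z := rfl

theorem ext_eval {S T : MatWiener n w} (h : ∀ z, S.eval z = T.eval z) : S = T := by
  refine ext' fun i j => ?_
  exact Wiener.ext_eval fun z => congrFun (congrFun (h z) i) j

/-- Evaluation at a point as a ring homomorphism. -/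
def evalHom (z : Circle) : MatWiener n w →+* Matrix (Fin n) (Fin n) ℂ where
  toFun T := T.eval z
  map_one' := map_one ((Wiener.evalHom (w := w) z).mapMatrix (m := Fin n))
  map_mul' := map_mul ((Wiener.evalHom (w := w) z).mapMatrix (m := Fin n))
  map_zero' := map_zero ((Wiener.evalHom (w := w) z).mapMatrix (m := Fin n))
  map_add' := map_add ((Wiener.evalHom (w := w) z).mapMatrix (m := Fin n))

@[simp] theorem evalHom_apply (z : Circle) (T : MatWiener n w) : evalHom z T = T.eval z := rfl

@[simp] theorem eval_mul (S T : MatWiener n w) (z : Circle) :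
    (S * T).eval z = S.eval z * T.eval z := map_mul (evalHom z) S T

@[simp] theorem eval_one (z : Circle) : (1 : MatWiener n w).eval z = 1 := map_one (evalHom z)

@[simp] theorem eval_add (S T : MatWiener n w) (z : Circle) :
    (S + T).eval z = S.eval z + T.eval z := map_add (evalHom z) S T

@[simp] theorem eval_sub (S T : MatWiener n w) (z : Circle) :
    (S - T).eval z = S.eval z - T.eval z := map_sub (evalHom z) S T

@[simp] theorem eval_neg (S : MatWiener n w) (z : Circle) :
    (-S).eval z = -S.eval z := map_neg (evalHom z) S

@[simp] theorem eval_zero (z : Circle) : (0 : MatWiener n w).eval z = 0 := map_zero (evalHom z)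

@[simp] theorem eval_smul (c : ℂ) (S : MatWiener n w) (z : Circle) :
    (c • S).eval z = c • S.eval z := by
  ext i j
  simp [Wiener.eval_smul]

/-- Evaluation at a point as a continuous linear map. -/
def evalL (z : Circle) : MatWiener n w →L[ℂ] Matrix (Fin n) (Fin n) ℂ where
  toFun T := T.eval z
  map_add' S T := eval_add S T z
  map_smul' c S := eval_smul c S z
  cont := continuous_matrix fun i j =>
    (Wiener.evalL z).continuous.comp (entryL i j).continuous

@[simp] theorem evalL_apply (z : Circle) (T : MatWiener n w) : evalL z T = T.eval z := rfl

/-- The matrix of the `k`-th Fourier coefficients. -/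
def coeff (T : MatWiener n w) (k : ℤ) : Matrix (Fin n) (Fin n) ℂ :=
  Matrix.of fun i j => (T.entry i j).coeff k

@[simp] theorem coeff_apply (T : MatWiener n w) (k : ℤ) (i j : Fin n) :
    T.coeff k i j = (T.entry i j).coeff k := rfl

theorem ext_coeff {S T : MatWiener n w} (h : ∀ k, S.coeff k = T.coeff k) : S = T := by
  ext i j k
  exact congrFun (congrFun (h k) i) j

/-- A matrix of Fourier coefficients as a continuous linear map. -/
def coeffL (k : ℤ) : MatWiener n w →L[ℂ] Matrix (Fin n) (Fin n) ℂ where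
  toFun T := T.coeff k
  map_add' _ _ := rfl
  map_smul' _ _ := rfl
  cont := continuous_matrix fun i j =>
    (Wiener.coeffL k).continuous.comp (entryL i j).continuous

@[simp] theorem coeffL_apply (k : ℤ) (T : MatWiener n w) : coeffL k T = T.coeff k := rfl

/-- A matrix as a constant loop. -/
def const (w : Weight) (A : Matrix (Fin n) (Fin n) ℂ) : MatWiener n w :=
  of fun i j => Wiener.const w (A i j)

@[simp] theorem eval_const (A : Matrix (Fin n) (Fin n) ℂ) (z : Circle) :
    (const w A).eval z = A := by
  ext i j
  exact Wiener.eval_const _ z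

theorem coeff_const (A : Matrix (Fin n) (Fin n) ℂ) (k : ℤ) :
    (const w A).coeff k = if k = 0 then A else 0 := by
  ext i j
  have h : (Wiener.const w (A i j)).coeff k = (Pi.single 0 (A i j) : ℤ → ℂ) k := rfl
  rw [coeff_apply, const, of_apply, h, Pi.single_apply]
  split_ifs <;> rfl

/-- The map applying a linear functional on matrices to a loop of matrices. -/
def applyFunctional (l : Matrix (Fin n) (Fin n) ℂ →ₗ[ℂ] ℂ) : MatWiener n w →L[ℂ] Wiener w :=
  ∑ i, ∑ j, l (Matrix.single i j 1) • entryL i j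

theorem functional_eq_sum (l : Matrix (Fin n) (Fin n) ℂ →ₗ[ℂ] ℂ) (A : Matrix (Fin n) (Fin n) ℂ) :
    l A = ∑ i, ∑ j, l (Matrix.single i j 1) * A i j := by
  conv_lhs => rw [Matrix.matrix_eq_sum_single A]
  simp only [map_sum]
  refine Finset.sum_congr rfl fun i _ => Finset.sum_congr rfl fun j _ => ?_
  rw [show Matrix.single i j (A i j) = A i j • Matrix.single i j (1 : ℂ) by simp, map_smul,
    smul_eq_mul, mul_comm]

theorem eval_applyFunctional (l : Matrix (Fin n) (Fin n) ℂ →ₗ[ℂ] ℂ) (T : MatWiener n w)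
    (z : Circle) : (applyFunctional l T).eval z = l (T.eval z) := by
  rw [functional_eq_sum, ← Wiener.evalL_apply]
  simp [applyFunctional, _root_.sum_apply]

theorem coeff_applyFunctional (l : Matrix (Fin n) (Fin n) ℂ →ₗ[ℂ] ℂ) (T : MatWiener n w)
    (k : ℤ) : (applyFunctional l T).coeff k = l (T.coeff k) := by
  rw [functional_eq_sum, ← Wiener.coeffL_apply]
  simp [applyFunctional, _root_.sum_apply]

theorem mem_iff_functional (V : Submodule ℂ (Matrix (Fin n) (Fin n) ℂ))
    (A : Matrix (Fin n) (Fin n) ℂ) :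
    A ∈ V ↔ ∀ l : Matrix (Fin n) (Fin n) ℂ →ₗ[ℂ] ℂ, (∀ x ∈ V, l x = 0) → l A = 0 := by
  refine ⟨fun h l hl => hl A h, fun h => ?_⟩
  by_contra hA
  obtain ⟨f, hf, hfV⟩ := Submodule.exists_dual_map_eq_bot_of_notMem hA inferInstance
  refine hf (h f fun x hx => ?_)
  have : f x ∈ V.map f := Submodule.mem_map_of_mem hx
  rw [hfV] at this
  simpa using this

/-- A subspace is cut out by linear functionals, and a functional applied to `T` gives a scalar
function that vanishes exactly when all its Fourier coefficients do. This allows linear equations in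
`L𝔤` to be solved one mode at a time. -/
theorem eval_mem_iff_coeff_mem (V : Submodule ℂ (Matrix (Fin n) (Fin n) ℂ)) (T : MatWiener n w) :
    (∀ z, T.eval z ∈ V) ↔ ∀ k, T.coeff k ∈ V := by
  constructor
  · intro h k
    refine (mem_iff_functional V _).2 fun l hl => ?_
    rw [← coeff_applyFunctional]
    refine Wiener.coeff_eq_zero_of_eval_eq_zero _ (fun z => ?_) k
    rw [eval_applyFunctional]
    exact (mem_iff_functional V _).1 (h z) l hl
  · intro h z
    refine (mem_iff_functional V _).2 fun l hl => ?_
    rw [← eval_applyFunctional]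
    have h0 : applyFunctional l T = 0 := by
      ext k
      rw [coeff_applyFunctional, (mem_iff_functional V _).1 (h k) l hl, Wiener.coeff_zero]
    rw [h0, Wiener.eval_zero]

/-- The map applying a linear endomorphism of the space of matrices to a loop of matrices. -/
def applyLin (P : Matrix (Fin n) (Fin n) ℂ →ₗ[ℂ] Matrix (Fin n) (Fin n) ℂ) :
    MatWiener n w →L[ℂ] MatWiener n w :=
  piL fun i j => applyFunctional ((Matrix.entryLinearMap ℂ ℂ i j).comp P)

@[simp] theorem eval_applyLin (P : Matrix (Fin n) (Fin n) ℂ →ₗ[ℂ] Matrix (Fin n) (Fin n) ℂ)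
    (T : MatWiener n w) (z : Circle) : (applyLin P T).eval z = P (T.eval z) := by
  ext i j
  rw [eval_apply, applyLin, piL_apply, eval_applyFunctional]
  rfl

/-- The inclusion of the loops with derivative in the Wiener algebra. -/
def incl (n : ℕ) (w : Weight) : MatWiener n w.diff →L[ℂ] MatWiener n w := mapL (Wiener.incl w)

/-- The derivation `z d/dz`. -/
def deriv (n : ℕ) (w : Weight) : MatWiener n w.diff →L[ℂ] MatWiener n w := mapL (Wiener.deriv w)

@[simp] theorem eval_incl (T : MatWiener n w.diff) (z : Circle) :
    (incl n w T).eval z = T.eval z := by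
  ext i j
  simp [incl]

@[simp] theorem coeff_incl (T : MatWiener n w.diff) (k : ℤ) :
    (incl n w T).coeff k = T.coeff k := by
  ext i j
  simp [incl]

@[simp] theorem coeff_deriv (T : MatWiener n w.diff) (k : ℤ) :
    (deriv n w T).coeff k = (k : ℂ) • T.coeff k := by
  ext i j
  simp [deriv]

theorem incl_mul (S T : MatWiener n w.diff) : incl n w (S * T) = incl n w S * incl n w T :=
  ext_eval fun z => by simp

@[simp] theorem incl_one : incl n w 1 = 1 := ext_eval fun z => by simp

theorem deriv_mul (S T : MatWiener n w.diff) :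
    deriv n w (S * T) = deriv n w S * incl n w T + incl n w S * deriv n w T := by
  ext i j : 2
  simp only [deriv, incl, mapL_apply, mul_apply, add_apply, map_sum, Wiener.deriv_mul,
    Finset.sum_add_distrib]

@[simp] theorem deriv_one : deriv n w 1 = 0 := by
  have h := deriv_mul (1 : MatWiener n w.diff) 1
  simpa using h

theorem eval_deriv (T : MatWiener n w.diff) (z : Circle) :
    (deriv n w T).eval z = circleD T.eval z := by
  ext i j
  simp [deriv, circleD, Wiener.eval_deriv]

end MatWiener

end LoopToda

end

/-! ### Exponentials in Banach algebras, and the group generated by `exp 𝔤`. -/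

noncomputable section

namespace LoopToda

section BanachAlgebra

variable {𝔸 : Type*} [NormedRing 𝔸] [NormedAlgebra ℂ 𝔸] [CompleteSpace 𝔸]

theorem banach_exp_add {x y : 𝔸} (h : Commute x y) :
    NormedSpace.exp (x + y) = NormedSpace.exp x * NormedSpace.exp y := by
  let : NormedAlgebra ℚ 𝔸 := NormedAlgebra.restrictScalars ℚ ℂ 𝔸
  exact NormedSpace.exp_add_of_commute h

theorem banach_exp_mul_exp_neg (x : 𝔸) : NormedSpace.exp x * NormedSpace.exp (-x) = 1 := by
  rw [← banach_exp_add (Commute.neg_right (Commute.refl x)), add_neg_cancel,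
    NormedSpace.exp_zero]

theorem banach_map_exp {𝔹 : Type*} [NormedRing 𝔹] [NormedAlgebra ℂ 𝔹] (f : 𝔸 →+* 𝔹)
    (hf : Continuous f) (x : 𝔸) : f (NormedSpace.exp x) = NormedSpace.exp (f x) := by
  let : NormedAlgebra ℚ 𝔸 := NormedAlgebra.restrictScalars ℚ ℂ 𝔸
  let : NormedAlgebra ℚ 𝔹 := NormedAlgebra.restrictScalars ℚ ℂ 𝔹
  exact NormedSpace.map_exp f hf x

theorem banach_exp_continuous : Continuous (NormedSpace.exp : 𝔸 → 𝔸) := by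
  let : NormedAlgebra ℚ 𝔸 := NormedAlgebra.restrictScalars ℚ ℂ 𝔸
  exact NormedSpace.exp_continuous

/-- The derivative of `det` at 1 in the direction `A` is the trace, here zero, so by
multiplicativity `s ↦ det exp(sA)` has zero derivative everywhere. The homomorphism `e` keeps the
norm on the algebra separate from the matrix structure. -/
theorem banach_det_exp [FiniteDimensional ℂ 𝔸] {n : ℕ} (e : 𝔸 →ₐ[ℂ] Matrix (Fin n) (Fin n) ℂ)
    {A : 𝔸} (hA : (e A).trace = 0) : (e (NormedSpace.exp A)).det = 1 := by
  have hd : Differentiable ℂ (fun B : 𝔸 => (e B).det) := by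
    simp only [Matrix.det_apply]
    have h1 : ∀ i j, Differentiable ℂ (fun B : 𝔸 => e B i j) := fun i j =>
      (LinearMap.toContinuousLinearMap
        ((Matrix.entryLinearMap ℂ ℂ i j).comp e.toLinearMap)).differentiable
    refine Differentiable.fun_sum fun σ _ => ?_
    refine Differentiable.const_smul ?_ _
    intro B
    exact (HasFDerivAt.finsetProd (u := Finset.univ) (g := fun i (B : 𝔸) => e B (σ i) i)
      fun i _ => (h1 (σ i) i B).hasFDerivAt).differentiableAt
  have hD := (hd 1).hasFDerivAt
  have h1 : HasDerivAt (fun s : ℂ => (e (1 + s • A)).det)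
      (fderiv ℂ (fun B : 𝔸 => (e B).det) 1 A) 0 := by
    have h2 : HasDerivAt (fun s : ℂ => 1 + s • A) A 0 := by
      simpa using (((hasDerivAt_id (0 : ℂ)).smul_const A).const_add 1)
    exact HasFDerivAt.comp_hasDerivAt (l := fun B : 𝔸 => (e B).det) (0 : ℂ)
      (by simpa using hD) h2
  have h3 : HasDerivAt (fun s : ℂ => (e (1 + s • A)).det) 0 0 := by
    -- `p` is the remainder in `det(1 + sA) = 1 + s tr A + s² p(s)`.
    obtain ⟨p, hp⟩ : ∃ p : Polynomial ℂ, p =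
      (1 + (Polynomial.X : Polynomial ℂ) • (e A).map Polynomial.C).det.divX.divX := ⟨_, rfl⟩
    have h5 : HasDerivAt (fun s : ℂ => 1 + p.eval s * s ^ 2) 0 0 := by
      simpa using ((p.hasDerivAt (0 : ℂ)).mul (hasDerivAt_pow 2 (0 : ℂ))).const_add 1
    refine h5.congr_of_eventuallyEq (Filter.Eventually.of_forall fun s => ?_)
    simp only [map_add, map_one, map_smul]
    rw [Matrix.det_one_add_smul, hA, ← hp]
    simp
  have h4 : fderiv ℂ (fun B : 𝔸 => (e B).det) 1 A = 0 := h1.unique h3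
  have key : ∀ t : ℂ, HasDerivAt (fun s : ℂ => (e (NormedSpace.exp (s • A))).det) 0 t := by
    intro t
    have h0 : HasDerivAt (fun s : ℂ => NormedSpace.exp ((s - t) • A)) A t := by
      refine HasDerivAt.comp_sub_const (f := fun s : ℂ => NormedSpace.exp (s • A)) t t ?_
      simpa using hasDerivAt_exp_smul_const A (0 : ℂ)
    have h2 : HasDerivAt (fun s : ℂ => (e (NormedSpace.exp ((s - t) • A))).det) 0 t := by
      have h6 := HasFDerivAt.comp_hasDerivAt (l := fun B : 𝔸 => (e B).det) t
        (by simpa using hD) h0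
      rwa [h4] at h6
    have h5 := h2.const_mul (e (NormedSpace.exp (t • A))).det
    rw [mul_zero] at h5
    refine h5.congr_of_eventuallyEq (Filter.Eventually.of_forall fun s => ?_)
    change (e (NormedSpace.exp (s • A))).det =
      (e (NormedSpace.exp (t • A))).det * (e (NormedSpace.exp ((s - t) • A))).det
    rw [← Matrix.det_mul, ← map_mul, ← banach_exp_add, ← add_smul]
    · simp
    · exact ((Commute.refl A).smul_left _).smul_right _
  have h := is_const_of_deriv_eq_zero (fun t => (key t).differentiableAt)
    (fun t => (key t).deriv) 1 0
  simpa using h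

theorem exp_apply_eq {R : 𝔸 →L[ℂ] 𝔸} {T : 𝔸 →L[ℂ] 𝔸} {x y : 𝔸}
    (h : ∀ k : ℕ, (R ^ k) y = T (x ^ k)) : NormedSpace.exp R y = T (NormedSpace.exp x) := by
  have h1 := (NormedSpace.exp_series_hasSum_exp' (𝕂 := ℂ) R).mapL (ContinuousLinearMap.apply ℂ 𝔸 y)
  have h2 := (NormedSpace.exp_series_hasSum_exp' (𝕂 := ℂ) x).mapL T
  refine h1.unique (h2.congr_fun fun k => ?_)
  rw [map_smul, map_smul, ContinuousLinearMap.apply_apply, h]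

/-- This is `Ad(exp x) = exp(ad x)`: left multiplication by `x` and right multiplication by `-x`
commute, so the exponential of their sum factors. -/
theorem banach_exp_conj_eq (x y : 𝔸) :
    NormedSpace.exp x * y * NormedSpace.exp (-x) =
      NormedSpace.exp (ContinuousLinearMap.mul ℂ 𝔸 x +
        (ContinuousLinearMap.mul ℂ 𝔸).flip (-x)) y := by
  have hc : Commute (ContinuousLinearMap.mul ℂ 𝔸 x) ((ContinuousLinearMap.mul ℂ 𝔸).flip (-x)) := by
    ext1 y
    simp [mul_assoc]
  have h1 : NormedSpace.exp ((ContinuousLinearMap.mul ℂ 𝔸).flip (-x)) y =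
      y * NormedSpace.exp (-x) := by
    refine exp_apply_eq (T := ContinuousLinearMap.mul ℂ 𝔸 y) fun k => ?_
    induction k with
    | zero => simp
    | succ k ih =>
      rw [pow_succ', mul_apply_eq_comp, ih, pow_succ]
      simp [mul_assoc]
  have h2 : ∀ v : 𝔸, NormedSpace.exp (ContinuousLinearMap.mul ℂ 𝔸 x) v =
      NormedSpace.exp x * v := by
    intro v
    refine exp_apply_eq (T := (ContinuousLinearMap.mul ℂ 𝔸).flip v) fun k => ?_
    induction k with
    | zero => simp
    | succ k ih =>
      rw [pow_succ', mul_apply_eq_comp, ih, pow_succ']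
      simp [mul_assoc]
  rw [banach_exp_add hc, mul_apply_eq_comp, h1, h2, mul_assoc]

/-- All partial sums of `exp(ad x) y` stay in `V`, and `V` is closed. -/
theorem banach_exp_conj_mem (V : Submodule ℂ 𝔸) (hV : IsClosed (V : Set 𝔸))
    {x y : 𝔸} (hx : ∀ v ∈ V, x * v - v * x ∈ V) (hy : y ∈ V) :
    NormedSpace.exp x * y * NormedSpace.exp (-x) ∈ V := by
  rw [banach_exp_conj_eq]
  set A := ContinuousLinearMap.mul ℂ 𝔸 x + (ContinuousLinearMap.mul ℂ 𝔸).flip (-x) with hA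
  have hpow : ∀ k : ℕ, (A ^ k) y ∈ V := by
    intro k
    induction k with
    | zero => simpa using hy
    | succ k ih =>
      have h := hx _ ih
      have h1 : (A ^ (k + 1)) y = x * (A ^ k) y - (A ^ k) y * x := by
        rw [pow_succ', mul_apply_eq_comp, hA]
        simp [sub_eq_add_neg]
      rwa [h1]
  have hs := (NormedSpace.exp_series_hasSum_exp' (𝕂 := ℂ) A).mapL
    (ContinuousLinearMap.apply ℂ 𝔸 y)
  refine hV.mem_of_tendsto hs (Filter.Eventually.of_forall fun s => V.sum_mem fun k _ => ?_)
  exact V.smul_mem _ (hpow k)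

/-- The hypothesis reads `y (x + c) = x y`, so `y` intertwines `x + c` with `x`, and hence their
exponentials. -/
theorem banach_exp_conj_eigenvector {x y : 𝔸} {c : ℂ} (h : x * y - y * x = c • y) :
    NormedSpace.exp x * y = Complex.exp c • (y * NormedSpace.exp x) := by
  let : NormedAlgebra ℚ 𝔸 := NormedAlgebra.restrictScalars ℚ ℂ 𝔸
  have h1 : SemiconjBy y (x + c • (1 : 𝔸)) x := by
    have h2 : x * y = y * x + c • y := by rw [← h]; abel
    rw [SemiconjBy, h2]
    simp [mul_add]
  have h2 := h1.exp_right
  have h3 : NormedSpace.exp (c • (1 : 𝔸)) = Complex.exp c • 1 := by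
    have h4 := NormedSpace.algebraMap_exp_comm (𝔸 := 𝔸) c
    rw [Algebra.algebraMap_eq_smul_one, Algebra.algebraMap_eq_smul_one] at h4
    rw [← h4, Complex.exp_eq_exp_ℂ]
  rw [banach_exp_add ((Commute.one_right x).smul_right c), h3] at h2
  rw [← h2.eq]
  simp

theorem banach_commute_of_forall_commute_exp {x B : 𝔸}
    (h : ∀ t : ℂ, Commute (NormedSpace.exp (t • x)) B) : Commute x B := by
  have h0 : HasDerivAt (fun s : ℂ => NormedSpace.exp (s • x)) x 0 := by
    simpa using hasDerivAt_exp_smul_const x (0 : ℂ)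
  have h1 := (h0.mul_const B).sub (h0.const_mul B)
  have h2 : HasDerivAt (fun _ : ℂ => (0 : 𝔸)) (x * B - B * x) 0 := by
    refine h1.congr_of_eventuallyEq (Filter.Eventually.of_forall fun s => ?_)
    exact (sub_eq_zero.2 (h s).eq).symm
  exact sub_eq_zero.1 (h2.unique (hasDerivAt_const _ _))

theorem banach_commute_exp {x B : 𝔸} (h : Commute x B) : Commute (NormedSpace.exp x) B := by
  let : NormedAlgebra ℚ 𝔸 := NormedAlgebra.restrictScalars ℚ ℂ 𝔸
  exact (SemiconjBy.exp_right (𝔸 := 𝔸) h.symm).symm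

theorem banach_exp_conj {x g g' : 𝔸} (h : g * g' = 1) (h' : g' * g = 1) :
    NormedSpace.exp (g * x * g') = g * NormedSpace.exp x * g' := by
  let : NormedAlgebra ℚ 𝔸 := NormedAlgebra.restrictScalars ℚ ℂ 𝔸
  exact NormedSpace.exp_units_conj (⟨g, g', h, h'⟩ : 𝔸ˣ) x

theorem banach_eventually_eq_zero_of_exp_eq_one :
    ∀ᶠ x : 𝔸 in nhds 0, NormedSpace.exp x = 1 → x = 0 := by
  have h : HasStrictFDerivAt (NormedSpace.exp : 𝔸 → 𝔸)
      ((ContinuousLinearEquiv.refl ℂ 𝔸 : 𝔸 →L[ℂ] 𝔸)) 0 :=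
    hasStrictFDerivAt_exp_zero (𝕂 := ℂ)
  filter_upwards [h.eventually_left_inverse] with x hx hx1
  have h0 := h.eventually_left_inverse.self_of_nhds
  rw [NormedSpace.exp_zero] at h0
  rw [hx1, h0] at hx
  exact hx.symm

end BanachAlgebra

section MatrixExp

attribute [local instance] Matrix.frobeniusNormedRing Matrix.frobeniusNormedAlgebra

variable {n : ℕ}

theorem exp_mul_exp_neg (x : Matrix (Fin n) (Fin n) ℂ) :
    NormedSpace.exp x * NormedSpace.exp (-x) = 1 := banach_exp_mul_exp_neg x

theorem exp_add {x y : Matrix (Fin n) (Fin n) ℂ} (h : Commute x y) :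
    NormedSpace.exp (x + y) = NormedSpace.exp x * NormedSpace.exp y := banach_exp_add h

theorem exp_continuous :
    Continuous (NormedSpace.exp : Matrix (Fin n) (Fin n) ℂ → Matrix (Fin n) (Fin n) ℂ) :=
  banach_exp_continuous

theorem det_exp_of_trace_eq_zero {A : Matrix (Fin n) (Fin n) ℂ} (hA : A.trace = 0) :
    (NormedSpace.exp A).det = 1 :=
  banach_det_exp (AlgHom.id ℂ (Matrix (Fin n) (Fin n) ℂ)) hA

theorem exp_conj_mem (V : Submodule ℂ (Matrix (Fin n) (Fin n) ℂ))
    {x y : Matrix (Fin n) (Fin n) ℂ} (hx : ∀ v ∈ V, x * v - v * x ∈ V) (hy : y ∈ V) :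
    NormedSpace.exp x * y * NormedSpace.exp (-x) ∈ V :=
  banach_exp_conj_mem V V.closed_of_finiteDimensional hx hy

theorem exp_conj_eigenvector {x y : Matrix (Fin n) (Fin n) ℂ} {c : ℂ}
    (h : x * y - y * x = c • y) :
    NormedSpace.exp x * y = Complex.exp c • (y * NormedSpace.exp x) :=
  banach_exp_conj_eigenvector h

theorem commute_of_forall_commute_exp {x B : Matrix (Fin n) (Fin n) ℂ}
    (h : ∀ t : ℂ, Commute (NormedSpace.exp (t • x)) B) : Commute x B :=
  banach_commute_of_forall_commute_exp h

theorem commute_exp {x B : Matrix (Fin n) (Fin n) ℂ} (h : Commute x B) :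
    Commute (NormedSpace.exp x) B :=
  banach_commute_exp h

theorem exp_conj {x g g' : Matrix (Fin n) (Fin n) ℂ} (h : g * g' = 1) (h' : g' * g = 1) :
    NormedSpace.exp (g * x * g') = g * NormedSpace.exp x * g' :=
  banach_exp_conj h h'

theorem eventually_eq_zero_of_exp_eq_one :
    ∀ᶠ x : Matrix (Fin n) (Fin n) ℂ in nhds 0, NormedSpace.exp x = 1 → x = 0 :=
  banach_eventually_eq_zero_of_exp_eq_one

theorem hasDerivAt_exp_smul (x : Matrix (Fin n) (Fin n) ℂ) (t : ℝ) (i j : Fin n) :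
    HasDerivAt (fun s : ℝ => NormedSpace.exp ((s : ℂ) • x) i j)
      ((x * NormedSpace.exp ((t : ℂ) • x)) i j) t := by
  let l : Matrix (Fin n) (Fin n) ℂ →L[ℂ] ℂ := (Matrix.entryLinearMap ℂ ℂ i j).toContinuousLinearMap
  exact (l.hasFDerivAt.comp_hasDerivAt (t : ℂ)
    (hasDerivAt_exp_smul_const' x (t : ℂ))).comp_ofReal

end MatrixExp

section Group

variable {n : ℕ} {𝔤 : LieSubalgebra ℂ (Matrix (Fin n) (Fin n) ℂ)}

namespace linGroup

@[simp] theorem mat_mul (g h : linGroup 𝔤) : mat (g * h) = mat g * mat h := by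
  simp [mat]

@[simp] theorem mat_one : mat (1 : linGroup 𝔤) = 1 := by simp [mat]

theorem mat_mul_mat_inv (g : linGroup 𝔤) : mat g * mat g⁻¹ = 1 := by
  rw [← mat_mul, mul_inv_cancel, mat_one]

theorem mat_inv_mul_mat (g : linGroup 𝔤) : mat g⁻¹ * mat g = 1 := by
  rw [← mat_mul, inv_mul_cancel, mat_one]

@[simp] theorem inv_mat (g : linGroup 𝔤) : (mat g)⁻¹ = mat g⁻¹ :=
  Matrix.inv_eq_right_inv (mat_mul_mat_inv g)

theorem det_mat (g : linGroup 𝔤) : (mat g).det = 1 := g.1.2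

theorem mat_injective : Function.Injective (mat : linGroup 𝔤 → _) := fun _ _ h =>
  Subtype.ext (Subtype.ext h)

theorem conj_mem (g : linGroup 𝔤) {y : Matrix (Fin n) (Fin n) ℂ} (hy : y ∈ 𝔤) :
    mat g * y * mat g⁻¹ ∈ 𝔤 := by
  -- Conjugation by `g` and by `g⁻¹` are carried together so that the induction passes through
  -- inverses.
  let P : Matrix.SpecialLinearGroup (Fin n) ℂ → Prop := fun g => ∀ y ∈ 𝔤,
    g.1 * y * (g⁻¹).1 ∈ 𝔤 ∧ (g⁻¹).1 * y * g.1 ∈ 𝔤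
  have hmul : ∀ a b : Matrix.SpecialLinearGroup (Fin n) ℂ, (a * b).1 = a.1 * b.1 :=
    fun _ _ => rfl
  have key : P g.1 := by
    refine Subgroup.closure_induction (p := fun g _ => P g) ?_ ?_ ?_ ?_ g.2
    · rintro g ⟨x, hx, hgx⟩ y hy
      have hinv : (g⁻¹).1 = NormedSpace.exp (-x) := by
        have h1 : (g⁻¹).1 * NormedSpace.exp x = 1 := by
          rw [← hgx, ← hmul, inv_mul_cancel]
          rfl
        calc _ = (g⁻¹).1 * (NormedSpace.exp x * NormedSpace.exp (-x)) := by
              rw [exp_mul_exp_neg, mul_one]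
          _ = _ := by rw [← mul_assoc, h1, one_mul]
      rw [hinv, hgx]
      refine ⟨exp_conj_mem 𝔤.toSubmodule (fun v hv => 𝔤.lie_mem hx hv) hy, ?_⟩
      have h2 := exp_conj_mem 𝔤.toSubmodule (x := -x)
        (fun v hv => 𝔤.lie_mem (𝔤.neg_mem hx) hv) hy
      rwa [neg_neg] at h2
    · intro y hy
      simpa using hy
    · intro a b _ _ ha hb y hy
      constructor
      · have := (ha _ (hb y hy).1).1
        simpa only [mul_assoc, mul_inv_rev, hmul] using this
      · have := (hb _ (ha y hy).2).2
        simpa only [mul_assoc, mul_inv_rev, hmul] using this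
    · intro a _ ha y hy
      rw [inv_inv]
      exact ⟨(ha y hy).2, (ha y hy).1⟩
  exact (key y hy).1

end linGroup

/-- The trace is a homomorphism to an abelian Lie algebra, so its kernel is an ideal containing all
brackets; simplicity and non-commutativity force the kernel to be everything. Hence `exp 𝔤` lies in
`SL(n, ℂ)`. -/
theorem trace_eq_zero_of_isSimple (hs : LieAlgebra.IsSimple ℂ 𝔤)
    {x : Matrix (Fin n) (Fin n) ℂ} (hx : x ∈ 𝔤) : x.trace = 0 := by
  let tr : 𝔤 →ₗ⁅ℂ⁆ ℂ :=
    { toLinearMap := (Matrix.traceLinearMap (Fin n) ℂ ℂ).comp 𝔤.toSubmodule.subtype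
      map_lie' := by
        intro x y
        have h1 : ((⁅x, y⁆ : 𝔤) : Matrix (Fin n) (Fin n) ℂ) = x * y - y * x := rfl
        have h2 : ((x : Matrix (Fin n) (Fin n) ℂ) * y - y * x).trace = 0 := by
          rw [Matrix.trace_sub, Matrix.trace_mul_comm, sub_self]
        rw [LieRing.of_associative_ring_bracket, mul_comm, sub_self]
        exact h2 }
  have htr : ∀ y : 𝔤, tr y = (y : Matrix (Fin n) (Fin n) ℂ).trace := fun _ => rfl
  rcases hs.eq_bot_or_eq_top tr.ker with h | h
  · refine absurd ⟨fun x y => ?_⟩ hs.non_abelian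
    have h3 : ⁅x, y⁆ ∈ tr.ker := by
      rw [LieHom.mem_ker, LieHom.map_lie]
      rw [LieRing.of_associative_ring_bracket, mul_comm, sub_self]
    rwa [h, LieSubmodule.mem_bot] at h3
  · have h3 : (⟨x, hx⟩ : 𝔤) ∈ tr.ker := by
      rw [h]
      exact LieSubmodule.mem_top _
    rw [LieHom.mem_ker, htr] at h3
    exact h3

theorem exists_mat_eq_exp (hs : LieAlgebra.IsSimple ℂ 𝔤) {x : Matrix (Fin n) (Fin n) ℂ}
    (hx : x ∈ 𝔤) : ∃ g : linGroup 𝔤, linGroup.mat g = NormedSpace.exp x :=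
  ⟨⟨⟨NormedSpace.exp x, det_exp_of_trace_eq_zero (trace_eq_zero_of_isSimple hs hx)⟩,
    Subgroup.subset_closure ⟨x, hx, rfl⟩⟩, rfl⟩

end Group

end LoopToda

end

/-! ### The Cartan subalgebra, its normalizer and regular elements. -/

noncomputable section

namespace LoopToda

/-- The operator `x ↦ [c, x]` on `K` depends continuously on `c`, and injectivity is an open
condition in finite dimension. -/
theorem banach_eventually_commute_injective {𝔸 : Type*} [NormedRing 𝔸] [NormedAlgebra ℂ 𝔸]
    [FiniteDimensional ℂ 𝔸] {K : Submodule ℂ 𝔸} {c₀ : 𝔸} (h : ∀ x ∈ K, Commute c₀ x → x = 0) :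
    ∀ᶠ c in nhds c₀, ∀ x ∈ K, Commute c x → x = 0 := by
  let L : 𝔸 →L[ℂ] 𝔸 →L[ℂ] 𝔸 := ContinuousLinearMap.mul ℂ 𝔸 - (ContinuousLinearMap.mul ℂ 𝔸).flip
  have hL : ∀ c (x : K), (L c).comp K.subtypeL x = 0 ↔ Commute c (x : 𝔸) := fun c x =>
    sub_eq_zero
  have hinj : ∀ c, Function.Injective ((L c).comp K.subtypeL) ↔
      ∀ x ∈ K, Commute c x → x = 0 := by
    intro c
    rw [injective_iff_map_eq_zero]
    constructor
    · intro h x hx hc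
      exact congrArg Subtype.val (h ⟨x, hx⟩ ((hL c _).2 hc))
    · intro h x hx
      exact Subtype.ext (h x x.2 ((hL c x).1 hx))
  have hcont : Continuous fun c => (L c).comp K.subtypeL := L.continuous.clm_comp continuous_const
  have h1 := hcont.continuousAt.eventually
    (ContinuousLinearMap.isOpen_injective.mem_nhds ((hinj c₀).2 h))
  filter_upwards [h1] with c hc
  exact (hinj c).1 hc

section Cartan

variable {n : ℕ} {𝔤 : LieSubalgebra ℂ (Matrix (Fin n) (Fin n) ℂ)}

/-- The matrices in the Cartan subalgebra. -/
def cartanMat (𝔥 : LieSubalgebra ℂ 𝔤) : Submodule ℂ (Matrix (Fin n) (Fin n) ℂ) :=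
  𝔥.toSubmodule.map 𝔤.toSubmodule.subtype

variable {𝔥 : LieSubalgebra ℂ 𝔤}

/-- The matrix of an element of the Cartan subalgebra. -/
abbrev cmat (h : 𝔥) : Matrix (Fin n) (Fin n) ℂ := ((h : 𝔤) : Matrix (Fin n) (Fin n) ℂ)

theorem coe_mem_cartanMat (h : 𝔥) : (cmat h) ∈ cartanMat 𝔥 :=
  ⟨h, h.2, rfl⟩

theorem exists_of_mem_cartanMat {x : Matrix (Fin n) (Fin n) ℂ} (hx : x ∈ cartanMat 𝔥) :
    ∃ h : 𝔥, (cmat h) = x := by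
  obtain ⟨y, hy, rfl⟩ := hx
  exact ⟨⟨y, hy⟩, rfl⟩

theorem mem_of_mem_cartanMat {x : Matrix (Fin n) (Fin n) ℂ} (hx : x ∈ cartanMat 𝔥) : x ∈ 𝔤 := by
  obtain ⟨y, hy, rfl⟩ := hx
  exact y.2

theorem cartanMat_commute [LieAlgebra.IsSimple ℂ 𝔤] [𝔥.IsCartanSubalgebra]
    {x y : Matrix (Fin n) (Fin n) ℂ} (hx : x ∈ cartanMat 𝔥) (hy : y ∈ cartanMat 𝔥) :
    Commute x y := by
  obtain ⟨a, rfl⟩ := exists_of_mem_cartanMat hx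
  obtain ⟨b, rfl⟩ := exists_of_mem_cartanMat hy
  have h : ⁅a, b⁆ = 0 := LieModule.IsTrivial.trivial a b
  have h2 : ((⁅a, b⁆ : 𝔥) : 𝔤) = 0 := by rw [h]; rfl
  have h3 : (((⁅a, b⁆ : 𝔥) : 𝔤) : Matrix (Fin n) (Fin n) ℂ) = 0 := by rw [h2]; rfl
  exact sub_eq_zero.1 h3

theorem mem_cartanMat_of_normalizes [𝔥.IsCartanSubalgebra] {x : Matrix (Fin n) (Fin n) ℂ}
    (hx : x ∈ 𝔤) (h : ∀ y ∈ cartanMat 𝔥, x * y - y * x ∈ cartanMat 𝔥) : x ∈ cartanMat 𝔥 := by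
  have h1 : (⟨x, hx⟩ : 𝔤) ∈ 𝔥.normalizer := by
    rw [LieSubalgebra.mem_normalizer_iff]
    intro y hy
    obtain ⟨z, hz⟩ := exists_of_mem_cartanMat (h y ⟨y, hy, rfl⟩)
    have h2 : ⁅(⟨x, hx⟩ : 𝔤), y⁆ = z := Subtype.ext hz.symm
    rw [h2]
    exact z.2
  rw [LieSubalgebra.IsCartanSubalgebra.self_normalizing] at h1
  exact ⟨_, h1, rfl⟩

theorem mem_cartanMat_of_commute [𝔥.IsCartanSubalgebra] {x : Matrix (Fin n) (Fin n) ℂ}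
    (hx : x ∈ 𝔤) (h : ∀ y ∈ cartanMat 𝔥, Commute x y) : x ∈ cartanMat 𝔥 :=
  mem_cartanMat_of_normalizes hx fun y hy => by
    rw [(h y hy).eq, sub_self]
    exact Submodule.zero_mem _

/-- The weights of `𝔥` on `𝔤` span the dual of `𝔥`. -/
theorem eq_zero_of_forall_weight [LieAlgebra.IsSimple ℂ 𝔤] [𝔥.IsCartanSubalgebra] {h : 𝔥}
    (H : ∀ α : LieModule.Weight ℂ 𝔥 𝔤, α h = 0) : h = 0 := by
  rw [← Module.forall_dual_apply_eq_zero_iff ℂ]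
  intro φ
  have hφ : φ ∈ Submodule.span ℂ (Set.range (LieModule.Weight.toLinear ℂ 𝔥 𝔤)) := by
    rw [LieAlgebra.IsKilling.span_weight_eq_top]
    exact Submodule.mem_top
  induction hφ using Submodule.span_induction with
  | mem x hx =>
    obtain ⟨α, rfl⟩ := hx
    exact H α
  | zero => rfl
  | add x y _ _ hx hy => rw [LinearMap.add_apply, hx, hy, add_zero]
  | smul c x _ hx => rw [LinearMap.smul_apply, hx, smul_zero]

/-- `g` normalizes the Cartan subalgebra. -/
def Normalizes (𝔥 : LieSubalgebra ℂ 𝔤) (g : linGroup 𝔤) : Prop :=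
  ∀ x ∈ cartanMat 𝔥, linGroup.mat g * x * linGroup.mat g⁻¹ ∈ cartanMat 𝔥

/-- If `x` is a weight vector for `α`, then `g⁻¹ x g` is a nonzero weight vector for `α ∘ Ad g`. -/
theorem exists_weight_comp [LieAlgebra.IsSimple ℂ 𝔤] [𝔥.IsCartanSubalgebra] {g : linGroup 𝔤}
    {T : 𝔥 → 𝔥} (hT : ∀ h : 𝔥, (cmat (T h)) =
      linGroup.mat g * (cmat h) * linGroup.mat g⁻¹)
    (α : LieModule.Weight ℂ 𝔥 𝔤) : ∃ β : LieModule.Weight ℂ 𝔥 𝔤, ∀ h, β h = α (T h) := by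
  obtain ⟨x, hx, hx0⟩ := α.exists_ne_zero
  have hxg : linGroup.mat g⁻¹ * x * linGroup.mat g ∈ 𝔤 := by
    simpa using linGroup.conj_mem g⁻¹ x.2
  have hgg := linGroup.mat_mul_mat_inv g
  have hgg' := linGroup.mat_inv_mul_mat g
  have hmem : (⟨_, hxg⟩ : 𝔤) ∈ LieModule.weightSpace 𝔤 (fun h : 𝔥 => α (T h)) := by
    rw [LieModule.mem_weightSpace]
    intro h
    have h1 := LieAlgebra.IsKilling.lie_eq_smul_of_mem_rootSpace hx (T h)
    have h2 : (cmat (T h)) * x - x * (cmat (T h)) =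
        α (T h) • (x : Matrix (Fin n) (Fin n) ℂ) := congrArg Subtype.val h1
    refine Subtype.ext ?_
    change (cmat h) * (linGroup.mat g⁻¹ * x * linGroup.mat g) -
      (linGroup.mat g⁻¹ * x * linGroup.mat g) * (cmat h) =
      α (T h) • (linGroup.mat g⁻¹ * x * linGroup.mat g)
    have h3 : α (T h) • (linGroup.mat g⁻¹ * x * linGroup.mat g) =
        linGroup.mat g⁻¹ * (α (T h) • (x : Matrix (Fin n) (Fin n) ℂ)) * linGroup.mat g := by
      simp
    rw [h3, ← h2, hT, mul_sub, sub_mul]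
    congr 1
    · calc _ = 1 * (cmat h) *
            (linGroup.mat g⁻¹ * x * linGroup.mat g) := by rw [one_mul]
        _ = _ := by rw [← hgg']; noncomm_ring
    · calc _ = (linGroup.mat g⁻¹ * x * linGroup.mat g) *
            (cmat h) * 1 := by rw [mul_one]
        _ = _ := by rw [← hgg']; noncomm_ring
  refine ⟨⟨fun h => α (T h), fun hbot => hx0 ?_⟩, fun h => rfl⟩
  have h0 := LieModule.weightSpace_le_genWeightSpace 𝔤 _ hmem
  rw [hbot, LieSubmodule.mem_bot] at h0
  have h4 : linGroup.mat g⁻¹ * x * linGroup.mat g = 0 := congrArg Subtype.val h0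
  refine Subtype.ext ?_
  calc (x : Matrix (Fin n) (Fin n) ℂ) =
        (linGroup.mat g * linGroup.mat g⁻¹) * x * (linGroup.mat g * linGroup.mat g⁻¹) := by
        rw [hgg, one_mul, mul_one]
    _ = linGroup.mat g * (linGroup.mat g⁻¹ * x * linGroup.mat g) * linGroup.mat g⁻¹ := by
        noncomm_ring
    _ = 0 := by rw [h4]; simp

-- The finiteness of the Weyl group: the action of a normalizing element on `𝔥` is determined by the
-- self-map it induces on the finite set of weights.
variable (𝔥) in
theorem finite_normalizer_action [LieAlgebra.IsSimple ℂ 𝔤] [𝔥.IsCartanSubalgebra] :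
    {f : 𝔥 → Matrix (Fin n) (Fin n) ℂ | ∃ g : linGroup 𝔤, Normalizes 𝔥 g ∧
      f = fun h => linGroup.mat g * (cmat h) *
        linGroup.mat g⁻¹}.Finite := by
  set S := {f : 𝔥 → Matrix (Fin n) (Fin n) ℂ | ∃ g : linGroup 𝔤, Normalizes 𝔥 g ∧
      f = fun h => linGroup.mat g * (cmat h) * linGroup.mat g⁻¹}
  have key : ∀ f : S, ∃ T : 𝔥 → 𝔥, (∀ h, (cmat (T h)) = f.1 h) ∧
      ∃ σ : LieModule.Weight ℂ 𝔥 𝔤 → LieModule.Weight ℂ 𝔥 𝔤, ∀ α h, σ α h = α (T h) := by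
    rintro ⟨f, g, hg, rfl⟩
    choose T hT using fun h : 𝔥 => exists_of_mem_cartanMat (hg _ (coe_mem_cartanMat h))
    choose σ hσ using exists_weight_comp hT
    exact ⟨T, hT, σ, hσ⟩
  choose T hT σ hσ using key
  have hinj : Function.Injective σ := by
    intro f f' hff
    refine Subtype.ext (funext fun h => ?_)
    have h0 : T f h - T f' h = 0 := eq_zero_of_forall_weight fun α => by
      have h1 : α (T f h) = α (T f' h) := by rw [← hσ, ← hσ, hff]
      have h2 := map_sub (LieModule.Weight.toLinear ℂ 𝔥 𝔤 α) (T f h) (T f' h)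
      simp only [LieModule.Weight.toLinear_apply] at h2
      rw [h2, h1, sub_self]
    rw [← hT, ← hT, sub_eq_zero.1 h0]
  have : Finite S := Finite.of_injective σ hinj
  exact Set.toFinite S

/-- An element `c` whose fixed points in `𝔤` lie in the Cartan subalgebra. -/
def InfReg (𝔥 : LieSubalgebra ℂ 𝔤) (c : Matrix (Fin n) (Fin n) ℂ) : Prop :=
  ∀ x ∈ 𝔤, Commute c x → x ∈ cartanMat 𝔥

/-- `Ad g` carries `𝔥`, which commutes with `exp h`, into the commutant of `exp h'`, and regularity
of `exp h'` puts that part of `𝔤` inside `𝔥`. -/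
theorem normalizes_of_conj [LieAlgebra.IsSimple ℂ 𝔤] [𝔥.IsCartanSubalgebra] {g : linGroup 𝔤}
    {h h' : Matrix (Fin n) (Fin n) ℂ} (hh : h ∈ cartanMat 𝔥)
    (hg : linGroup.mat g * NormedSpace.exp h * linGroup.mat g⁻¹ = NormedSpace.exp h')
    (hreg : InfReg 𝔥 (NormedSpace.exp h')) : Normalizes 𝔥 g := by
  intro x hx
  refine hreg _ (linGroup.conj_mem g (mem_of_mem_cartanMat hx)) ?_
  have hc : Commute (NormedSpace.exp h) x := commute_exp (cartanMat_commute hh hx)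
  have hgg' := linGroup.mat_inv_mul_mat g
  rw [← hg]
  calc _ = linGroup.mat g * NormedSpace.exp h * (linGroup.mat g⁻¹ * linGroup.mat g) * x *
        linGroup.mat g⁻¹ := by noncomm_ring
    _ = linGroup.mat g * (NormedSpace.exp h * x) * linGroup.mat g⁻¹ := by
        rw [hgg']; noncomm_ring
    _ = linGroup.mat g * x * (linGroup.mat g⁻¹ * linGroup.mat g) * NormedSpace.exp h *
        linGroup.mat g⁻¹ := by rw [hgg', hc.eq]; noncomm_ring
    _ = _ := by noncomm_ring

theorem continuous_coe_cartan :
    Continuous fun h : 𝔥 => (cmat h) :=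
  continuous_subtype_val.comp continuous_subtype_val

theorem continuous_exp_cartan :
    Continuous fun h : 𝔥 => NormedSpace.exp (cmat h) :=
  exp_continuous.comp continuous_coe_cartan

/-- Each of the finitely many normalizer actions either fixes `exp h₀` or, by continuity, sends `exp
h` away from `exp h'` for all `h`, `h'` near `h₀`. The neighbourhood is therefore uniform in `g`. -/
theorem eventually_conj_fixes [LieAlgebra.IsSimple ℂ 𝔤] [𝔥.IsCartanSubalgebra] (h₀ : 𝔥) :
    ∀ᶠ p : 𝔥 × 𝔥 in nhds (h₀, h₀), InfReg 𝔥 (NormedSpace.exp (cmat p.2)) →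
      ∀ g : linGroup 𝔤, linGroup.mat g * NormedSpace.exp (cmat p.1) *
        linGroup.mat g⁻¹ = NormedSpace.exp (cmat p.2) →
      linGroup.mat g * NormedSpace.exp (cmat h₀) *
        linGroup.mat g⁻¹ = NormedSpace.exp (cmat h₀) := by
  have h1 : ∀ f ∈ {f : 𝔥 → Matrix (Fin n) (Fin n) ℂ | ∃ g : linGroup 𝔤, Normalizes 𝔥 g ∧
      f = fun h => linGroup.mat g * (cmat h) * linGroup.mat g⁻¹},
      ∀ᶠ p : 𝔥 × 𝔥 in nhds (h₀, h₀),
        NormedSpace.exp (f p.1) = NormedSpace.exp (cmat p.2) →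
        NormedSpace.exp (f h₀) = NormedSpace.exp (cmat h₀) := by
    rintro f ⟨g, -, rfl⟩
    by_cases heq : NormedSpace.exp (linGroup.mat g * (cmat h₀) *
        linGroup.mat g⁻¹) = NormedSpace.exp (cmat h₀)
    · exact Filter.Eventually.of_forall fun p _ => heq
    · have hc1 : Continuous fun p : 𝔥 × 𝔥 => NormedSpace.exp (linGroup.mat g *
          (cmat p.1) * linGroup.mat g⁻¹) :=
        exp_continuous.comp ((continuous_const.mul
          (continuous_coe_cartan.comp continuous_fst)).mul continuous_const)
      have hc2 : Continuous fun p : 𝔥 × 𝔥 =>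
          NormedSpace.exp (cmat p.2) :=
        continuous_exp_cartan.comp continuous_snd
      have h2 : ∀ᶠ p : 𝔥 × 𝔥 in nhds (h₀, h₀), NormedSpace.exp (linGroup.mat g *
          (cmat p.1) * linGroup.mat g⁻¹) ≠
          NormedSpace.exp (cmat p.2) :=
        (isOpen_ne_fun hc1 hc2).mem_nhds heq
      filter_upwards [h2] with p hp hp'
      exact absurd hp' hp
  filter_upwards [(Filter.eventually_all_finite (finite_normalizer_action 𝔥)).2 h1] with
    p hp hreg g hg
  have hconj : ∀ x : Matrix (Fin n) (Fin n) ℂ, NormedSpace.exp (linGroup.mat g * x *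
      linGroup.mat g⁻¹) = linGroup.mat g * NormedSpace.exp x * linGroup.mat g⁻¹ := fun x =>
    exp_conj (linGroup.mat_mul_mat_inv g) (linGroup.mat_inv_mul_mat g)
  have h3 := hp _ ⟨g, normalizes_of_conj (coe_mem_cartanMat p.1) hg hreg, rfl⟩
  simp only [hconj] at h3
  exact h3 hg

theorem eventually_commute_injective {K : Submodule ℂ (Matrix (Fin n) (Fin n) ℂ)}
    {c₀ : Matrix (Fin n) (Fin n) ℂ} (h : ∀ x ∈ K, Commute c₀ x → x = 0) :
    ∀ᶠ c in nhds c₀, ∀ x ∈ K, Commute c x → x = 0 := by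
  let : NormedRing (Matrix (Fin n) (Fin n) ℂ) := Matrix.frobeniusNormedRing
  let : NormedAlgebra ℂ (Matrix (Fin n) (Fin n) ℂ) := Matrix.frobeniusNormedAlgebra
  exact banach_eventually_commute_injective h

/-- Commutation with `exp h` is automatic on `𝔥`, so regularity only concerns the intersection of
`𝔤` with a complement `K`, where it is an open injectivity condition. -/
theorem eventually_infReg [LieAlgebra.IsSimple ℂ 𝔤] [𝔥.IsCartanSubalgebra] {h₀ : 𝔥}
    (h₀reg : InfReg 𝔥 (NormedSpace.exp (cmat h₀))) :
    ∀ᶠ h : 𝔥 in nhds h₀, InfReg 𝔥 (NormedSpace.exp (cmat h)) := by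
  obtain ⟨K, hK⟩ := (cartanMat 𝔥).exists_isCompl
  have h1 : ∀ x ∈ K ⊓ 𝔤.toSubmodule, Commute (NormedSpace.exp (cmat h₀)) x → x = 0 := by
    intro x hx hc
    have h2 := h₀reg x hx.2 hc
    have h3 : x ∈ cartanMat 𝔥 ⊓ K := ⟨h2, hx.1⟩
    rwa [hK.inf_eq_bot, Submodule.mem_bot] at h3
  filter_upwards [continuous_exp_cartan.continuousAt.eventually
    (eventually_commute_injective h1)] with h hh x hx hc
  obtain ⟨a, ha, b, hb, rfl⟩ := Submodule.mem_sup.1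
    (hK.sup_eq_top ▸ Submodule.mem_top : x ∈ cartanMat 𝔥 ⊔ K)
  have hb' : b ∈ 𝔤.toSubmodule := by
    have h4 := 𝔤.toSubmodule.sub_mem hx (mem_of_mem_cartanMat ha)
    rwa [add_sub_cancel_left] at h4
  have h5 : Commute (NormedSpace.exp (cmat h)) a :=
    commute_exp (cartanMat_commute (coe_mem_cartanMat h) ha)
  have h6 : Commute (NormedSpace.exp (cmat h)) b := by
    have h7 := hc.sub_right h5
    rwa [add_sub_cancel_left] at h7
  rw [hh b ⟨hb, hb'⟩ h6, add_zero]
  exact ha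

theorem exp_mul_mul_inv (g : linGroup 𝔤) (x : Matrix (Fin n) (Fin n) ℂ) :
    NormedSpace.exp (linGroup.mat g * x * linGroup.mat g⁻¹) =
      linGroup.mat g * NormedSpace.exp x * linGroup.mat g⁻¹ :=
  exp_conj (linGroup.mat_mul_mat_inv g) (linGroup.mat_inv_mul_mat g)

theorem mem_cartanSubgroup_of_exp {g : linGroup 𝔤} {x : Matrix (Fin n) (Fin n) ℂ}
    (hx : x ∈ cartanMat 𝔥) (hg : linGroup.mat g = NormedSpace.exp x) : g ∈ cartanSubgroup 𝔥 :=
  Subgroup.subset_closure ⟨x, hx, hg⟩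

theorem commute_of_mem_cartanSubgroup {g : linGroup 𝔤} (hg : g ∈ cartanSubgroup 𝔥)
    {x : Matrix (Fin n) (Fin n) ℂ} (hx : ∀ y ∈ cartanMat 𝔥, Commute (NormedSpace.exp y) x) :
    Commute (linGroup.mat g) x := by
  let P : Matrix.SpecialLinearGroup (Fin n) ℂ → Prop := fun g => Commute g.1 x
  have key : P g.1 := by
    refine Subgroup.closure_induction (p := fun g _ => P g) ?_ ?_ ?_ ?_ hg
    · rintro g ⟨y, hy, hgy⟩
      change Commute g.1 x
      rw [hgy]
      exact hx y hy
    · exact Commute.one_left x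
    · intro a b _ _ ha hb
      exact Commute.mul_left ha hb
    · intro a _ ha
      have h1 : (a⁻¹).1 * a.1 = 1 := by
        have h2 := congrArg Subtype.val (inv_mul_cancel a)
        exact h2
      have h2 : a.1 * (a⁻¹).1 = 1 := by
        have h2 := congrArg Subtype.val (mul_inv_cancel a)
        exact h2
      have h3 : Commute (⟨a.1, (a⁻¹).1, h2, h1⟩ : (Matrix (Fin n) (Fin n) ℂ)ˣ).val x := ha
      exact Commute.units_inv_left h3
  exact key

theorem commute_cartanSubgroup [LieAlgebra.IsSimple ℂ 𝔤] [𝔥.IsCartanSubalgebra]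
    {a b : linGroup 𝔤} (ha : a ∈ cartanSubgroup 𝔥) (hb : b ∈ cartanSubgroup 𝔥) :
    a * b = b * a := by
  refine linGroup.mat_injective ?_
  rw [linGroup.mat_mul, linGroup.mat_mul]
  refine commute_of_mem_cartanSubgroup ha fun y hy => ?_
  refine (commute_of_mem_cartanSubgroup hb fun x hx => ?_).symm
  exact commute_exp (commute_exp (cartanMat_commute hy hx)).symm

theorem conj_mem_cartanSubgroup {k a : linGroup 𝔤} (hk : Normalizes 𝔥 k)
    (ha : a ∈ cartanSubgroup 𝔥) : k * a * k⁻¹ ∈ cartanSubgroup 𝔥 := by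
  let H := expSubgroup ((fun x : 𝔤 => (x : Matrix (Fin n) (Fin n) ℂ)) '' (𝔥 : Set 𝔤))
  let P : Matrix.SpecialLinearGroup (Fin n) ℂ → Prop := fun g => k.1 * g * k.1⁻¹ ∈ H
  have key : P a.1 := by
    refine Subgroup.closure_induction (p := fun g _ => P g) ?_ ?_ ?_ ?_ ha
    · rintro g ⟨y, hy, hgy⟩
      refine Subgroup.subset_closure ⟨_, hk y hy, ?_⟩
      rw [exp_mul_mul_inv, ← hgy]
      rfl
    · change k.1 * 1 * k.1⁻¹ ∈ H
      rw [mul_one, mul_inv_cancel]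
      exact H.one_mem
    · intro a b _ _ ha hb
      change k.1 * (a * b) * k.1⁻¹ ∈ H
      have h1 : k.1 * (a * b) * k.1⁻¹ = (k.1 * a * k.1⁻¹) * (k.1 * b * k.1⁻¹) := by group
      rw [h1]
      exact H.mul_mem ha hb
    · intro a _ ha
      change k.1 * a⁻¹ * k.1⁻¹ ∈ H
      have h1 : k.1 * a⁻¹ * k.1⁻¹ = (k.1 * a * k.1⁻¹)⁻¹ := by group
      rw [h1]
      exact H.inv_mem ha
  exact key

theorem mem_centralizer_singleton {G : Type*} [Group G] {c g : G} :
    g ∈ Subgroup.centralizer {c} ↔ c * g = g * c := by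
  simp [Subgroup.mem_centralizer_iff]

theorem isRegularElement_conj (a : linGroup 𝔤) {M : linGroup 𝔤} (hM : IsRegularElement 𝔥 M) :
    IsRegularElement 𝔥 (a * M * a⁻¹) := by
  obtain ⟨g, hg⟩ := hM
  refine ⟨a * g, ?_⟩
  have h1 : Subgroup.centralizer {a * M * a⁻¹} =
      (Subgroup.centralizer {M}).map (MulAut.conj a).toMonoidHom := by
    ext x
    rw [mem_centralizer_singleton, Subgroup.mem_map]
    constructor
    · intro hx
      refine ⟨a⁻¹ * x * a, mem_centralizer_singleton.2 ?_, ?_⟩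
      · calc M * (a⁻¹ * x * a) = a⁻¹ * (a * M * a⁻¹ * x) * a := by group
          _ = _ := by rw [hx]; group
      · simp only [MulEquiv.toMonoidHom_eq_coe, MonoidHom.coe_coe, MulAut.conj_apply]
        group
    · rintro ⟨y, hy, rfl⟩
      have hy' := mem_centralizer_singleton.1 hy
      simp only [MulEquiv.toMonoidHom_eq_coe, MonoidHom.coe_coe, MulAut.conj_apply]
      calc a * M * a⁻¹ * (a * y * a⁻¹) = a * (M * y) * a⁻¹ := by group
        _ = _ := by rw [hy']; group
  rw [h1, hg, Subgroup.map_map]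
  congr 1
  ext x
  simp [MulAut.conj_apply, mul_assoc]

theorem isRegularElement_of_centralizer_eq {M : linGroup 𝔤}
    (h : Subgroup.centralizer {M} = cartanSubgroup 𝔥) : IsRegularElement 𝔥 M := by
  refine ⟨1, ?_⟩
  rw [h]
  ext x
  simp [Subgroup.mem_map]

section Regular

variable [LieAlgebra.IsSimple ℂ 𝔤] [𝔥.IsCartanSubalgebra] {h₀ : 𝔥} {c : linGroup 𝔤}

/-- The centralizer of `c` is a conjugate of the Cartan subgroup, hence abelian. It contains
`exp(tx)` for every `x ∈ 𝔤` commuting with `c`, and `exp(sy)` for `y ∈ 𝔥`; differentiating in both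
parameters, `x` commutes with `𝔥`, so it lies in `𝔥`. -/
theorem infReg_of_isRegularElement (hc : linGroup.mat c = NormedSpace.exp (cmat h₀))
    (hreg : IsRegularElement 𝔥 c) : InfReg 𝔥 (NormedSpace.exp (cmat h₀)) := by
  obtain ⟨k, hk⟩ := hreg
  have hcomm : ∀ a ∈ Subgroup.centralizer {c}, ∀ b ∈ Subgroup.centralizer {c},
      a * b = b * a := by
    rw [hk]
    rintro _ ⟨a, ha, rfl⟩ _ ⟨b, hb, rfl⟩
    rw [← map_mul, commute_cartanSubgroup ha hb, map_mul]
  have hmem : ∀ a : linGroup 𝔤, Commute (linGroup.mat a) (NormedSpace.exp (cmat h₀)) →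
      a ∈ Subgroup.centralizer {c} := fun a ha => mem_centralizer_singleton.2 <|
    linGroup.mat_injective (by rw [linGroup.mat_mul, linGroup.mat_mul, hc]; exact ha.eq.symm)
  intro x hx hxc
  refine mem_cartanMat_of_commute hx fun y hy => ?_
  refine commute_of_forall_commute_exp fun t => ?_
  refine (commute_of_forall_commute_exp fun s => ?_).symm
  obtain ⟨a, ha⟩ := exists_mat_eq_exp ‹_› (𝔤.smul_mem t hx)
  obtain ⟨b, hb⟩ := exists_mat_eq_exp ‹_› (𝔤.smul_mem s (mem_of_mem_cartanMat hy))
  have h1 := hcomm b (hmem b (by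
    rw [hb]
    exact commute_exp ((cartanMat_commute (hy) (coe_mem_cartanMat h₀)).smul_left s |>.symm |>
      commute_exp |>.symm))) a (hmem a (by
    rw [ha]
    exact commute_exp (hxc.symm.smul_left t)))
  have h2 := congrArg linGroup.mat h1
  rw [linGroup.mat_mul, linGroup.mat_mul, ha, hb] at h2
  exact h2

/-- Regularity only says that the centralizer is `k C k⁻¹` for some `k`. Since this group
centralizes `c`, the space `Ad(k) 𝔥` commutes with `c` and so lies in `𝔥`; thus `k` normalizes `C`
and the conjugate is contained in `C`. -/
theorem mem_cartanSubgroup_of_isRegularElement (hc : linGroup.mat c = NormedSpace.exp (cmat h₀))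
    (hreg : IsRegularElement 𝔥 c) {g : linGroup 𝔤} (hg : c * g = g * c) :
    g ∈ cartanSubgroup 𝔥 := by
  have hinf := infReg_of_isRegularElement hc hreg
  obtain ⟨k, hk⟩ := hreg
  have hnorm : Normalizes 𝔥 k := by
    intro y hy
    refine hinf _ (linGroup.conj_mem k (mem_of_mem_cartanMat hy)) ?_
    refine (commute_of_forall_commute_exp fun t => ?_).symm
    obtain ⟨b, hb⟩ := exists_mat_eq_exp ‹_› (𝔤.smul_mem t (mem_of_mem_cartanMat hy))
    have h1 : k * b * k⁻¹ ∈ Subgroup.centralizer {c} := by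
      rw [hk]
      exact ⟨b, mem_cartanSubgroup_of_exp ((cartanMat 𝔥).smul_mem t hy) hb, rfl⟩
    have h2 := congrArg linGroup.mat (mem_centralizer_singleton.1 h1)
    simp only [linGroup.mat_mul] at h2
    rw [hb, ← exp_mul_mul_inv, hc] at h2
    rw [show t • (linGroup.mat k * y * linGroup.mat k⁻¹) =
      linGroup.mat k * (t • y) * linGroup.mat k⁻¹ by simp]
    exact h2.symm
  have hgm : g ∈ Subgroup.centralizer {c} := mem_centralizer_singleton.2 hg
  rw [hk] at hgm
  obtain ⟨a, ha, rfl⟩ := hgm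
  exact conj_mem_cartanSubgroup hnorm ha

end Regular

end Cartan

end LoopToda

end

/-! ### The gauge action on loops and the monodromy. -/

noncomputable section

namespace LoopToda

open scoped Wiener MatWiener

section MatDeriv

variable {n : ℕ}

/-- Entrywise derivative of a curve of matrices. -/
def HasMatDeriv (f : ℝ → Matrix (Fin n) (Fin n) ℂ) (f' : Matrix (Fin n) (Fin n) ℂ) (t : ℝ) :
    Prop :=
  ∀ i j, HasDerivAt (fun s => f s i j) (f' i j) t

namespace HasMatDeriv

variable {f g : ℝ → Matrix (Fin n) (Fin n) ℂ} {f' g' : Matrix (Fin n) (Fin n) ℂ} {t : ℝ}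

theorem mul (hf : HasMatDeriv f f' t) (hg : HasMatDeriv g g' t) :
    HasMatDeriv (fun s => f s * g s) (f' * g t + f t * g') t := by
  intro i j
  simp only [Matrix.mul_apply, Matrix.add_apply, ← Finset.sum_add_distrib]
  exact HasDerivAt.fun_sum fun k _ => (hf i k).mul (hg k j)

theorem const (A : Matrix (Fin n) (Fin n) ℂ) (t : ℝ) : HasMatDeriv (fun _ => A) 0 t :=
  fun _ _ => hasDerivAt_const _ _

theorem mul_const (hf : HasMatDeriv f f' t) (A : Matrix (Fin n) (Fin n) ℂ) :
    HasMatDeriv (fun s => f s * A) (f' * A) t := by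
  simpa using hf.mul (const A t)

theorem unique (hf : HasMatDeriv f f' t) (hg : HasMatDeriv f g' t) : f' = g' := by
  ext i j
  exact (hf i j).unique (hg i j)

theorem congr (hf : HasMatDeriv f f' t) (h : ∀ s, g s = f s) : HasMatDeriv g f' t := by
  rwa [show g = f from funext h]

theorem det (hf : HasMatDeriv f f' t) : DifferentiableAt ℝ (fun s => (f s).det) t := by
  simp only [Matrix.det_apply]
  refine DifferentiableAt.fun_sum fun σ _ => DifferentiableAt.const_smul ?_ _
  exact DifferentiableAt.fun_finsetProd fun i _ => (hf (σ i) i).differentiableAt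

theorem adjugate (hf : HasMatDeriv f f' t) :
    ∃ g', HasMatDeriv (fun s => (f s).adjugate) g' t := by
  refine ⟨Matrix.of fun i j => _root_.deriv (fun s => (f s).adjugate i j) t, fun i j => ?_⟩
  refine DifferentiableAt.hasDerivAt ?_
  simp only [Matrix.adjugate_apply]
  have h : HasMatDeriv (fun s => (f s).updateRow j (Pi.single i 1)) (f'.updateRow j 0) t := by
    intro k l
    by_cases hk : k = j
    · subst hk
      simpa using hasDerivAt_const t _
    · simpa [Matrix.updateRow_ne hk] using hf k l
  exact h.det

/-- With determinant one the inverse is the adjugate, a polynomial in the entries, so it is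
differentiable; its derivative then follows from `f f⁻¹ = 1`. -/
theorem inv_of_det (hf : HasMatDeriv f f' t) (hd : ∀ s, (f s).det = 1) :
    HasMatDeriv (fun s => (f s)⁻¹) (-((f t)⁻¹ * f' * (f t)⁻¹)) t := by
  have hu : ∀ s, IsUnit (f s).det := fun s => by rw [hd]; exact isUnit_one
  have hinv : ∀ s, (f s)⁻¹ = (f s).adjugate := fun s => by
    rw [Matrix.inv_def, hd, Ring.inverse_one, one_smul]
  obtain ⟨g', hg⟩ := hf.adjugate
  replace hg : HasMatDeriv (fun s => (f s)⁻¹) g' t := hg.congr hinv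
  have h1 := hf.mul hg
  have h2 : HasMatDeriv (fun s => f s * (f s)⁻¹) 0 t :=
    (const 1 t).congr fun s => Matrix.mul_nonsing_inv _ (hu s)
  have h3 := h1.unique h2
  have h4 : g' = -((f t)⁻¹ * f' * (f t)⁻¹) := by
    have h5 : f t * g' = -(f' * (f t)⁻¹) := eq_neg_of_add_eq_zero_right h3
    calc g' = (f t)⁻¹ * f t * g' := by rw [Matrix.nonsing_inv_mul _ (hu t), one_mul]
      _ = (f t)⁻¹ * (f t * g') := mul_assoc _ _ _
      _ = _ := by rw [h5, mul_neg, mul_assoc]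
  rwa [h4] at hg

theorem eq_of_deriv_zero (hf : ∀ t, HasMatDeriv f 0 t) (s t : ℝ) : f s = f t := by
  ext i j
  exact is_const_of_deriv_eq_zero (fun t => (hf t i j).differentiableAt)
    (fun t => (hf t i j).deriv) s t

end HasMatDeriv

theorem circleD_eq {f : Circle → Matrix (Fin n) (Fin n) ℂ} {z : Circle}
    {F' : Matrix (Fin n) (Fin n) ℂ} (h : HasMatDeriv (fun t => f (Circle.exp t * z)) F' 0) :
    circleD f z = -Complex.I • F' := by
  ext i j
  simp [circleD, (h i j).deriv]

end MatDeriv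

section Loops

variable {n : ℕ} {w : Weight}

theorem MatWiener.exists_hasMatDeriv (T : MatWiener n w) (z : Circle) (t : ℝ) :
    ∃ F', HasMatDeriv (fun s => T.eval (Circle.exp s * z)) F' t :=
  ⟨Matrix.of fun _ _ => _, fun i j => (T.entry i j).hasDerivAt_eval_exp_mul z t⟩

theorem circleD_mul (S T : MatWiener n w) (z : Circle) :
    circleD (fun ζ => S.eval ζ * T.eval ζ) z =
      circleD S.eval z * T.eval z + S.eval z * circleD T.eval z := by
  obtain ⟨S', hS⟩ := S.exists_hasMatDeriv z 0
  obtain ⟨T', hT⟩ := T.exists_hasMatDeriv z 0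
  rw [circleD_eq hS, circleD_eq hT, circleD_eq (f := fun ζ => S.eval ζ * T.eval ζ) (hS.mul hT)]
  simp only [Circle.exp_zero, one_mul, smul_add, Matrix.smul_mul, Matrix.mul_smul]

theorem circleD_const (A : Matrix (Fin n) (Fin n) ℂ) (z : Circle) :
    circleD (fun _ => A) z = 0 := by
  rw [circleD_eq (f := fun _ => A) (HasMatDeriv.const A 0), smul_zero]

/-- The adjugate loop. -/
def MatWiener.adj (T : MatWiener n w) : MatWiener n w :=
  Matrix.adjugate (show Matrix (Fin n) (Fin n) (Wiener w) from T)

theorem MatWiener.eval_adj (T : MatWiener n w) (z : Circle) :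
    T.adj.eval z = (T.eval z).adjugate :=
  RingHom.map_adjugate (Wiener.evalHom z) (show Matrix (Fin n) (Fin n) (Wiener w) from T)

variable {𝔤 : LieSubalgebra ℂ (Matrix (Fin n) (Fin n) ℂ)} {γ β : MatWiener n w}

theorem det_of_mem_loopGroup (hγ : γ ∈ loopGroup 𝔤 w) (z : Circle) : (γ.eval z).det = 1 := by
  obtain ⟨g, hg⟩ := hγ z
  rw [← hg, linGroup.det_mat]

/-- This keeps inverse loops inside `M_n(A_w)` without any inversion theorem for the Wiener algebra.
-/
theorem inv_eval (hγ : γ ∈ loopGroup 𝔤 w) (z : Circle) : (γ.eval z)⁻¹ = γ.adj.eval z := by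
  rw [MatWiener.eval_adj, Matrix.inv_def, det_of_mem_loopGroup hγ, Ring.inverse_one, one_smul]

theorem eval_mul_adj (hγ : γ ∈ loopGroup 𝔤 w) (z : Circle) : γ.eval z * γ.adj.eval z = 1 := by
  rw [← inv_eval hγ, Matrix.mul_nonsing_inv _ (by rw [det_of_mem_loopGroup hγ]; exact isUnit_one)]

theorem adj_mul_eval (hγ : γ ∈ loopGroup 𝔤 w) (z : Circle) : γ.adj.eval z * γ.eval z = 1 := by
  rw [← inv_eval hγ, Matrix.nonsing_inv_mul _ (by rw [det_of_mem_loopGroup hγ]; exact isUnit_one)]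

theorem adj_mem_loopGroup (hγ : γ ∈ loopGroup 𝔤 w) : γ.adj ∈ loopGroup 𝔤 w := by
  intro z
  obtain ⟨g, hg⟩ := hγ z
  exact ⟨g⁻¹, by rw [← inv_eval hγ, ← hg, linGroup.inv_mat]⟩

theorem mul_mem_loopGroup (hβ : β ∈ loopGroup 𝔤 w) (hγ : γ ∈ loopGroup 𝔤 w) :
    β * γ ∈ loopGroup 𝔤 w := by
  intro z
  obtain ⟨g, hg⟩ := hγ z
  obtain ⟨b, hb⟩ := hβ z
  exact ⟨b * g, by rw [linGroup.mat_mul, hg, hb, MatWiener.eval_mul]⟩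

theorem one_mem_loopGroup : (1 : MatWiener n w) ∈ loopGroup 𝔤 w := fun z =>
  ⟨1, by rw [linGroup.mat_one, MatWiener.eval_one]⟩

theorem conj_mem_of_mem_loopGroup (hγ : γ ∈ loopGroup 𝔤 w) (z : Circle)
    {x : Matrix (Fin n) (Fin n) ℂ} (hx : x ∈ 𝔤) : γ.eval z * x * γ.adj.eval z ∈ 𝔤 := by
  obtain ⟨g, hg⟩ := hγ z
  rw [← inv_eval hγ, ← hg, linGroup.inv_mat]
  exact linGroup.conj_mem g hx

/-- The gauge relation by a given loop. -/
def GaugeBy (γ : MatWiener n w) (x y : ExtLoopAlgebra 𝔤 w) : Prop :=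
  y.2 = x.2 ∧ ∀ z : Circle, MatWiener.eval y.1.1 z =
    γ.eval z * MatWiener.eval x.1.1 z * γ.adj.eval z + x.2 • (γ.eval z * circleD γ.adj.eval z)

theorem gaugeConj_iff {x y : ExtLoopAlgebra 𝔤 w} :
    GaugeConj x y ↔ ∃ γ ∈ loopGroup 𝔤 w, GaugeBy γ x y := by
  constructor
  · rintro ⟨γ, hγ, h2, h⟩
    refine ⟨γ, hγ, h2, fun z => ?_⟩
    rw [h z]
    simp only [inv_eval hγ]
  · rintro ⟨γ, hγ, h2, h⟩
    refine ⟨γ, hγ, h2, fun z => ?_⟩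
    rw [h z]
    simp only [inv_eval hγ]

theorem GaugeConj.refl (x : ExtLoopAlgebra 𝔤 w) : GaugeConj x x := by
  refine ⟨1, one_mem_loopGroup, rfl, fun z => ?_⟩
  simp [circleD_const]

theorem GaugeConj.symm {x y : ExtLoopAlgebra 𝔤 w} (h : GaugeConj x y) : GaugeConj y x := by
  rw [gaugeConj_iff] at h
  obtain ⟨γ, hγ, h2, h⟩ := h
  refine ⟨γ.adj, adj_mem_loopGroup hγ, h2.symm, fun z => ?_⟩
  have hinv : ∀ ζ, (γ.adj.eval ζ)⁻¹ = γ.eval ζ := fun ζ =>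
    Matrix.inv_eq_right_inv (adj_mul_eval hγ ζ)
  simp only [hinv]
  have h1 := circleD_mul γ.adj γ z
  simp only [adj_mul_eval hγ, circleD_const] at h1
  have h3 : γ.adj.eval z * circleD γ.eval z = -(circleD γ.adj.eval z * γ.eval z) :=
    eq_neg_of_add_eq_zero_right h1.symm
  have h4 := adj_mul_eval hγ z
  rw [h z, h2, h3]
  set a := γ.eval z
  set b := γ.adj.eval z
  set X := MatWiener.eval x.1.1 z
  calc X = (b * a) * X * (b * a) + x.2 • ((b * a) * circleD γ.adj.eval z * a +
        -(circleD γ.adj.eval z * a)) := by rw [h4]; simp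
    _ = b * (a * X * b + x.2 • (a * circleD γ.adj.eval z)) * a +
        x.2 • -(circleD γ.adj.eval z * a) := by
        simp only [mul_add, add_mul, smul_add, Matrix.mul_smul, Matrix.smul_mul, mul_assoc,
          add_assoc]

theorem GaugeConj.trans {x y v : ExtLoopAlgebra 𝔤 w} (h : GaugeConj x y) (h' : GaugeConj y v) :
    GaugeConj x v := by
  rw [gaugeConj_iff] at h h'
  obtain ⟨γ, hγ, h2, h⟩ := h
  obtain ⟨β, hβ, h2', h'⟩ := h'
  refine ⟨β * γ, mul_mem_loopGroup hβ hγ, h2'.trans h2, fun z => ?_⟩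
  have hinv : ∀ ζ, ((β * γ).eval ζ)⁻¹ = γ.adj.eval ζ * β.adj.eval ζ := fun ζ => by
    rw [MatWiener.eval_mul, Matrix.mul_inv_rev, inv_eval hγ, inv_eval hβ]
  simp only [hinv]
  rw [circleD_mul, h' z, h z, h2, MatWiener.eval_mul]
  have h4 := eval_mul_adj hγ z
  set a := γ.eval z
  set a' := γ.adj.eval z
  set b := β.eval z
  set b' := β.adj.eval z
  set X := MatWiener.eval x.1.1 z
  set Y := circleD β.adj.eval z
  calc b * (a * X * a' + x.2 • (a * circleD γ.adj.eval z)) * b' + x.2 • (b * Y)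
      = b * (a * X * a' + x.2 • (a * circleD γ.adj.eval z)) * b' +
        x.2 • (b * (a * a') * Y) := by rw [h4, mul_one]
    _ = _ := by
        simp only [mul_add, add_mul, smul_add, Matrix.mul_smul, Matrix.smul_mul, mul_assoc,
          add_assoc]

/-- Conjugation by a loop, as a continuous linear map of the loop algebra. -/
def loopConj (hγ : γ ∈ loopGroup 𝔤 w) : loopAlgebra 𝔤 w →L[ℂ] loopAlgebra 𝔤 w :=
  ((((ContinuousLinearMap.mul ℂ (MatWiener n w)).flip γ.adj).comp
    (ContinuousLinearMap.mul ℂ (MatWiener n w) γ)).comp (loopAlgebra 𝔤 w).subtypeL).codRestrict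
      (loopAlgebra 𝔤 w) fun x z => by
        have h : MatWiener.eval (γ * x.1 * γ.adj) z ∈ 𝔤 := by
          rw [MatWiener.eval_mul, MatWiener.eval_mul]
          exact conj_mem_of_mem_loopGroup hγ z (x.2 z)
        exact h

theorem eval_loopConj (hγ : γ ∈ loopGroup 𝔤 w) (x : loopAlgebra 𝔤 w) (z : Circle) :
    MatWiener.eval (loopConj hγ x).1 z = γ.eval z * MatWiener.eval x.1 z * γ.adj.eval z := by
  have h : (loopConj hγ x).1 = γ * x.1 * γ.adj := rfl
  rw [h, MatWiener.eval_mul, MatWiener.eval_mul]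

/-- For fixed `γ` the action is linear in `(φ, p)` jointly. That `γ D(γ⁻¹)` lies in `L𝔤` is not
clear for `γ` with entries in `A_w` only, so it is recovered from the given pair as `(y.1 - γ x.1
γ⁻¹) / x.2`. -/
theorem GaugeConj.exists_continuousLinearMap {x y : ExtLoopAlgebra 𝔤 w} (h : GaugeConj x y)
    (hx : x.2 ≠ 0) : ∃ A : ExtLoopAlgebra 𝔤 w →L[ℂ] ExtLoopAlgebra 𝔤 w,
      A x = y ∧ ∀ v, GaugeConj v (A v) := by
  rw [gaugeConj_iff] at h
  obtain ⟨γ, hγ, h2, h⟩ := h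
  let L := loopConj (𝔤 := 𝔤) hγ
  let A : ExtLoopAlgebra 𝔤 w →L[ℂ] ExtLoopAlgebra 𝔤 w :=
    (L.comp (ContinuousLinearMap.fst ℂ _ _) +
      (ContinuousLinearMap.snd ℂ _ _).smulRight (x.2⁻¹ • (y.1 - L x.1))).prod
      (ContinuousLinearMap.snd ℂ _ _)
  have hA : ∀ v, A v = (L v.1 + v.2 • x.2⁻¹ • (y.1 - L x.1), v.2) := fun v => rfl
  refine ⟨A, ?_, fun v => gaugeConj_iff.2 ⟨γ, hγ, rfl, fun z => ?_⟩⟩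
  · rw [hA, smul_smul, mul_inv_cancel₀ hx, one_smul, add_sub_cancel, ← h2]
  · have h3 : (A v).1.1 = (L v.1).1 + v.2 • x.2⁻¹ • (y.1.1 - (L x.1).1) := rfl
    rw [h3, MatWiener.eval_add, MatWiener.eval_smul, MatWiener.eval_smul, MatWiener.eval_sub,
      eval_loopConj, eval_loopConj, h z, add_sub_cancel_left, smul_smul x.2⁻¹,
      inv_mul_cancel₀ hx, one_smul]

/-- The gauge term `p γ D(γ⁻¹)` is precisely what differentiating the factor `γ(e^{it})`
contributes. Evaluated at `2π`, where `γ` has returned to `γ(1)`, this conjugates the monodromy by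
`γ(1)`. -/
theorem SolvesMonodromy.gauge {x y : ExtLoopAlgebra 𝔤 w} (hγ : γ ∈ loopGroup 𝔤 w)
    (h : GaugeBy γ x y) (hx : x.2 ≠ 0) {g : Circle → linGroup 𝔤}
    (hg : ∀ z, linGroup.mat (g z) = γ.eval z) {f : ℝ → linGroup 𝔤} (hf : SolvesMonodromy x f) :
    SolvesMonodromy y fun t => g (Circle.exp t) * f t * (g 1)⁻¹ := by
  refine ⟨by simp [hf.1], fun t => ?_⟩
  obtain ⟨F', hF, hF'⟩ := hf.2 t
  replace hF : HasMatDeriv (fun s => linGroup.mat (f s)) F' t := hF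
  obtain ⟨Γ', hΓ⟩ := γ.exists_hasMatDeriv 1 t
  obtain ⟨Δ', hΔ⟩ := γ.adj.exists_hasMatDeriv (Circle.exp t) 0
  obtain ⟨Γ₂, hΓ₂⟩ := γ.exists_hasMatDeriv (Circle.exp t) 0
  -- The derivative at time `t` based at 1 equals the derivative at time 0 based at `e^{it}`, the
  -- form used by `circleD`.
  have hΓΓ : Γ' = Γ₂ := by
    ext i j
    have h1 : HasDerivAt (fun s : ℝ => γ.eval (Circle.exp (s - t) * Circle.exp t) i j)
        (Γ₂ i j) t := HasDerivAt.comp_sub_const t t (by simpa using hΓ₂ i j)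
    refine (hΓ i j).unique (h1.congr_of_eventuallyEq (Filter.Eventually.of_forall fun s => ?_))
    simp only [← Circle.exp_add, sub_add_cancel, mul_one]
  have hprod := (hΓ₂.mul hΔ).unique ((HasMatDeriv.const 1 0).congr
    fun s => eval_mul_adj hγ (Circle.exp s * Circle.exp t))
  simp only [Circle.exp_zero, one_mul] at hprod
  have hcurve : HasMatDeriv (fun s => linGroup.mat (g (Circle.exp s) * f s * (g 1)⁻¹))
      ((Γ' * linGroup.mat (f t) + γ.eval (Circle.exp t) * F') * linGroup.mat (g 1)⁻¹) t := by
    have h1 := (hΓ.mul hF).mul_const (linGroup.mat (g 1)⁻¹)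
    simp only [mul_one] at h1
    exact h1.congr fun s => by rw [linGroup.mat_mul, linGroup.mat_mul, hg]
  refine ⟨_, hcurve, ?_⟩
  -- The prefactor `1/(ip)` of the equation cancels the `p` of the gauge term and the `-i` in `D`,
  -- leaving the sign from differentiating `γ⁻¹`.
  have hI : 1 / (Complex.I * x.2) * x.2 * -Complex.I = -1 := by
    field_simp
  rw [linGroup.inv_mat, h.1, h.2, circleD_eq hΔ, smul_add, ← Matrix.smul_mul, ← Matrix.mul_smul,
    ← hF', Matrix.mul_smul, smul_smul, smul_smul, hI, neg_one_smul]
  rw [← eq_neg_of_add_eq_zero_left hprod, linGroup.inv_mat, ← hΓΓ]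
  simp only [mul_inv_rev, inv_inv, linGroup.mat_mul]
  have h1 := linGroup.mat_inv_mul_mat (g 1)
  have h2 := linGroup.mat_mul_mat_inv (f t)
  have h3 : linGroup.mat (g (Circle.exp t))⁻¹ = γ.adj.eval (Circle.exp t) := by
    rw [← linGroup.inv_mat, hg, inv_eval hγ]
  rw [h3]
  set a := γ.eval (Circle.exp t)
  set a' := γ.adj.eval (Circle.exp t)
  calc (Γ' * linGroup.mat (f t) + a * F') * linGroup.mat (g 1)⁻¹ *
        (linGroup.mat (g 1) * (linGroup.mat (f t)⁻¹ * a'))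
      = (Γ' * linGroup.mat (f t) + a * F') * (linGroup.mat (g 1)⁻¹ * linGroup.mat (g 1)) *
        (linGroup.mat (f t)⁻¹ * a') := by simp only [mul_assoc]
    _ = Γ' * (linGroup.mat (f t) * linGroup.mat (f t)⁻¹) * a' +
        a * (F' * linGroup.mat (f t)⁻¹) * a' := by
        rw [h1, mul_one, add_mul]
        simp only [mul_assoc]
    _ = _ := by rw [h2, mul_one, add_comm]

theorem IsMonodromy.gauge {x y : ExtLoopAlgebra 𝔤 w} (h : GaugeConj x y) (hx : x.2 ≠ 0)
    {M : linGroup 𝔤} (hM : IsMonodromy x M) :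
    ∃ a : linGroup 𝔤, IsMonodromy y (a * M * a⁻¹) := by
  obtain ⟨γ, hγ, h⟩ := gaugeConj_iff.1 h
  obtain ⟨f, hf, rfl⟩ := hM
  choose g hg using id hγ
  refine ⟨g 1, _, SolvesMonodromy.gauge hγ h hx hg hf, ?_⟩
  simp

/-- For two solutions, `f⁻¹ g` has zero derivative and equals 1 at 0. -/
theorem SolvesMonodromy.unique {x : ExtLoopAlgebra 𝔤 w} {f g : ℝ → linGroup 𝔤}
    (hf : SolvesMonodromy x f) (hg : SolvesMonodromy x g) : f = g := by
  have key : ∀ t, HasMatDeriv (fun s => (linGroup.mat (f s))⁻¹ * linGroup.mat (g s)) 0 t := by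
    intro t
    obtain ⟨F', hF, hF'⟩ := hf.2 t
    obtain ⟨G', hG, hG'⟩ := hg.2 t
    replace hF : HasMatDeriv (fun s => linGroup.mat (f s)) F' t := hF
    replace hG : HasMatDeriv (fun s => linGroup.mat (g s)) G' t := hG
    have h1 := (hF.inv_of_det fun s => linGroup.det_mat (f s)).mul hG
    rw [← hF', linGroup.inv_mat, linGroup.inv_mat] at hG'
    have h2 := linGroup.mat_inv_mul_mat (g t)
    have h3 : G' = F' * linGroup.mat (f t)⁻¹ * linGroup.mat (g t) := by
      rw [← hG', mul_assoc, h2, mul_one]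
    convert! h1 using 1
    rw [h3, linGroup.inv_mat]
    simp only [neg_mul, mul_assoc, neg_add_cancel]
  funext t
  refine linGroup.mat_injective ?_
  have h1 := HasMatDeriv.eq_of_deriv_zero key t 0
  simp only [hf.1, hg.1, linGroup.mat_one, linGroup.inv_mat, inv_one, mul_one] at h1
  calc linGroup.mat (f t) = linGroup.mat (f t) * (linGroup.mat (f t)⁻¹ * linGroup.mat (g t)) := by
        rw [h1, mul_one]
    _ = linGroup.mat (g t) := by rw [← mul_assoc, linGroup.mat_mul_mat_inv, one_mul]

theorem IsMonodromy.unique {x : ExtLoopAlgebra 𝔤 w} {M M' : linGroup 𝔤}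
    (h : IsMonodromy x M) (h' : IsMonodromy x M') : M = M' := by
  obtain ⟨f, hf, rfl⟩ := h
  obtain ⟨g, hg, rfl⟩ := h'
  rw [hf.unique hg]

theorem constLoop_eval (w : Weight) (μ : 𝔤) (z : Circle) :
    MatWiener.eval (constLoop w μ).1 z = μ :=
  MatWiener.eval_const (w := w) (μ : Matrix (Fin n) (Fin n) ℂ) z

/-- The logarithm of the monodromy of a constant loop. -/
def logMonodromy {𝔥 : LieSubalgebra ℂ 𝔤} (y : 𝔥 × ℂ) : 𝔥 :=
  ((2 * Real.pi : ℝ) / (Complex.I * y.2) : ℂ) • y.1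

theorem isMonodromy_cartanIncl [LieAlgebra.IsSimple ℂ 𝔤] {𝔥 : LieSubalgebra ℂ 𝔤} (y : 𝔥 × ℂ)
    {c : linGroup 𝔤} (hc : linGroup.mat c = NormedSpace.exp (cmat (logMonodromy y))) :
    IsMonodromy (cartanIncl w y) c := by
  set A : Matrix (Fin n) (Fin n) ℂ := (1 / (Complex.I * y.2)) • cmat y.1 with hA
  have hmem : ∀ t : ℝ, (t : ℂ) • A ∈ 𝔤 := fun t =>
    𝔤.smul_mem _ (𝔤.smul_mem _ (y.1 : 𝔤).2)
  choose f hf using fun t : ℝ => exists_mat_eq_exp ‹_› (hmem t)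
  refine ⟨f, ⟨?_, fun t => ⟨A * NormedSpace.exp ((t : ℂ) • A), fun i j => ?_, ?_⟩⟩, ?_⟩
  · refine linGroup.mat_injective ?_
    rw [hf, linGroup.mat_one]
    simp
  · simp only [hf]
    exact hasDerivAt_exp_smul A t i j
  · have h1 := linGroup.mat_mul_mat_inv (f t)
    rw [← hf t, linGroup.inv_mat, mul_assoc, h1, mul_one, hA]
    congr 1
    exact (constLoop_eval w (y.1 : 𝔤) _).symm
  · refine linGroup.mat_injective ?_
    rw [hf, hc]
    congr 1
    have h2 : cmat (logMonodromy y) = ((2 * Real.pi : ℝ) / (Complex.I * y.2) : ℂ) • cmat y.1 := rfl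
    rw [h2, hA, smul_smul, mul_one_div]

end Loops

end LoopToda

end

/-! ### The linearized gauge action on single Fourier modes. -/

noncomputable section

namespace LoopToda

section Modes

variable {n : ℕ} {𝔤 : LieSubalgebra ℂ (Matrix (Fin n) (Fin n) ℂ)} {𝔥 : LieSubalgebra ℂ 𝔤}
  [LieAlgebra.IsSimple ℂ 𝔤] [𝔥.IsCartanSubalgebra] {ξ : 𝔥} {q : ℂ}

/-- The regularity condition on a point of `𝔥 × ℂ`, on the level of Lie algebras. -/
def RegPoint (y : 𝔥 × ℂ) : Prop :=
  y.2 ≠ 0 ∧ InfReg 𝔥 (NormedSpace.exp (cmat (logMonodromy y)))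

-- Rescaling `ξ` by `2π/(iq)` turns the eigenvalue of `ad ξ` into `2πik`, whose exponential is 1;
-- hence `x` commutes with the monodromy.
omit [LieAlgebra.IsSimple ℂ 𝔤] [𝔥.IsCartanSubalgebra] in
theorem RegPoint.mem_of_eigenvector (h : RegPoint (ξ, q)) {x : Matrix (Fin n) (Fin n) ℂ}
    (hx : x ∈ 𝔤) (k : ℤ) (hk : x * cmat ξ - cmat ξ * x - (q * k) • x = 0) :
    x ∈ cartanMat 𝔥 := by
  refine h.2 x hx ?_
  have h1 : cmat ξ * x - x * cmat ξ = -(q * k) • x := by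
    rw [← neg_sub, sub_eq_zero.1 hk, neg_smul]
  have h2 : cmat (logMonodromy (ξ, q)) * x - x * cmat (logMonodromy (ξ, q)) =
      (k * (2 * Real.pi * Complex.I)) • x := by
    have h3 : cmat (logMonodromy (ξ, q)) =
        ((2 * Real.pi : ℝ) / (Complex.I * q) : ℂ) • cmat ξ := rfl
    rw [h3, Matrix.smul_mul, Matrix.mul_smul, ← smul_sub, h1, smul_smul]
    congr 1
    have hq : q ≠ 0 := h.1
    have hI : Complex.I * Complex.I = -1 := Complex.I_mul_I
    field_simp
    push_cast
    linear_combination -(2 * Real.pi * k : ℂ) * hI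
  have h3 := exp_conj_eigenvector h2
  rw [Complex.exp_int_mul_two_pi_mul_I, one_smul] at h3
  exact h3

/-- The complement of the Cartan subalgebra given by the image of `ad ξ`. -/
def adRange (ξ : 𝔥) : Submodule ℂ (Matrix (Fin n) (Fin n) ℂ) :=
  𝔤.toSubmodule.map (LinearMap.mulRight ℂ (cmat ξ) - LinearMap.mulLeft ℂ (cmat ξ))

omit [LieAlgebra.IsSimple ℂ 𝔤] [𝔥.IsCartanSubalgebra] in
theorem sub_mem_of_mem {x y : Matrix (Fin n) (Fin n) ℂ} (hx : x ∈ 𝔤) (hy : y ∈ 𝔤) :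
    x * y - y * x ∈ 𝔤 := 𝔤.lie_mem hx hy

omit [LieAlgebra.IsSimple ℂ 𝔤] [𝔥.IsCartanSubalgebra] in
theorem mem_adRange {x : Matrix (Fin n) (Fin n) ℂ} :
    x ∈ adRange ξ ↔ ∃ y ∈ 𝔤, y * cmat ξ - cmat ξ * y = x := Iff.rfl

omit [LieAlgebra.IsSimple ℂ 𝔤] [𝔥.IsCartanSubalgebra] in
theorem mem_of_mem_adRange {x : Matrix (Fin n) (Fin n) ℂ} (hx : x ∈ adRange ξ) : x ∈ 𝔤 := by
  obtain ⟨y, hy, rfl⟩ := mem_adRange.1 hx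
  exact sub_mem_of_mem hy (ξ : 𝔤).2

/-- Suppose `[y, ξ] ∈ 𝔥`. By the Jacobi identity `[[y, v], ξ] = 0` for every `v ∈ 𝔥`, so `[y, v] ∈
𝔥` by regularity. Thus `y` normalizes `𝔥`, hence lies in it, and `[y, ξ] = 0`. -/
theorem RegPoint.eq_zero_of_mem (h : RegPoint (ξ, q)) {x : Matrix (Fin n) (Fin n) ℂ}
    (hx : x ∈ adRange ξ) (hx' : x ∈ cartanMat 𝔥) : x = 0 := by
  obtain ⟨y, hy, rfl⟩ := mem_adRange.1 hx
  have hξ := coe_mem_cartanMat ξ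
  have hy' : y ∈ cartanMat 𝔥 := by
    refine mem_cartanMat_of_normalizes hy fun v hv => ?_
    refine h.mem_of_eigenvector (sub_mem_of_mem hy (mem_of_mem_cartanMat hv)) 0 ?_
    have h1 := (cartanMat_commute hx' hv).eq
    have h2 := (cartanMat_commute hv hξ).eq
    rw [Int.cast_zero, mul_zero, zero_smul, sub_zero]
    have h3 : (y * v - v * y) * cmat ξ - cmat ξ * (y * v - v * y) =
        ((y * cmat ξ - cmat ξ * y) * v - v * (y * cmat ξ - cmat ξ * y)) +
          (y * (v * cmat ξ - cmat ξ * v) - (v * cmat ξ - cmat ξ * v) * y) := by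
      noncomm_ring
    rw [h3, h1, h2]
    simp
  rw [(cartanMat_commute hy' hξ).eq, sub_self]

/-- The operator `x ↦ [x, ξ] - c x` on `𝔤`. -/
def modeOp (ξ : 𝔥) (c : ℂ) : 𝔤 →ₗ[ℂ] 𝔤 :=
  ((LinearMap.mulRight ℂ (cmat ξ) - LinearMap.mulLeft ℂ (cmat ξ) -
    c • LinearMap.id).comp 𝔤.toSubmodule.subtype).codRestrict 𝔤.toSubmodule fun x =>
      𝔤.toSubmodule.sub_mem (sub_mem_of_mem x.2 (ξ : 𝔤).2) (𝔤.toSubmodule.smul_mem c x.2)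

omit [LieAlgebra.IsSimple ℂ 𝔤] [𝔥.IsCartanSubalgebra] in
theorem modeOp_apply (c : ℂ) (x : 𝔤) : (modeOp ξ c x : Matrix (Fin n) (Fin n) ℂ) =
    x * cmat ξ - cmat ξ * x - c • (x : Matrix (Fin n) (Fin n) ℂ) := rfl

theorem RegPoint.eq_zero_of_mode (h : RegPoint (ξ, q)) {k : ℤ} (hk : k ≠ 0)
    {x : Matrix (Fin n) (Fin n) ℂ} (hx : x ∈ 𝔤)
    (h0 : x * cmat ξ - cmat ξ * x - (q * k) • x = 0) : x = 0 := by
  have h1 := h.mem_of_eigenvector hx k h0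
  rw [(cartanMat_commute h1 (coe_mem_cartanMat ξ)).eq, sub_self, zero_sub, neg_eq_zero,
    smul_eq_zero] at h0
  refine h0.resolve_left (mul_ne_zero h.1 (Int.cast_ne_zero.2 hk))

theorem RegPoint.exists_mode (h : RegPoint (ξ, q)) {k : ℤ} (hk : k ≠ 0)
    {v : Matrix (Fin n) (Fin n) ℂ} (hv : v ∈ 𝔤) :
    ∃ x ∈ 𝔤, x * cmat ξ - cmat ξ * x - (q * k) • x = v := by
  have hinj : Function.Injective (modeOp ξ (q * k)) := by
    rw [injective_iff_map_eq_zero]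
    intro x hx
    exact Subtype.ext (h.eq_zero_of_mode hk x.2 (congrArg Subtype.val hx))
  obtain ⟨x, hx⟩ := LinearMap.surjective_of_injective hinj ⟨v, hv⟩
  exact ⟨x, x.2, congrArg Subtype.val hx⟩

/-- The kernel and the range of `[·, ξ]` on `𝔤` meet trivially, so by rank-nullity they are
complementary. -/
theorem RegPoint.exists_mode_zero (h : RegPoint (ξ, q)) {v : Matrix (Fin n) (Fin n) ℂ}
    (hv : v ∈ 𝔤) : ∃ x ∈ adRange ξ, ∃ η : 𝔥, x * cmat ξ - cmat ξ * x + cmat η = v := by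
  set f := modeOp ξ 0
  have hf : ∀ x : 𝔤, (f x : Matrix (Fin n) (Fin n) ℂ) = x * cmat ξ - cmat ξ * x := fun x => by
    rw [modeOp_apply, zero_smul, sub_zero]
  have hker : ∀ x : 𝔤, f x = 0 → (x : Matrix (Fin n) (Fin n) ℂ) ∈ cartanMat 𝔥 := by
    intro x hx
    refine h.mem_of_eigenvector x.2 0 ?_
    rw [Int.cast_zero, mul_zero, zero_smul, sub_zero, ← hf, hx]
    rfl
  have hdisj : Disjoint (LinearMap.ker f) (LinearMap.range f) := by
    rw [Submodule.disjoint_def]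
    rintro _ hx ⟨y, rfl⟩
    exact Subtype.ext (h.eq_zero_of_mem ⟨y, y.2, (hf y).symm⟩ (hker _ hx))
  have hcompl : LinearMap.ker f ⊔ LinearMap.range f = ⊤ :=
    Submodule.eq_top_of_disjoint _ _
      (by rw [add_comm, LinearMap.finrank_range_add_finrank_ker]) hdisj
  have hdec : ∀ x : 𝔤, ∃ a : 𝔤, f a = 0 ∧ ∃ b : 𝔤, a + f b = x := fun x => by
    obtain ⟨a, ha, _, ⟨b, rfl⟩, hab⟩ := Submodule.mem_sup.1
      (hcompl ▸ Submodule.mem_top : x ∈ LinearMap.ker f ⊔ LinearMap.range f)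
    exact ⟨a, ha, b, hab⟩
  obtain ⟨a, ha, b, hab⟩ := hdec ⟨v, hv⟩
  -- Splitting the preimage once more drops its kernel component, so that the solution itself lies
  -- in the range, as the slice requires.
  obtain ⟨a', ha', b', rfl⟩ := hdec b
  rw [map_add, ha', zero_add] at hab
  obtain ⟨η, hη⟩ := exists_of_mem_cartanMat (hker a ha)
  refine ⟨f b', ⟨b', b'.2, (hf b').symm⟩, η, ?_⟩
  rw [← hf, hη, add_comm]
  exact congrArg Subtype.val hab

end Modes

end LoopToda

end

/-! ### The gauge action of exponentials in abstract Banach algebras. -/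

noncomputable section

namespace LoopToda

section AbstractSlice

variable {𝔸 𝔹 H : Type*} [NormedRing 𝔸] [NormedAlgebra ℂ 𝔸] [CompleteSpace 𝔸]
  [NormedRing 𝔹] [NormedAlgebra ℂ 𝔹] [NormedAddCommGroup H] [NormedSpace ℂ H]

/-- The gauge action of `exp u` on a constant loop, in an abstract form. -/
def sliceMap (ι δ : 𝔸 →L[ℂ] 𝔹) (c : H →L[ℂ] 𝔹) (x : 𝔸 × H × ℂ) : 𝔹 :=
  ι (NormedSpace.exp x.1) * c x.2.1 * ι (NormedSpace.exp (-x.1)) +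
    x.2.2 • (ι (NormedSpace.exp x.1) * δ (NormedSpace.exp (-x.1)))

theorem contDiff_banach_exp : ContDiff ℂ ω (NormedSpace.exp : 𝔸 → 𝔸) :=
  AnalyticOnNhd.contDiff fun x _ => NormedSpace.exp_analytic x

theorem contDiff_sliceMap (ι δ : 𝔸 →L[ℂ] 𝔹) (c : H →L[ℂ] 𝔹) : ContDiff ℂ ω (sliceMap ι δ c) := by
  have h1 : ContDiff ℂ ω fun x : 𝔸 × H × ℂ => NormedSpace.exp x.1 :=
    contDiff_banach_exp.comp contDiff_fst
  have h2 : ContDiff ℂ ω fun x : 𝔸 × H × ℂ => NormedSpace.exp (-x.1) :=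
    contDiff_banach_exp.comp contDiff_fst.neg
  have h3 : ContDiff ℂ ω fun x : 𝔸 × H × ℂ => c x.2.1 :=
    c.contDiff.comp (contDiff_fst.comp contDiff_snd)
  exact (((ι.contDiff.comp h1).mul h3).mul (ι.contDiff.comp h2)).add
    ((contDiff_snd.comp contDiff_snd).smul ((ι.contDiff.comp h1).mul (δ.contDiff.comp h2)))

/-- Since `exp` has derivative the identity at 0, only the product rule is needed; the variation of
`p` drops out because it multiplies `δ 1 = 0`. -/
theorem exists_hasFDerivAt_sliceMap {ι δ : 𝔸 →L[ℂ] 𝔹} (hι : ι 1 = 1) (hδ : δ 1 = 0)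
    (c : H →L[ℂ] 𝔹) (h : H) (p : ℂ) : ∃ L : 𝔸 × H × ℂ →L[ℂ] 𝔹,
      HasFDerivAt (sliceMap ι δ c) L (0, h, p) ∧
      ∀ x, L x = ι x.1 * c h - c h * ι x.1 + c x.2.1 - p • δ x.1 := by
  have h0 : HasFDerivAt (NormedSpace.exp : 𝔸 → 𝔸) (1 : 𝔸 →L[ℂ] 𝔸) 0 :=
    hasFDerivAt_exp_zero
  have hf : HasFDerivAt (fun x : 𝔸 × H × ℂ => x.1) (ContinuousLinearMap.fst ℂ 𝔸 (H × ℂ))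
    (0, h, p) := hasFDerivAt_fst
  have h1 : HasFDerivAt (fun x : 𝔸 × H × ℂ => NormedSpace.exp x.1)
      ((1 : 𝔸 →L[ℂ] 𝔸).comp (ContinuousLinearMap.fst ℂ 𝔸 (H × ℂ))) (0, h, p) :=
    HasFDerivAt.comp (g := NormedSpace.exp) (0, h, p) h0 hf
  have h2 : HasFDerivAt (fun x : 𝔸 × H × ℂ => NormedSpace.exp (-x.1))
      ((1 : 𝔸 →L[ℂ] 𝔸).comp (-ContinuousLinearMap.fst ℂ 𝔸 (H × ℂ))) (0, h, p) := by
    have h0' : HasFDerivAt (NormedSpace.exp : 𝔸 → 𝔸) (1 : 𝔸 →L[ℂ] 𝔸)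
      (-(0, h, p).1 : 𝔸) := by simpa using h0
    exact HasFDerivAt.comp (g := NormedSpace.exp) (0, h, p) h0' hf.neg
  have h3 : HasFDerivAt (fun x : 𝔸 × H × ℂ => c x.2.1)
      (c.comp ((ContinuousLinearMap.fst ℂ H ℂ).comp (ContinuousLinearMap.snd ℂ 𝔸 (H × ℂ))))
      (0, h, p) :=
    (c.comp ((ContinuousLinearMap.fst ℂ H ℂ).comp
      (ContinuousLinearMap.snd ℂ 𝔸 (H × ℂ)))).hasFDerivAt
  have h4 : HasFDerivAt (fun x : 𝔸 × H × ℂ => x.2.2)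
      ((ContinuousLinearMap.snd ℂ H ℂ).comp (ContinuousLinearMap.snd ℂ 𝔸 (H × ℂ)))
      (0, h, p) :=
    ((ContinuousLinearMap.snd ℂ H ℂ).comp (ContinuousLinearMap.snd ℂ 𝔸 (H × ℂ))).hasFDerivAt
  have h5 := (((ι.hasFDerivAt.comp (0, h, p) h1).mul' h3).mul' (ι.hasFDerivAt.comp (0, h, p) h2)).add
    (h4.smul ((ι.hasFDerivAt.comp (0, h, p) h1).mul' (δ.hasFDerivAt.comp (0, h, p) h2)))
  refine ⟨_, h5, fun x => ?_⟩
  simp [hι, hδ]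
  abel

/-- The curve `s ↦ e^{su} δ(e^{-su})` has derivative `-e^{su} (δu) e^{-su}` and vanishes at `s = 0`.
A functional killing the derivative therefore kills the curve; this shows that `e^u D(e^{-u})` is
𝔤-valued. -/
theorem functional_eq_zero {ι δ : 𝔸 →L[ℂ] 𝔹} (hι : ∀ a b, ι (a * b) = ι a * ι b)
    (hι1 : ι 1 = 1) (hδ1 : δ 1 = 0)
    (hδ : ∀ a b, δ (a * b) = δ a * ι b + ι a * δ b) (l : 𝔹 →L[ℂ] ℂ) (u : 𝔸)
    (h : ∀ s : ℂ, l (ι (NormedSpace.exp (s • u)) * δ u * ι (NormedSpace.exp (-(s • u)))) = 0) :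
    l (ι (NormedSpace.exp u) * δ (NormedSpace.exp (-u))) = 0 := by
  have h1 : ∀ s : ℂ, HasDerivAt (fun s : ℂ => NormedSpace.exp (s • u))
      (NormedSpace.exp (s • u) * u) s := fun s => hasDerivAt_exp_smul_const u s
  have h2 : ∀ s : ℂ, HasDerivAt (fun s : ℂ => NormedSpace.exp (-(s • u)))
      (-(u * NormedSpace.exp (-(s • u)))) s := fun s => by
    simpa using hasDerivAt_exp_smul_const' (-u) s
  have h3 : ∀ s : ℂ, HasDerivAt
      (fun s : ℂ => l (ι (NormedSpace.exp (s • u)) * δ (NormedSpace.exp (-(s • u))))) 0 s := by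
    intro s
    have h4 := l.hasFDerivAt.comp_hasDerivAt s
      (((ι.hasFDerivAt.comp_hasDerivAt s (h1 s)).mul (δ.hasFDerivAt.comp_hasDerivAt s (h2 s))))
    convert! h4 using 1
    rw [← neg_eq_zero.2 (h s), ← map_neg]
    congr 1
    simp only [Function.comp_apply, hι, hδ, map_neg]
    noncomm_ring
  have h5 := is_const_of_deriv_eq_zero (fun s => (h3 s).differentiableAt)
    (fun s => (h3 s).deriv) 1 0
  simpa [hδ1, hι1] using h5

end AbstractSlice

end LoopToda

end

/-! ### Inverse function theorem, and loops built from matrix Fourier coefficients. -/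

noncomputable section

namespace LoopToda

open scoped Wiener MatWiener

theorem exists_local_inverse {E F : Type*} [NormedAddCommGroup E] [NormedSpace ℂ E]
    [CompleteSpace E] [NormedAddCommGroup F] [NormedSpace ℂ F] [CompleteSpace F] {f : E → F}
    {L : E →L[ℂ] F} {a : E} (hf : ContDiff ℂ ω f) (hL : HasFDerivAt f L a)
    (hinj : ∀ x, L x = 0 → x = 0) (hsurj : Function.Surjective L) :
    ∃ g : F → E, g (f a) = a ∧ (∀ᶠ y in nhds (f a), ContDiffAt ℝ ∞ g y) ∧
      ∀ᶠ y in nhds (f a), f (g y) = y := by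
  have hker : L.ker = ⊥ := LinearMap.ker_eq_bot'.2 hinj
  have hran : L.range = ⊤ := LinearMap.range_eq_top.2 hsurj
  have hL' : HasFDerivAt f (ContinuousLinearEquiv.ofBijective L hker hran : E →L[ℂ] F) a := by
    rwa [ContinuousLinearEquiv.coe_ofBijective]
  -- Working with class `ω` rather than `∞` matters below: being of class `ω` at a point persists
  -- nearby, so the inverse is smooth on a whole neighbourhood.
  have hn : (ω : WithTop ℕ∞) ≠ 0 := by simp
  have hs := hf.contDiffAt.hasStrictFDerivAt' hL' hn
  refine ⟨hf.contDiffAt.localInverse hL' hn, hf.contDiffAt.localInverse_apply_image hL' hn, ?_,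
    hs.eventually_right_inverse⟩
  filter_upwards [(hf.contDiffAt.to_localInverse hL' hn).eventually (by simp)] with y hy
  exact (hy.restrict_scalars ℝ).of_le le_top

section Coefficients

variable {n : ℕ} {w : Weight}

theorem norm_matrix_entry_le (A : Matrix (Fin n) (Fin n) ℂ) (i j : Fin n) : ‖A i j‖ ≤ ‖A‖ := by
  rw [Matrix.frobenius_norm_def]
  have h : ‖A i j‖ ^ (2 : ℝ) ≤ ∑ i, ∑ j, ‖A i j‖ ^ (2 : ℝ) :=
    (Finset.single_le_sum (f := fun j => ‖A i j‖ ^ (2 : ℝ)) (fun _ _ => by positivity)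
      (Finset.mem_univ j)).trans
      (Finset.single_le_sum (f := fun i => ∑ j, ‖A i j‖ ^ (2 : ℝ))
        (fun _ _ => by positivity) (Finset.mem_univ i))
  calc ‖A i j‖ = (‖A i j‖ ^ (2 : ℝ)) ^ (1 / 2 : ℝ) := by
        rw [← Real.rpow_mul (norm_nonneg _)]
        norm_num
    _ ≤ _ := Real.rpow_le_rpow (by positivity) h (by norm_num)

theorem norm_matrix_le_sum (A : Matrix (Fin n) (Fin n) ℂ) : ‖A‖ ≤ ∑ i, ∑ j, ‖A i j‖ := by
  rw [Matrix.frobenius_norm_def]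
  have h : ∑ i, ∑ j, ‖A i j‖ ^ (2 : ℝ) ≤ (∑ i, ∑ j, ‖A i j‖) ^ (2 : ℝ) := by
    simp only [Real.rpow_two]
    refine le_trans ?_ (Finset.sum_sq_le_sq_sum_of_nonneg fun i _ =>
      Finset.sum_nonneg fun j _ => norm_nonneg _)
    exact Finset.sum_le_sum fun i _ => Finset.sum_sq_le_sq_sum_of_nonneg fun j _ => norm_nonneg _
  refine (Real.rpow_le_rpow (by positivity) h (by norm_num)).trans (le_of_eq ?_)
  rw [← Real.rpow_mul (by positivity)]
  norm_num

namespace MatWiener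

theorem summable_norm_coeff (T : MatWiener n w) : Summable fun k => ‖T.coeff k‖ * w k := by
  have h : Summable fun k => ∑ i, ∑ j, ‖(T.entry i j).coeff k‖ * w k :=
    summable_sum fun i _ => summable_sum fun j _ => (T.entry i j).summable_weighted
  refine Summable.of_nonneg_of_le (fun k => mul_nonneg (norm_nonneg _) (w.pos' k).le)
    (fun k => ?_) h
  simp only [← Finset.sum_mul]
  exact mul_le_mul_of_nonneg_right (norm_matrix_le_sum _) (w.pos' k).le

theorem exists_coeff_eq (a : ℤ → Matrix (Fin n) (Fin n) ℂ) (h : Summable fun k => ‖a k‖ * w k) :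
    ∃ T : MatWiener n w, ∀ k, T.coeff k = a k :=
  ⟨of fun i j => Wiener.mk (fun k => a k i j)
    (Summable.of_nonneg_of_le (fun k => mul_nonneg (norm_nonneg _) (w.pos' k).le)
      (fun k => mul_le_mul_of_nonneg_right (norm_matrix_entry_le _ i j) (w.pos' k).le) h),
    fun _ => rfl⟩

theorem const_add (A B : Matrix (Fin n) (Fin n) ℂ) : const w (A + B) = const w A + const w B :=
  ext_eval fun z => by simp

theorem const_smul (c : ℂ) (A : Matrix (Fin n) (Fin n) ℂ) : const w (c • A) = c • const w A :=
  ext_eval fun z => by simp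

theorem const_mul_eq_applyLin (A : Matrix (Fin n) (Fin n) ℂ) (T : MatWiener n w) :
    const w A * T = applyLin (LinearMap.mulLeft ℂ A) T := ext_eval fun z => by simp

theorem mul_const_eq_applyLin (A : Matrix (Fin n) (Fin n) ℂ) (T : MatWiener n w) :
    T * const w A = applyLin (LinearMap.mulRight ℂ A) T := ext_eval fun z => by simp

theorem coeff_applyLin (P : Matrix (Fin n) (Fin n) ℂ →ₗ[ℂ] Matrix (Fin n) (Fin n) ℂ)
    (T : MatWiener n w) (k : ℤ) : (applyLin P T).coeff k = P (T.coeff k) := by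
  ext i j
  rw [coeff_apply, applyLin, piL_apply, coeff_applyFunctional]
  rfl

theorem coeff_const_mul (A : Matrix (Fin n) (Fin n) ℂ) (T : MatWiener n w) (k : ℤ) :
    (const w A * T).coeff k = A * T.coeff k := by
  rw [const_mul_eq_applyLin, coeff_applyLin, LinearMap.mulLeft_apply]

theorem coeff_mul_const (A : Matrix (Fin n) (Fin n) ℂ) (T : MatWiener n w) (k : ℤ) :
    (T * const w A).coeff k = T.coeff k * A := by
  rw [mul_const_eq_applyLin, coeff_applyLin, LinearMap.mulRight_apply]

theorem coeff_add (S T : MatWiener n w) (k : ℤ) : (S + T).coeff k = S.coeff k + T.coeff k := rfl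

theorem coeff_sub (S T : MatWiener n w) (k : ℤ) : (S - T).coeff k = S.coeff k - T.coeff k :=
  map_sub (coeffL k) S T

theorem coeff_smul (c : ℂ) (T : MatWiener n w) (k : ℤ) : (c • T).coeff k = c • T.coeff k := rfl

theorem coeff_zero (k : ℤ) : (0 : MatWiener n w).coeff k = 0 := rfl

theorem eval_exp (T : MatWiener n w) (z : Circle) :
    (NormedSpace.exp T).eval z = NormedSpace.exp (T.eval z) :=
  @banach_map_exp _ _ _ _ _ Matrix.frobeniusNormedRing Matrix.frobeniusNormedAlgebra
    (evalHom z) (evalL z).continuous T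

end MatWiener

theorem isClosed_submodule_matrix (V : Submodule ℂ (Matrix (Fin n) (Fin n) ℂ)) :
    IsClosed (V : Set (Matrix (Fin n) (Fin n) ℂ)) := V.closed_of_finiteDimensional

end Coefficients

end LoopToda

end

/-! ### The slice space, and 𝔤-valuedness of the gauge action of exponentials. -/

noncomputable section

namespace LoopToda

open scoped Wiener MatWiener

section Slice

variable {n : ℕ} {w : Weight} {𝔤 : LieSubalgebra ℂ (Matrix (Fin n) (Fin n) ℂ)}
  {𝔥 : LieSubalgebra ℂ 𝔤} {ξ : 𝔥} {q : ℂ}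

theorem mem_loopAlgebra_iff_coeff {x : MatWiener n w} :
    x ∈ loopAlgebra 𝔤 w ↔ ∀ k, x.coeff k ∈ 𝔤 :=
  MatWiener.eval_mem_iff_coeff_mem 𝔤.toSubmodule x

instance completeSpace_loopAlgebra : CompleteSpace (loopAlgebra 𝔤 w) := by
  refine completeSpace_coe_iff_isComplete.2 (IsClosed.isComplete ?_)
  have h : (loopAlgebra 𝔤 w : Set (MatWiener n w)) =
      ⋂ z : Circle, MatWiener.evalL z ⁻¹' (𝔤.toSubmodule : Set (Matrix (Fin n) (Fin n) ℂ)) := by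
    ext x
    simp only [Set.mem_iInter]
    rfl
  rw [h]
  exact isClosed_iInter fun z =>
    (isClosed_submodule_matrix 𝔤.toSubmodule).preimage (MatWiener.evalL z).continuous

/-- The loops in `𝔤` with derivative in the Wiener algebra and with the zeroth Fourier coefficient
in the image of `ad ξ`. -/
def sliceSpace (w : Weight) (ξ : 𝔥) : Submodule ℂ (MatWiener n w.diff) :=
  loopAlgebra 𝔤 w.diff ⊓ (adRange ξ).comap (MatWiener.coeffL 0).toLinearMap

theorem mem_sliceSpace {u : MatWiener n w.diff} :
    u ∈ sliceSpace w ξ ↔ u ∈ loopAlgebra 𝔤 w.diff ∧ u.coeff 0 ∈ adRange ξ := Iff.rfl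

instance completeSpace_sliceSpace : CompleteSpace (sliceSpace w ξ) := by
  refine completeSpace_coe_iff_isComplete.2 (IsClosed.isComplete ?_)
  have h : IsClosed (loopAlgebra 𝔤 w.diff : Set (MatWiener n w.diff)) :=
    (completeSpace_coe_iff_isComplete.1 completeSpace_loopAlgebra).isClosed
  exact h.inter ((isClosed_submodule_matrix (adRange ξ)).preimage
    (MatWiener.coeffL 0).continuous)

/-- The Cartan subalgebra as a normed space. -/
def CartanSpace (𝔥 : LieSubalgebra ℂ 𝔤) : Type := 𝔥

instance : NormedAddCommGroup (CartanSpace 𝔥) := inferInstanceAs (NormedAddCommGroup 𝔥)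

instance : NormedSpace ℂ (CartanSpace 𝔥) := inferInstanceAs (NormedSpace ℂ 𝔥)

instance : FiniteDimensional ℂ (CartanSpace 𝔥) := inferInstanceAs (FiniteDimensional ℂ 𝔥)

instance completeSpace_cartan : CompleteSpace (CartanSpace 𝔥) :=
  FiniteDimensional.complete ℂ (CartanSpace 𝔥)

-- A linear projection onto `𝔤` is applied pointwise. Composing with it turns a smooth map into
-- `M_n(A_w)` with values in `L𝔤` into a smooth map into the Banach space `L𝔤`.
variable (𝔤 w) in
theorem exists_projection : ∃ π : MatWiener n w →L[ℂ] loopAlgebra 𝔤 w,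
    ∀ x : loopAlgebra 𝔤 w, π x = x := by
  obtain ⟨P, hP⟩ := 𝔤.toSubmodule.subtype.exists_leftInverse_of_injective
    (LinearMap.ker_eq_bot.2 Subtype.val_injective)
  refine ⟨(MatWiener.applyLin (𝔤.toSubmodule.subtype.comp P)).codRestrict (loopAlgebra 𝔤 w)
    fun x z => ?_, fun x => Subtype.ext (MatWiener.ext_eval fun z => ?_)⟩
  · have h' := MatWiener.eval_applyLin (𝔤.toSubmodule.subtype.comp P) x z
    rw [h']
    exact (P (x.eval z)).2
  · have h : P (x.1.eval z) = ⟨x.1.eval z, x.2 z⟩ := LinearMap.congr_fun hP ⟨_, x.2 z⟩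
    have h' := MatWiener.eval_applyLin (𝔤.toSubmodule.subtype.comp P) x.1 z
    rw [LinearMap.comp_apply, h] at h'
    exact h'

/-- The inclusion of `𝔥` in the loops through constant loops. -/
def cartanConst (w : Weight) (𝔥 : LieSubalgebra ℂ 𝔤) : CartanSpace 𝔥 →L[ℂ] MatWiener n w :=
  LinearMap.toContinuousLinearMap
    { toFun := fun h => MatWiener.const w (cmat h)
      map_add' := fun a b => MatWiener.const_add (cmat a) (cmat b)
      map_smul' := fun c a => MatWiener.const_smul c (cmat a) }

theorem cartanConst_apply (h : CartanSpace 𝔥) :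
    cartanConst w 𝔥 h = MatWiener.const w (cmat (𝔥 := 𝔥) h) := rfl

/-- The gauge action of `exp u` on a constant loop in `𝔥`. -/
def gaugeMap (w : Weight) (𝔥 : LieSubalgebra ℂ 𝔤) :
    MatWiener n w.diff × CartanSpace 𝔥 × ℂ → MatWiener n w :=
  sliceMap (MatWiener.incl n w) (MatWiener.deriv n w) (cartanConst w 𝔥)

theorem eval_exp_mem {u : MatWiener n w.diff} [LieAlgebra.IsSimple ℂ 𝔤]
    (hu : u ∈ loopAlgebra 𝔤 w.diff) :
    MatWiener.incl n w (NormedSpace.exp u) ∈ loopGroup 𝔤 w := fun z => by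
  rw [MatWiener.eval_incl, MatWiener.eval_exp]
  exact exists_mat_eq_exp inferInstance (hu z)

theorem eval_conj_exp_mem {u : MatWiener n w.diff} (hu : u ∈ loopAlgebra 𝔤 w.diff)
    {x : MatWiener n w} (hx : x ∈ loopAlgebra 𝔤 w) (z : Circle) :
    (MatWiener.incl n w (NormedSpace.exp u) * x *
      MatWiener.incl n w (NormedSpace.exp (-u))).eval z ∈ 𝔤 := by
  simp only [MatWiener.eval_mul, MatWiener.eval_incl, MatWiener.eval_exp, MatWiener.eval_neg]
  exact exp_conj_mem 𝔤.toSubmodule (fun v hv => 𝔤.lie_mem (hu z) hv) (hx z)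

theorem deriv_mem {u : MatWiener n w.diff} (hu : u ∈ loopAlgebra 𝔤 w.diff) :
    MatWiener.deriv n w u ∈ loopAlgebra 𝔤 w := by
  rw [mem_loopAlgebra_iff_coeff] at hu ⊢
  intro k
  rw [MatWiener.coeff_deriv]
  exact 𝔤.smul_mem _ (hu k)

theorem exp_mul_deriv_exp_mem {u : MatWiener n w.diff} (hu : u ∈ loopAlgebra 𝔤 w.diff) :
    MatWiener.incl n w (NormedSpace.exp u) * MatWiener.deriv n w (NormedSpace.exp (-u)) ∈
      loopAlgebra 𝔤 w := fun z => by
  refine (MatWiener.mem_iff_functional 𝔤.toSubmodule _).2 fun l hl => ?_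
  rw [← MatWiener.eval_applyFunctional]
  refine functional_eq_zero (l := (Wiener.evalL z).comp (MatWiener.applyFunctional l))
    MatWiener.incl_mul MatWiener.incl_one MatWiener.deriv_one MatWiener.deriv_mul u fun s => ?_
  rw [ContinuousLinearMap.comp_apply, Wiener.evalL_apply, MatWiener.eval_applyFunctional]
  exact hl _ (eval_conj_exp_mem (Submodule.smul_mem _ s hu) (deriv_mem hu) z)

theorem gaugeMap_mem {u : MatWiener n w.diff} (hu : u ∈ loopAlgebra 𝔤 w.diff) (y : CartanSpace 𝔥 × ℂ) :
    gaugeMap w 𝔥 (u, y) ∈ loopAlgebra 𝔤 w := by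
  refine Submodule.add_mem _ (eval_conj_exp_mem hu fun z => ?_)
    (Submodule.smul_mem _ _ (exp_mul_deriv_exp_mem hu))
  rw [cartanConst_apply, MatWiener.eval_const]
  exact ((show 𝔥 from y.1) : 𝔤).2

theorem gaugeConj_gaugeMap [LieAlgebra.IsSimple ℂ 𝔤] {u : MatWiener n w.diff}
    (hu : u ∈ loopAlgebra 𝔤 w.diff) (y : CartanSpace 𝔥 × ℂ) {x : ExtLoopAlgebra 𝔤 w}
    (hx : x.1.1 = gaugeMap w 𝔥 (u, y)) (hx' : x.2 = y.2) : GaugeConj (cartanIncl (𝔥 := 𝔥) w y) x := by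
  have hinv : ∀ z, ((MatWiener.incl n w (NormedSpace.exp u)).eval z)⁻¹ =
      (NormedSpace.exp (-u)).eval z := fun z => by
    rw [MatWiener.eval_incl, MatWiener.eval_exp, MatWiener.eval_exp, MatWiener.eval_neg]
    exact Matrix.inv_eq_right_inv (exp_mul_exp_neg _)
  refine ⟨_, eval_exp_mem hu, hx', fun z => ?_⟩
  simp only [hinv]
  rw [hx, gaugeMap, sliceMap]
  simp only [MatWiener.eval_add, MatWiener.eval_mul, MatWiener.eval_smul, MatWiener.eval_incl,
    MatWiener.eval_deriv, cartanConst_apply, MatWiener.eval_const]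
  congr 2
  rw [show (cartanIncl w y).1.1.eval z = cmat y.1 from constLoop_eval w _ z]

end Slice

end LoopToda

end

/-! ### Invertibility of the linearization and the local slice. -/

noncomputable section

namespace LoopToda

open scoped Wiener MatWiener

section Linearization

variable {n : ℕ} {w : Weight} {𝔤 : LieSubalgebra ℂ (Matrix (Fin n) (Fin n) ℂ)}
  {𝔥 : LieSubalgebra ℂ 𝔤} {ξ : 𝔥} {q : ℂ}

/-- The linearization of the gauge action at a constant loop `ξ ∈ 𝔥`. -/
def linGauge (w : Weight) (ξ : 𝔥) (q : ℂ) (u : MatWiener n w.diff) (η : 𝔥) : MatWiener n w :=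
  MatWiener.incl n w u * MatWiener.const w (cmat ξ) -
    MatWiener.const w (cmat ξ) * MatWiener.incl n w u + MatWiener.const w (cmat η) -
      q • MatWiener.deriv n w u

theorem coeff_linGauge (u : MatWiener n w.diff) (η : 𝔥) (k : ℤ) :
    (linGauge w ξ q u η).coeff k = u.coeff k * cmat ξ - cmat ξ * u.coeff k +
      (if k = 0 then cmat η else 0) - (q * k) • u.coeff k := by
  simp only [linGauge, MatWiener.coeff_sub, MatWiener.coeff_add, MatWiener.coeff_mul_const,
    MatWiener.coeff_const_mul, MatWiener.coeff_const, MatWiener.coeff_smul, MatWiener.coeff_incl,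
    MatWiener.coeff_deriv, smul_smul]

theorem cmat_injective {η : 𝔥} (h : cmat η = 0) : η = 0 :=
  Subtype.ext (Subtype.ext h)

theorem linGauge_mem {u : MatWiener n w.diff} (hu : u ∈ loopAlgebra 𝔤 w.diff) (η : 𝔥) :
    linGauge w ξ q u η ∈ loopAlgebra 𝔤 w := by
  rw [mem_loopAlgebra_iff_coeff] at hu ⊢
  intro k
  rw [coeff_linGauge]
  refine 𝔤.sub_mem (𝔤.add_mem (sub_mem_of_mem (hu k) ξ.1.2) ?_) (𝔤.smul_mem _ (hu k))
  split_ifs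
  · exact η.1.2
  · exact 𝔤.zero_mem

/-- The commutator has norm at most `2‖A‖‖x‖`, hence at most half of `‖q‖ k ‖x‖`, and is absorbed;
this costs a factor 2, and `1 + k ≤ 2k` costs another. -/
theorem norm_le_of_mode {x v : Matrix (Fin n) (Fin n) ℂ} {A : Matrix (Fin n) (Fin n) ℂ} {q : ℂ}
    {k : ℝ} (hk : 1 ≤ k) (hk' : 4 * ‖A‖ ≤ ‖q‖ * k) (c : ℂ) (hc : ‖c‖ = ‖q‖ * k)
    (h : x * A - A * x - c • x = v) : ‖q‖ * ((1 + k) * ‖x‖) ≤ 4 * ‖v‖ := by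
  have h1 : c • x = (x * A - A * x) - v := by rw [← h]; abel
  have h2 : ‖q‖ * k * ‖x‖ ≤ ‖x‖ * ‖A‖ + ‖A‖ * ‖x‖ + ‖v‖ := by
    rw [← hc, ← norm_smul, h1]
    refine (norm_sub_le _ _).trans (add_le_add_left ((norm_sub_le _ _).trans ?_) _)
    exact add_le_add (Matrix.frobenius_norm_mul _ _) (Matrix.frobenius_norm_mul _ _)
  have hq := norm_nonneg q
  have hx := norm_nonneg x
  have h3 := mul_le_mul_of_nonneg_right hk' hx
  have h4 := mul_le_mul_of_nonneg_left hk (mul_nonneg hq hx)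
  nlinarith

theorem tendsto_abs_int_cofinite :
    Filter.Tendsto (fun k : ℤ => |(k : ℝ)|) Filter.cofinite Filter.atTop := by
  rw [Int.cofinite_eq]
  exact Filter.Tendsto.sup
    (Filter.tendsto_abs_atBot_atTop.comp (tendsto_intCast_atBot_iff.2 Filter.tendsto_id))
    (Filter.tendsto_abs_atTop_atTop.comp (tendsto_intCast_atTop_atTop))

variable [LieAlgebra.IsSimple ℂ 𝔤] [𝔥.IsCartanSubalgebra]

theorem RegPoint.eq_zero_of_linGauge (h : RegPoint (ξ, q)) {u : MatWiener n w.diff}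
    (hu : u ∈ sliceSpace w ξ) {η : 𝔥} (h0 : linGauge w ξ q u η = 0) : u = 0 ∧ η = 0 := by
  obtain ⟨hu, hu0⟩ := mem_sliceSpace.1 hu
  rw [mem_loopAlgebra_iff_coeff] at hu
  have hk : ∀ k, u.coeff k * cmat ξ - cmat ξ * u.coeff k +
      (if k = 0 then cmat η else 0) - (q * k) • u.coeff k = 0 := fun k => by
    rw [← coeff_linGauge, h0, MatWiener.coeff_zero]
  have h1 : u.coeff 0 * cmat ξ - cmat ξ * u.coeff 0 + cmat η = 0 := by simpa using hk 0
  have h2 : u.coeff 0 * cmat ξ - cmat ξ * u.coeff 0 = 0 := by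
    refine h.eq_zero_of_mem ⟨_, hu 0, rfl⟩ ?_
    rw [eq_neg_of_add_eq_zero_left h1]
    exact (cartanMat 𝔥).neg_mem (coe_mem_cartanMat η)
  have h3 : u.coeff 0 = 0 := h.eq_zero_of_mem hu0
    (h.mem_of_eigenvector (hu 0) 0 (by simpa using h2))
  refine ⟨MatWiener.ext_coeff fun k => ?_, cmat_injective (by simpa [h2] using h1)⟩
  rw [MatWiener.coeff_zero]
  by_cases hk0 : k = 0
  · rw [hk0, h3]
  · refine h.eq_zero_of_mode hk0 (hu k) ?_
    simpa [hk0] using hk k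

/-- The equation is solved mode by mode. The factor `1 + |k|` gained for large `|k|` is exactly the
ratio of the weights `w.diff` and `w`, so the solution belongs to the smaller space; the finitely
many other modes do not affect summability. -/
theorem RegPoint.exists_linGauge_eq (h : RegPoint (ξ, q)) {v : MatWiener n w}
    (hv : v ∈ loopAlgebra 𝔤 w) : ∃ u ∈ sliceSpace w ξ, ∃ η : 𝔥, linGauge w ξ q u η = v := by
  have hvk := mem_loopAlgebra_iff_coeff.1 hv
  obtain ⟨x₀, hx₀, η, hη⟩ := h.exists_mode_zero (hvk 0)
  have hex : ∀ k : ℤ, ∃ x ∈ 𝔤, (k = 0 → x = x₀) ∧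
      (k ≠ 0 → x * cmat ξ - cmat ξ * x - (q * k) • x = v.coeff k) := fun k => by
    by_cases hk : k = 0
    · exact ⟨x₀, mem_of_mem_adRange hx₀, fun _ => rfl, fun h => absurd hk h⟩
    · obtain ⟨x, hx, hx'⟩ := h.exists_mode hk (hvk k)
      exact ⟨x, hx, fun h => absurd h hk, fun _ => hx'⟩
  choose a ha ha0 hak using hex
  have hq : 0 < ‖q‖ := norm_pos_iff.2 h.1
  have hsum : Summable fun k => ‖a k‖ * w.diff k := by
    refine Summable.of_norm_bounded_eventually
      (v.summable_norm_coeff.mul_left (4 / ‖q‖)) ?_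
    filter_upwards [tendsto_abs_int_cofinite.eventually_ge_atTop 1,
      tendsto_abs_int_cofinite.eventually_ge_atTop (4 * ‖cmat ξ‖ / ‖q‖)] with k hk1 hk2
    have hk0 : k ≠ 0 := by
      rintro rfl
      norm_num at hk1
    have h1 := norm_le_of_mode hk1 (by rwa [div_le_iff₀' hq] at hk2) (q * k)
      (by rw [norm_mul, Complex.norm_intCast]) (hak k hk0)
    rw [Real.norm_of_nonneg (mul_nonneg (norm_nonneg _) (w.diff.pos' k).le), Weight.diff_apply]
    have h2 : (1 + |(k : ℝ)|) * ‖a k‖ ≤ 4 / ‖q‖ * ‖v.coeff k‖ := by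
      rw [div_mul_eq_mul_div, le_div_iff₀' hq]
      exact h1
    have h3 := mul_le_mul_of_nonneg_right h2 (w.pos' k).le
    linarith
  obtain ⟨u, hu⟩ := MatWiener.exists_coeff_eq a hsum
  refine ⟨u, mem_sliceSpace.2 ⟨mem_loopAlgebra_iff_coeff.2 fun k => ?_, ?_⟩, η,
    MatWiener.ext_coeff fun k => ?_⟩
  · rw [hu]
    exact ha k
  · rw [hu, ha0 0 rfl]
    exact hx₀
  · rw [coeff_linGauge, hu]
    by_cases hk : k = 0
    · subst hk
      rw [ha0 0 rfl, ← hη]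
      simp
    · rw [if_neg hk, add_zero, hak k hk]

/-- The inverse function theorem applies to `Φ`, and the Cartan component of its local inverse is
the required map. -/
theorem RegPoint.exists_slice (h : RegPoint (ξ, q)) :
    ∃ g : ExtLoopAlgebra 𝔤 w → CartanSpace 𝔥 × ℂ, g (cartanIncl w (ξ, q)) = (ξ, q) ∧
      (∀ᶠ x in nhds (cartanIncl w (ξ, q)), ContDiffAt ℝ ∞ g x) ∧
      ∀ᶠ x in nhds (cartanIncl w (ξ, q)), GaugeConj (cartanIncl (𝔥 := 𝔥) w (g x)) x := by
  obtain ⟨π, hπ⟩ := exists_projection w 𝔤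
  set j : (sliceSpace w ξ × CartanSpace 𝔥 × ℂ) →L[ℂ] MatWiener n w.diff × CartanSpace 𝔥 × ℂ :=
    (sliceSpace w ξ).subtypeL.prodMap (ContinuousLinearMap.id ℂ _) with hj
  set r : (sliceSpace w ξ × CartanSpace 𝔥 × ℂ) →L[ℂ] ℂ :=
    (ContinuousLinearMap.snd ℂ _ _).comp (ContinuousLinearMap.snd ℂ _ _) with hr
  set Φ : sliceSpace w ξ × CartanSpace 𝔥 × ℂ → ExtLoopAlgebra 𝔤 w :=
    fun x => (π (gaugeMap w 𝔥 (j x)), r x) with hΦ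
  obtain ⟨L, hL, hL'⟩ := exists_hasFDerivAt_sliceMap (ι := MatWiener.incl n w)
    (δ := MatWiener.deriv n w) MatWiener.incl_one MatWiener.deriv_one (cartanConst w 𝔥) ξ q
  have hL2 : HasFDerivAt (gaugeMap w 𝔥) L (j (0, ξ, q)) := hL
  have hcd : ContDiff ℂ ω Φ :=
    (π.contDiff.comp ((contDiff_sliceMap _ _ _).comp j.contDiff)).prodMk r.contDiff
  have hder : HasFDerivAt Φ ((π.comp (L.comp j)).prod r) (0, ξ, q) :=
    (π.hasFDerivAt.comp _ (HasFDerivAt.comp (0, ξ, q) hL2 j.hasFDerivAt)).prodMk r.hasFDerivAt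
  have hLj : ∀ x, L (j x) = linGauge w ξ q x.1 x.2.1 := fun x => hL' _
  have hπL : ∀ x, π (L (j x)) = ⟨linGauge w ξ q x.1 x.2.1, linGauge_mem x.1.2.1 _⟩ := fun x => by
    rw [hLj]
    exact hπ ⟨_, linGauge_mem x.1.2.1 _⟩
  have hΦ1 : ∀ x, (Φ x).1.1 = gaugeMap w 𝔥 (x.1, x.2) := fun x =>
    congrArg Subtype.val (hπ ⟨_, gaugeMap_mem x.1.2.1 x.2⟩)
  have hΦ0 : Φ (0, ξ, q) = cartanIncl w (ξ, q) := by
    refine Prod.ext (Subtype.ext ?_) rfl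
    rw [hΦ1, gaugeMap, sliceMap]
    simp [NormedSpace.exp_zero]
    rfl
  have hinj : ∀ x, (π.comp (L.comp j)).prod r x = 0 → x = 0 := by
    rintro ⟨u, η, s⟩ h0
    have h1 : π (L (j (u, η, s))) = 0 := congrArg Prod.fst h0
    have h2 : s = 0 := congrArg Prod.snd h0
    rw [hπL] at h1
    obtain ⟨h3, h4⟩ := h.eq_zero_of_linGauge u.2 (congrArg Subtype.val h1)
    exact Prod.ext (Subtype.ext h3) (Prod.ext h4 h2)
  have hsurj : Function.Surjective ((π.comp (L.comp j)).prod r) := by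
    rintro ⟨v, s⟩
    obtain ⟨u, hu, η, huη⟩ := h.exists_linGauge_eq v.2
    exact ⟨(⟨u, hu⟩, η, s), Prod.ext ((hπL _).trans (Subtype.ext huη)) rfl⟩
  obtain ⟨g, hg0, hg1, hg2⟩ := exists_local_inverse hcd hder hinj hsurj
  rw [hΦ0] at hg0 hg1 hg2
  refine ⟨fun x => (g x).2, congrArg Prod.snd hg0, ?_, ?_⟩
  · filter_upwards [hg1] with x hx
    exact contDiff_snd.contDiffAt.comp x hx
  · filter_upwards [hg2] with x hx
    refine gaugeConj_gaugeMap (g x).1.2.1 (g x).2 ?_ ?_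
    · rw [← hΦ1, hx]
    · exact (congrArg Prod.snd hx).symm

end Linearization

end LoopToda

end

/-! ### Local injectivity on `𝔥 × ℂ`, and extension along gauge orbits. -/

noncomputable section

namespace LoopToda

open scoped Wiener MatWiener

section LocalInjectivity

variable {n : ℕ} {w : Weight} {𝔤 : LieSubalgebra ℂ (Matrix (Fin n) (Fin n) ℂ)}
  {𝔥 : LieSubalgebra ℂ 𝔤} {ξ : 𝔥} {q : ℂ}

theorem cmat_logMonodromy (y : 𝔥 × ℂ) : cmat (logMonodromy y) =
    ((2 * Real.pi : ℝ) / (Complex.I * y.2) : ℂ) • cmat y.1 := rfl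

theorem continuousAt_logMonodromy (hq : q ≠ 0) :
    ContinuousAt (logMonodromy : 𝔥 × ℂ → 𝔥) (ξ, q) := by
  have hind : Topology.IsInducing (fun h : 𝔥 => cmat h) :=
    Topology.IsInducing.subtypeVal.comp Topology.IsInducing.subtypeVal
  rw [hind.continuousAt_iff]
  change ContinuousAt (fun y : 𝔥 × ℂ =>
    ((2 * Real.pi : ℝ) / (Complex.I * y.2) : ℂ) • cmat y.1) (ξ, q)
  refine ContinuousAt.smul (continuousAt_const.div (continuousAt_const.mul continuousAt_snd)
    (mul_ne_zero Complex.I_ne_zero hq)) ?_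
  exact continuous_coe_cartan.continuousAt.comp continuousAt_fst

theorem logMonodromy_injective {y y' : 𝔥 × ℂ} (h2 : y.2 = y'.2) (hy : y.2 ≠ 0)
    (h : logMonodromy y = logMonodromy y') : y = y' := by
  refine Prod.ext ?_ h2
  have hc : ((2 * Real.pi : ℝ) / (Complex.I * y.2) : ℂ) ≠ 0 :=
    div_ne_zero (by exact_mod_cast Real.two_pi_pos.ne') (mul_ne_zero Complex.I_ne_zero hy)
  have h1 := congrArg cmat h
  rw [cmat_logMonodromy, cmat_logMonodromy, ← h2] at h1
  exact Subtype.ext (Subtype.ext (smul_right_injective _ hc h1))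

variable [LieAlgebra.IsSimple ℂ 𝔤] [𝔥.IsCartanSubalgebra]

omit [𝔥.IsCartanSubalgebra] in
theorem exists_mat_eq_exp_cmat (h : 𝔥) :
    ∃ c : linGroup 𝔤, linGroup.mat c = NormedSpace.exp (cmat h) :=
  exists_mat_eq_exp inferInstance h.1.2

theorem eventually_regular_pair (h : RegPoint (ξ, q)) :
    ∀ᶠ p : (𝔥 × ℂ) × 𝔥 × ℂ in nhds ((ξ, q), (ξ, q)), p.1.2 ≠ 0 ∧
      (∀ g : linGroup 𝔤, linGroup.mat g * NormedSpace.exp (cmat (logMonodromy p.1)) *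
        linGroup.mat g⁻¹ = NormedSpace.exp (cmat (logMonodromy p.2)) →
      linGroup.mat g * NormedSpace.exp (cmat (logMonodromy (ξ, q))) *
        linGroup.mat g⁻¹ = NormedSpace.exp (cmat (logMonodromy (ξ, q)))) ∧
      (NormedSpace.exp (cmat (logMonodromy p.1)) = NormedSpace.exp (cmat (logMonodromy p.2)) →
        logMonodromy p.1 = logMonodromy p.2) := by
  have hc1 : Filter.Tendsto (fun p : (𝔥 × ℂ) × 𝔥 × ℂ => logMonodromy p.1)
      (nhds ((ξ, q), (ξ, q))) (nhds (logMonodromy (ξ, q))) :=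
    (continuousAt_logMonodromy h.1).tendsto.comp continuousAt_fst
  have hc2 : Filter.Tendsto (fun p : (𝔥 × ℂ) × 𝔥 × ℂ => logMonodromy p.2)
      (nhds ((ξ, q), (ξ, q))) (nhds (logMonodromy (ξ, q))) :=
    (continuousAt_logMonodromy h.1).tendsto.comp continuousAt_snd
  have hsub : Filter.Tendsto (fun p : (𝔥 × ℂ) × 𝔥 × ℂ =>
      cmat (logMonodromy p.1) - cmat (logMonodromy p.2)) (nhds ((ξ, q), (ξ, q))) (nhds 0) := by
    have h1 := ((continuous_coe_cartan (𝔥 := 𝔥)).tendsto _).comp hc1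
    have h2 := ((continuous_coe_cartan (𝔥 := 𝔥)).tendsto _).comp hc2
    simpa using h1.sub h2
  have hne : ∀ᶠ p : (𝔥 × ℂ) × 𝔥 × ℂ in nhds ((ξ, q), (ξ, q)), p.1.2 ≠ 0 :=
    (continuous_snd.comp continuous_fst).continuousAt.eventually_ne h.1
  filter_upwards [hne, hc2.eventually (eventually_infReg h.2),
    (hc1.prodMk_nhds hc2).eventually (eventually_conj_fixes (logMonodromy (ξ, q))),
    hsub.eventually eventually_eq_zero_of_exp_eq_one] with p hp0 hp1 hp2 hp3
  refine ⟨hp0, hp2 hp1, fun he => ?_⟩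
  refine Subtype.ext (Subtype.ext (sub_eq_zero.1 (hp3 ?_)))
  -- Since `𝔥` is abelian, equal exponentials give `exp` of the difference equal to 1, and the
  -- difference is small.
  have hcomm : Commute (cmat (logMonodromy p.1)) (-cmat (logMonodromy p.2)) :=
    (cartanMat_commute (coe_mem_cartanMat _) (coe_mem_cartanMat _)).neg_right
  rw [sub_eq_add_neg, exp_add hcomm, he, exp_mul_exp_neg]

omit [LieAlgebra.IsSimple ℂ 𝔤] [𝔥.IsCartanSubalgebra] in
theorem conj_eq_of_mul_eq {a c c' : linGroup 𝔤} {h h' : 𝔥}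
    (hc : linGroup.mat c = NormedSpace.exp (cmat h))
    (hc' : linGroup.mat c' = NormedSpace.exp (cmat h')) (ha : a * c * a⁻¹ = c') :
    linGroup.mat a * NormedSpace.exp (cmat h) * linGroup.mat a⁻¹ =
      NormedSpace.exp (cmat h') := by
  rw [← hc, ← hc', ← ha, linGroup.mat_mul, linGroup.mat_mul]

/-- Any `a` conjugating the monodromies of two points of `V` fixes `c₀`, hence lies in the Cartan
subgroup. For a single point this bounds its centralizer and gives regularity; for two points `a`
commutes with the monodromies, so they coincide. -/
theorem exists_nhds_regular (h : RegPoint (ξ, q)) {c₀ : linGroup 𝔤}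
    (hc₀ : linGroup.mat c₀ = NormedSpace.exp (cmat (logMonodromy (ξ, q))))
    (hZ : ∀ g, c₀ * g = g * c₀ → g ∈ cartanSubgroup 𝔥) :
    ∃ V ∈ nhds (ξ, q), (∀ y ∈ V, LoopRegular 𝔥 (cartanIncl w y)) ∧
      ∀ y ∈ V, ∀ y' ∈ V, GaugeConj (cartanIncl w y) (cartanIncl w y') → y = y' := by
  have h1 := eventually_regular_pair h
  rw [nhds_prod_eq] at h1
  -- A square neighbourhood, so that the pair condition also covers the diagonal.
  obtain ⟨V, hV, hVV⟩ := Filter.mem_prod_self_iff.1 h1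
  have key : ∀ y ∈ V, ∀ y' ∈ V, ∀ (c c' : linGroup 𝔤),
      linGroup.mat c = NormedSpace.exp (cmat (logMonodromy y)) →
      linGroup.mat c' = NormedSpace.exp (cmat (logMonodromy y')) → ∀ a, a * c * a⁻¹ = c' →
      a ∈ cartanSubgroup 𝔥 := by
    intro y hy y' hy' c c' hc hc' a ha
    have h2 := (hVV (Set.mk_mem_prod hy hy')).2.1 a (conj_eq_of_mul_eq hc hc' ha)
    refine hZ a ?_
    have h3 : a * c₀ * a⁻¹ = c₀ := linGroup.mat_injective (by
      rw [linGroup.mat_mul, linGroup.mat_mul, hc₀]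
      exact h2)
    exact (mul_inv_eq_iff_eq_mul.1 h3).symm
  have hcomm : ∀ (y : 𝔥 × ℂ) (c : linGroup 𝔤),
      linGroup.mat c = NormedSpace.exp (cmat (logMonodromy y)) → c ∈ cartanSubgroup 𝔥 :=
    fun y c hc => mem_cartanSubgroup_of_exp (coe_mem_cartanMat _) hc
  refine ⟨V, hV, fun y hy => ⟨(hVV (Set.mk_mem_prod hy hy)).1, ?_⟩, fun y hy y' hy' hg => ?_⟩
  · obtain ⟨c, hc⟩ := exists_mat_eq_exp_cmat (logMonodromy y)
    refine ⟨c, isMonodromy_cartanIncl y hc, isRegularElement_of_centralizer_eq ?_⟩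
    ext g
    rw [mem_centralizer_singleton]
    refine ⟨fun hg => key y hy y hy c c hc hc g ?_, fun hg =>
      commute_cartanSubgroup (hcomm y c hc) hg⟩
    rw [← hg, mul_inv_cancel_right]
  · obtain ⟨c, hc⟩ := exists_mat_eq_exp_cmat (logMonodromy y)
    obtain ⟨c', hc'⟩ := exists_mat_eq_exp_cmat (logMonodromy y')
    obtain ⟨hp0, -, hp⟩ := hVV (Set.mk_mem_prod hy hy')
    obtain ⟨a, ha⟩ := IsMonodromy.gauge hg hp0 (isMonodromy_cartanIncl y hc)
    have h2 := IsMonodromy.unique ha (isMonodromy_cartanIncl y' hc')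
    have h3 : c = c' := by
      rw [← h2, commute_cartanSubgroup (key y hy y' hy' c c' hc hc' a h2) (hcomm y c hc),
        mul_inv_cancel_right]
    refine logMonodromy_injective ?_ hp0 (hp (by rw [← hc, ← hc', h3]))
    obtain ⟨_, _, h4, _⟩ := hg
    exact h4.symm

omit [LieAlgebra.IsSimple ℂ 𝔤] [𝔥.IsCartanSubalgebra] in
theorem LoopRegular.of_gaugeConj {x y : ExtLoopAlgebra 𝔤 w} (hx : LoopRegular 𝔥 x)
    (h : GaugeConj x y) : LoopRegular 𝔥 y := by
  obtain ⟨hx0, M, hM, hreg⟩ := hx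
  obtain ⟨a, ha⟩ := hM.gauge h hx0
  obtain ⟨_, _, h2, _⟩ := h
  exact ⟨h2 ▸ hx0, _, ha, isRegularElement_conj a hreg⟩

omit [𝔥.IsCartanSubalgebra] in
theorem LoopRegular.exists_isRegularElement (h : LoopRegular 𝔥 (cartanIncl w (ξ, q))) :
    ∃ c₀ : linGroup 𝔤, linGroup.mat c₀ = NormedSpace.exp (cmat (logMonodromy (ξ, q))) ∧
      IsRegularElement 𝔥 c₀ := by
  obtain ⟨-, M, hM, hreg⟩ := h
  obtain ⟨c, hc⟩ := exists_mat_eq_exp_cmat (logMonodromy (ξ, q))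
  rw [hM.unique (isMonodromy_cartanIncl (ξ, q) hc)] at hreg
  exact ⟨c, hc, hreg⟩

theorem exists_slice_map (h : LoopRegular 𝔥 (cartanIncl w (ξ, q))) :
    ∃ (N : Set (ExtLoopAlgebra 𝔤 w)) (g : ExtLoopAlgebra 𝔤 w → CartanSpace 𝔥 × ℂ),
      IsOpen N ∧ cartanIncl w (ξ, q) ∈ N ∧ g (cartanIncl w (ξ, q)) = (ξ, q) ∧
      (∀ x ∈ N, ContDiffAt ℝ ∞ g x) ∧
      (∀ x ∈ N, GaugeConj (cartanIncl (𝔥 := 𝔥) w (g x)) x) ∧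
      (∀ x ∈ N, LoopRegular 𝔥 x) ∧
      ∀ x ∈ N, ∀ y ∈ N, GaugeConj x y → g x = g y := by
  obtain ⟨c₀, hc₀, hreg⟩ := h.exists_isRegularElement
  have hpt : RegPoint (ξ, q) := ⟨h.1, infReg_of_isRegularElement hc₀ hreg⟩
  obtain ⟨V, hV, hV1, hV2⟩ := exists_nhds_regular (w := w) hpt hc₀
    fun g hg => mem_cartanSubgroup_of_isRegularElement hc₀ hreg hg
  obtain ⟨g, hg0, hg1, hg2⟩ := hpt.exists_slice (w := w)
  have hcont : Filter.Tendsto g (nhds (cartanIncl w (ξ, q))) (nhds (ξ, q)) := by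
    have h1 := hg1.self_of_nhds.continuousAt.tendsto
    rwa [hg0] at h1
  obtain ⟨N, hN, hNo, hxN⟩ := mem_nhds_iff.1 ((hg1.and hg2).and (hcont.eventually hV))
  refine ⟨N, g, hNo, hxN, hg0, fun x hx => (hN hx).1.1, fun x hx => (hN hx).1.2, fun x hx =>
    (hV1 _ (hN hx).2).of_gaugeConj (hN hx).1.2, fun x hx y hy hxy => ?_⟩
  exact hV2 _ (hN hx).2 _ (hN hy).2 (((hN hx).1.2.trans hxy).trans (hN hy).1.2.symm)

theorem exists_invariant_map (h : LoopRegular 𝔥 (cartanIncl w (ξ, q))) :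
    ∃ (U : Set (ExtLoopAlgebra 𝔤 w)) (η : ExtLoopAlgebra 𝔤 w → CartanSpace 𝔥 × ℂ),
      IsOpen U ∧ cartanIncl w (ξ, q) ∈ U ∧ (∀ x ∈ U, LoopRegular 𝔥 x) ∧
      (∀ x ∈ U, ∀ y, GaugeConj x y → y ∈ U) ∧ ContDiffOn ℝ ∞ η U ∧
      (∀ x ∈ U, ∀ y, GaugeConj x y → η y = η x) ∧ η (cartanIncl w (ξ, q)) = (ξ, q) ∧
      ∀ x ∈ U, GaugeConj x (cartanIncl (𝔥 := 𝔥) w (η x)) := by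
  classical
  obtain ⟨N, g, hNo, hxN, hg0, hg1, hg2, hg3, hg4⟩ := exists_slice_map h
  let U : Set (ExtLoopAlgebra 𝔤 w) := {x | ∃ y ∈ N, GaugeConj y x}
  let η : ExtLoopAlgebra 𝔤 w → CartanSpace 𝔥 × ℂ := fun x =>
    -- The representative in `N` is arbitrary, since `g` agrees on gauge-conjugate elements of `N`;
    -- the value 0 off `U` plays no role.
    if hx : x ∈ U then g hx.choose else 0
  have hη : ∀ x, ∀ y ∈ N, GaugeConj y x → η x = g y := by
    intro x y hy hyx
    have hx : x ∈ U := ⟨y, hy, hyx⟩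
    simp only [η, dif_pos hx]
    exact hg4 _ hx.choose_spec.1 y hy (hx.choose_spec.2.trans hyx.symm)
  have hU : ∀ x ∈ U, LoopRegular 𝔥 x := by
    rintro x ⟨y, hy, hyx⟩
    exact (hg3 y hy).of_gaugeConj hyx
  have hloc : ∀ x ∈ U, ∃ A : ExtLoopAlgebra 𝔤 w →L[ℂ] ExtLoopAlgebra 𝔤 w, A x ∈ N ∧
      ∀ v, GaugeConj v (A v) := by
    intro x hx
    obtain ⟨y, hy, hyx⟩ := id hx
    obtain ⟨A, rfl, hA⟩ := hyx.symm.exists_continuousLinearMap (hU x hx).1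
    exact ⟨A, hy, hA⟩
  refine ⟨U, η, isOpen_iff_mem_nhds.2 fun x hx => ?_, ⟨_, hxN, GaugeConj.refl _⟩, hU, ?_, ?_, ?_,
    ?_, ?_⟩
  · obtain ⟨A, hAx, hA⟩ := hloc x hx
    filter_upwards [A.continuous.continuousAt.preimage_mem_nhds (hNo.mem_nhds hAx)] with v hv
    exact ⟨A v, hv, (hA v).symm⟩
  · rintro x ⟨y, hy, hyx⟩ v hxv
    exact ⟨y, hy, hyx.trans hxv⟩
  · intro x hx
    obtain ⟨A, hAx, hA⟩ := hloc x hx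
    -- Near `x` the extension equals `g ∘ A` with `A` a continuous linear gauge transformation
    -- moving `x` into `N`.
    refine ContDiffAt.contDiffWithinAt ?_
    have h1 : ContDiffAt ℝ ∞ (fun v => g (A v)) x :=
      (hg1 _ hAx).comp x (A.contDiff.contDiffAt.restrict_scalars ℝ)
    refine h1.congr_of_eventuallyEq ?_
    filter_upwards [A.continuous.continuousAt.preimage_mem_nhds (hNo.mem_nhds hAx)] with v hv
    exact hη v (A v) hv (hA v).symm
  · rintro x ⟨y, hy, hyx⟩ v hxv
    rw [hη x y hy hyx, hη v y hy (hyx.trans hxv)]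
  · rw [hη _ _ hxN (GaugeConj.refl _), hg0]
  · rintro x ⟨y, hy, hyx⟩
    rw [hη x y hy hyx]
    exact hyx.symm.trans (hg2 y hy).symm

end LocalInjectivity

end LoopToda

end

theorem mainTheorem8 {n : ℕ} (w : LoopToda.Weight)
    (𝔤 : LieSubalgebra ℂ (Matrix (Fin n) (Fin n) ℂ)) (_hsimple : LieAlgebra.IsSimple ℂ 𝔤)
    (_hsc : SimplyConnectedSpace (LoopToda.linGroup 𝔤))
    (𝔥 : LieSubalgebra ℂ 𝔤) (_hcartan : 𝔥.IsCartanSubalgebra)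
    (ψ : LoopToda.loopAlgebra 𝔤 w) (q : ℂ) (_hreg : LoopToda.LoopRegular 𝔥 (ψ, q))
    (ξ : 𝔥) (_hconj : LoopToda.GaugeConj (ψ, q) (LoopToda.cartanIncl w (ξ, q))) :
    ∃ (U : Set (LoopToda.ExtLoopAlgebra 𝔤 w)) (η : LoopToda.ExtLoopAlgebra 𝔤 w → 𝔥 × ℂ),
      IsOpen U ∧ (ψ, q) ∈ U ∧
      (∀ x ∈ U, LoopToda.LoopRegular 𝔥 x) ∧
      (∀ x ∈ U, ∀ y, LoopToda.GaugeConj x y → y ∈ U) ∧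
      (∀ x ∈ U, (η x).2 ≠ 0) ∧
      ContDiffOn ℝ ∞ η U ∧
      (∀ x ∈ U, ∀ y, LoopToda.GaugeConj x y → η y = η x) ∧
      η (ψ, q) = (ξ, q) ∧
      (∀ x ∈ U, LoopToda.GaugeConj x (LoopToda.cartanIncl w (η x))) := by
  have := _hsimple
  have := _hcartan
  obtain ⟨U, η, hU, hξ, hreg, hinv, hsmooth, hη, hηξ, hg⟩ :=
    LoopToda.exists_invariant_map (_hreg.of_gaugeConj _hconj)
  have hψ := hinv _ hξ _ _hconj.symm
  refine ⟨U, η, hU, hψ, hreg, hinv, fun x hx => ?_, hsmooth, hη, ?_, hg⟩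
  · obtain ⟨_, _, h2, _⟩ := hg x hx
    exact fun h => (hreg x hx).1 (h2.symm.trans h)
  · exact (hη _ hψ _ _hconj).symm.trans hηξ
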